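/- Let $\Sigma$ be a closed, connected, orientable surface, and let $\mathcal P$ be a polygonal subdivision of $\Sigma$, i.e. a cellular decomposition of $\Sigma$ in which the closure of every 2-cell is an embedded polygon with at least two vertices. Let $D$ be a division ring, let $n\ge 0$, and let $\mathbb P^n(D)$ be the left projective space of dimension $n$ over $D$. A realization of $\mathcal P$ in $\mathbb P^n(D)$ assigns a point of $\mathbb P^n(D)$ to each vertex and each edge of $\mathcal P$ so that (i) if an edge $e$ joins vertices $v$ and $w$, the points assigned to $e$, $v$, $w$ are collinear and pairwise distinct; (ii) the points assigned to the vertices of each face are linearly independent. The Menelaus condition holds at a face if the family of points assigned to the edges of that face is linearly dependent. The incidence theorem in $\mathbb P^n(D)$ associated with $\mathcal P$ is the statement: for every realization of $\mathcal P$ in $\mathbb P^n(D)$ and every face $F_0$, if the Menelaus condition holds at all faces other than $F_0$, then it holds at $F_0$. **Theorem.** The incidence theorem in $\mathbb P^n(D)$ associated with $\mathcal P$ holds if and only if at least one of the following conditions is satisfied: 1. $\mathcal P$ has a face with more than $n+1$ vertices; 2. $D$ is a field (i.e. $D$ is commutative); 3. $\Sigma$ is homeomorphic to the sphere $S^2$.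 Moreover, if every face of $\mathcal P$ has at most $n+1$ vertices, $D$ is not commutative, and $\Sigma$ is not a sphere, then for every face $F_0$ of $\mathcal P$ there is a realization of $\mathcal P$ in $\mathbb P^n(D)$ for which the Menelaus condition holds at all faces other than $F_0$ and fails at $F_0$. -/

import Mathlib

open Topology

namespace SurfaceIncidence

open scoped LinearAlgebra.Projectivization

/-! ### Polygonal subdivisions

A cellular decomposition of a space `S` is a CW structure on `S` (Mathlib's `CWComplex`), whose
cells of dimension 0, 1, 2 are the vertices, edges and faces. (`RelCWComplex` is the namespace in
which Mathlib keeps the common API of absolute and relative CW complexes.) -/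

/-- The vertices (0-cells) of a cellular decomposition of `S`. -/
abbrev Vertex (S : Type*) [TopologicalSpace S] [CWComplex (Set.univ : Set S)] :=
  RelCWComplex.cell (Set.univ : Set S) 0

/-- The edges (1-cells) of a cellular decomposition of `S`. -/
abbrev Edge (S : Type*) [TopologicalSpace S] [CWComplex (Set.univ : Set S)] :=
  RelCWComplex.cell (Set.univ : Set S) 1

/-- The faces (2-cells) of a cellular decomposition of `S`. -/
abbrev Face (S : Type*) [TopologicalSpace S] [CWComplex (Set.univ : Set S)] :=
  RelCWComplex.cell (Set.univ : Set S) 2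

/-- The vertices lying on the closed edge `e`, i.e. its endpoints. -/
def Edge.vertices {S : Type*} [TopologicalSpace S] [CWComplex (Set.univ : Set S)]
    (e : Edge S) : Set (Vertex S) :=
  {v | RelCWComplex.openCell 0 v ⊆ RelCWComplex.closedCell 1 e}

/-- The vertices lying on the closed face `f`. -/
def Face.vertices {S : Type*} [TopologicalSpace S] [CWComplex (Set.univ : Set S)]
    (f : Face S) : Set (Vertex S) :=
  {v | RelCWComplex.openCell 0 v ⊆ RelCWComplex.closedCell 2 f}

/-- The edges lying on the closed face `f`. -/
def Face.edges {S : Type*} [TopologicalSpace S] [CWComplex (Set.univ : Set S)]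
    (f : Face S) : Set (Edge S) :=
  {e | RelCWComplex.openCell 1 e ⊆ RelCWComplex.closedCell 2 f}

/-- The point `exp (2πi t / m)` of the unit circle. The standard `m`-gon is the closed unit disk,
with vertices `circlePoint m k` and open sides `circlePoint m '' (k, k + 1)`, `k = 0, …, m - 1`;
this allows `m = 2`. -/
noncomputable def circlePoint (m : ℕ) (t : ℝ) : ℂ :=
  Complex.exp (((2 * Real.pi * t / m : ℝ) : ℂ) * Complex.I)

/-- A presentation of the closure of the face `f` as an embedded polygon with at least two
vertices: an embedding of the standard `m`-gon, `m ≥ 2`, which sends its interior onto the open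
face, its vertices to vertices, and its open sides onto open edges. The counterclockwise
orientation of the standard polygon turns it into an orientation of `f`, for which the side
`side i` runs from `vertex i` to `vertex (finRotate m i)` (that is, `vertex (i + 1)` with `i + 1`
modulo `m`). -/
structure PolygonChart {S : Type*} [TopologicalSpace S] [CWComplex (Set.univ : Set S)]
    (f : Face S) where
  /-- The number of vertices. -/
  m : ℕ
  two_le : 2 ≤ m
  /-- The embedding; only its values on the closed unit disk matter. -/
  toFun : ℂ → S
  continuousOn : ContinuousOn toFun (Metric.closedBall 0 1)
  injOn : Set.InjOn toFun (Metric.closedBall 0 1)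
  image_ball : toFun '' Metric.ball 0 1 = RelCWComplex.openCell 2 f
  vertex : Fin m → Vertex S
  side : Fin m → Edge S
  map_vertex : ∀ i : Fin m, toFun (circlePoint m (i : ℕ)) ∈ RelCWComplex.openCell 0 (vertex i)
  map_side : ∀ i : Fin m,
    toFun '' (circlePoint m '' Set.Ioo ((i : ℕ) : ℝ) ((i : ℕ) + 1)) =
      RelCWComplex.openCell 1 (side i)

/-- The cellular decomposition of `S` is a polygonal subdivision: it has finitely many cells, all
of dimension at most two, and the closure of every 2-cell is an embedded polygon with at least two
vertices. -/
structure IsPolygonalSubdivision (S : Type*) [TopologicalSpace S]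
    [CWComplex (Set.univ : Set S)] : Prop where
  finite : Finite (Σ k, RelCWComplex.cell (Set.univ : Set S) k)
  dim_le_two : ∀ k, 2 < k → IsEmpty (RelCWComplex.cell (Set.univ : Set S) k)
  polygon : ∀ f : Face S, Nonempty (PolygonChart f)

/-- Orientability, read off a polygonal subdivision: the faces can be oriented coherently, i.e. so
that any two different faces with a common edge run through it in opposite directions. -/
def IsOrientable (S : Type*) [TopologicalSpace S] [CWComplex (Set.univ : Set S)] : Prop :=
  ∃ c : ∀ f : Face S, PolygonChart f,
    ∀ f g : Face S, f ≠ g → ∀ (i : Fin (c f).m) (j : Fin (c g).m), (c f).side i = (c g).side j →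
      (c f).vertex i = (c g).vertex (finRotate _ j) ∧
      (c f).vertex (finRotate _ i) = (c g).vertex j

/-- `S` is homeomorphic to the two-dimensional sphere. -/
def IsTwoSphere (S : Type*) [TopologicalSpace S] : Prop :=
  Nonempty (S ≃ₜ Metric.sphere (0 : EuclideanSpace ℝ (Fin 3)) 1)

/-! ### The incidence theorem -/

/-- The left projective space of dimension `n` over the division ring `D`. -/
abbrev ProjSpace (D : Type*) [DivisionRing D] (n : ℕ) := ℙ D (Fin (n + 1) → D)

/-- The assignment of the points `A v` to the vertices `v` and `B e` to the edges `e` is a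
realization of the polygonal subdivision in the `n`-dimensional projective space over `D`. -/
structure IsRealization {S : Type*} [TopologicalSpace S] [CWComplex (Set.univ : Set S)]
    {D : Type*} [DivisionRing D] {n : ℕ}
    (A : Vertex S → ProjSpace D n) (B : Edge S → ProjSpace D n) : Prop where
  /-- If `e` joins `v` and `w`, the three points assigned to `e`, `v`, `w` are distinct and
  collinear. -/
  edge : ∀ (e : Edge S) (v w : Vertex S), v ∈ Edge.vertices e → w ∈ Edge.vertices e → v ≠ w →
    (B e ≠ A v ∧ B e ≠ A w ∧ A v ≠ A w) ∧ Projectivization.Dependent ![B e, A v, A w]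
  /-- The points assigned to the vertices of each face are linearly independent. -/
  face : ∀ f : Face S, Projectivization.Independent fun v : Face.vertices f ↦ A v

/-- The Menelaus condition at the face `f`: the family of the points assigned to the edges of `f`
is linearly dependent. -/
def Menelaus {S : Type*} [TopologicalSpace S] [CWComplex (Set.univ : Set S)]
    {D : Type*} [DivisionRing D] {n : ℕ} (B : Edge S → ProjSpace D n) (f : Face S) : Prop :=
  Projectivization.Dependent fun e : Face.edges f ↦ B e

/-- The incidence theorem in the `n`-dimensional projective space over `D` associated with the
given polygonal subdivision of `S`: for every realization, if the Menelaus condition holds at all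
faces except one, it also holds at the remaining one. -/
def IncidenceTheorem (S : Type*) [TopologicalSpace S] [CWComplex (Set.univ : Set S)]
    (D : Type*) [DivisionRing D] (n : ℕ) : Prop :=
  ∀ (A : Vertex S → ProjSpace D n) (B : Edge S → ProjSpace D n), IsRealization A B →
    ∀ f₀ : Face S, (∀ f, f ≠ f₀ → Menelaus B f) → Menelaus B f₀

end SurfaceIncidence

/-!
Choose vectors `a v` spanning the points of the vertices. The point of an edge from `v` to `w` is
then spanned by `a v - g • a w` for a unit `g` of `D`, and running through the edge backwards
replaces `g` by its inverse. As the vectors at the vertices of a face are independent, the points of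
its edges are dependent exactly if the ordered product of these units around the face, the holonomy
of the face, is one (`linearIndependent_sides_iff`, `menelaus_iff`). Conversely, if the faces have at
most `n + 1` vertices and `D` is infinite, vectors in general position realize every such system of
units (`exists_realization`); a division ring which is not commutative is infinite. The theorem is
thereby a statement about systems of units whose holonomy is trivial at all faces but one.

The combinatorial core is to glue the faces one after the other to the face `f₀` until all of them
form one polygon, whose boundary word contains both sides of each remaining edge
(`PolygonGluing.Merged`). If the holonomy is trivial at the other faces, the holonomy of the word is
that of `f₀` (`Merged.hol_eq`). There are two kinds of words (`folds_or_crossing`). Either the word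
folds up, that is, it is reduced to the empty word by cancelling adjacent opposite sides; then its
holonomy is one. Or it contains sides in the order `a … b … a⁻¹ … b⁻¹`; then there is a system of
units whose holonomy at `f₀` is any prescribed commutator (`exists_hol_eq_commutator`), which
violates the incidence theorem if `D` is not commutative. If `D` is commutative, opposite sides
cancel wherever they stand.

It remains to see that the word folds up exactly if the surface is a sphere. If it folds up, every
cancellation of adjacent sides folds up a closed disk to a disk again, until a disk remains whose
boundary consists of two opposite sides, and this gives a sphere (`IsDisk.merge`, `IsDisk.fold`,
`IsDisk.nonempty_homeomorph_sphere`, `GluedSpace.isTwoSphere`). The inner corner of a fold is not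
glued to another corner since a point of a surface does not disconnect its small neighborhoods
(`IsDisk.corner_notMem`). Conversely, a crossing gives an integral cocycle on the edges which is not
a coboundary (`folds_of_cohomology`); on a sphere there is none, because a cocycle is the winding of
a map to the circle, and maps from the sphere to the circle lift to the real line
(`IsTwoSphere.exists_lift`, `exists_potential_of_isTwoSphere`).

The gluing pattern is read off from the cell structure. Every edge lies in at least two faces: near
a point of an edge lying in fewer faces, the surface would be contained in an interval or, with the
point as an extreme point, in a disk, whereas a loop around a point of a surface is not contained in
a convex set missing the point (`not_exists_convex_chart`). It lies in at most two faces by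
coherence of the orientations (`eq_or_eq`). The faces are connected through their edges, since
finitely many points do not disconnect a connected surface (`exists_crossing_dart`).
-/

namespace SurfaceIncidence

open Set Metric

/-! ### Polygons glued along their sides -/

/-- The list `w` of darts with sources `src` and targets `tgt` is a walk from `x` to `y`. -/
def IsWalk {Δ V : Type*} (src tgt : Δ → V) : V → List Δ → V → Prop
  | x, [], y => x = y
  | x, d :: w, y => src d = x ∧ IsWalk src tgt (tgt d) w y

theorem isWalk_append {Δ V : Type*} {src tgt : Δ → V} {u v : List Δ} {x y : V} :
    IsWalk src tgt x (u ++ v) y ↔ ∃ z, IsWalk src tgt x u z ∧ IsWalk src tgt z v y := by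
  induction u generalizing x with
  | nil => simp [IsWalk]
  | cons d u ih => simp [IsWalk, ih, and_assoc]

/-- The combinatorics of a closed oriented surface glued from polygons. The darts are the sides of
the polygons, each with the direction given by the orientation of its polygon; every dart `d` is
glued to a different dart `opp d`, in opposite directions. -/
structure PolygonGluing (Δ F V : Type*) where
  /-- The dart glued to a given one. -/
  opp : Δ → Δ
  /-- The polygon of a dart. -/
  face : Δ → F
  src : Δ → V
  tgt : Δ → V
  /-- The darts of a polygon, in cyclic order. -/
  bd : F → List Δ
  opp_opp : ∀ d, opp (opp d) = d
  opp_ne : ∀ d, opp d ≠ d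
  mem_bd : ∀ d f, d ∈ bd f ↔ face d = f
  nodup_bd : ∀ f, (bd f).Nodup
  src_opp : ∀ d, src (opp d) = tgt d
  isWalk_bd : ∀ f, ∃ x, IsWalk src tgt x (bd f) x

/-- The holonomy of a group-valued function on darts along a list of darts. -/
def hol {Δ G : Type*} [Monoid G] (g : Δ → G) (w : List Δ) : G := (w.map g).prod

section hol
variable {Δ G : Type*} [Group G] (g : Δ → G)

@[simp] theorem hol_nil : hol g [] = 1 := rfl

@[simp] theorem hol_cons (d : Δ) (w : List Δ) : hol g (d :: w) = g d * hol g w := by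
  simp [hol]

@[simp] theorem hol_append (u v : List Δ) : hol g (u ++ v) = hol g u * hol g v := by
  simp [hol]

theorem hol_congr {g g' : Δ → G} {w : List Δ} (h : ∀ d ∈ w, g d = g' d) : hol g w = hol g' w := by
  unfold hol
  rw [List.map_congr_left h]

theorem hol_eq_one_of_isRotated {w w' : List Δ} (h : w ~r w') (h1 : hol g w = 1) :
    hol g w' = 1 := by
  obtain ⟨n, rfl⟩ := h
  rw [List.rotate_eq_drop_append_take_mod, hol_append]
  rw [← List.take_append_drop (n % w.length) w, hol_append] at h1
  exact mul_eq_one_comm.mp h1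

theorem hol_isRotated_iff {w w' : List Δ} (h : w ~r w') : hol g w = 1 ↔ hol g w' = 1 :=
  ⟨hol_eq_one_of_isRotated g h, hol_eq_one_of_isRotated g h.symm⟩

theorem hol_eq_one {w : List Δ} (h : ∀ d ∈ w, g d = 1) : hol g w = 1 := by
  rw [hol_congr (g' := fun _ ↦ 1) h]
  simp [hol]

end hol

namespace PolygonGluing

variable {Δ F V : Type*} (P : PolygonGluing Δ F V)

theorem tgt_opp (d : Δ) : P.tgt (P.opp d) = P.src d := by
  rw [← P.src_opp, P.opp_opp]

theorem opp_injective : Function.Injective P.opp := fun a b h ↦ by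
  rw [← P.opp_opp a, h, P.opp_opp]

/-- `P.Merged f₀ M w R`: starting from the polygon `f₀`, the polygons in `M` have been glued
together one by one, each along one pair of darts; `R` is the set of darts glued so far, and `w` is
the boundary word of the polygon obtained. -/
inductive Merged (f₀ : F) : Set F → List Δ → Set Δ → Prop
  | base : Merged f₀ {f₀} (P.bd f₀) ∅
  | step {M : Set F} {w₁ w₂ r : List Δ} {d : Δ} {f : F} {R : Set Δ} :
    Merged f₀ M (w₁ ++ d :: w₂) R → f ∉ M → (P.opp d :: r) ~r P.bd f →
      Merged f₀ (insert f M) (w₁ ++ r ++ w₂) (insert d (insert (P.opp d) R))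

variable {P}

theorem face_of_isRotated {r : List Δ} {d : Δ} {f : F} (hr : (d :: r) ~r P.bd f) (x : Δ) :
    (x = d ∨ x ∈ r) ↔ P.face x = f := by
  rw [← P.mem_bd, ← hr.mem_iff, List.mem_cons]

theorem isWalk_of_isRotated {r : List Δ} {d : Δ} {f : F} (hr : (P.opp d :: r) ~r P.bd f) :
    IsWalk P.src P.tgt (P.src d) r (P.tgt d) := by
  obtain ⟨x, hx⟩ := P.isWalk_bd f
  obtain ⟨n, hn⟩ := hr.symm
  rw [List.rotate_eq_drop_append_take_mod] at hn
  rw [← List.take_append_drop (n % (P.bd f).length) (P.bd f), isWalk_append] at hx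
  obtain ⟨z, h1, h2⟩ := hx
  have h : IsWalk P.src P.tgt z (P.opp d :: r) z := by
    rw [← hn, isWalk_append]
    exact ⟨x, h2, h1⟩
  obtain ⟨h3, h4⟩ := h
  rwa [P.tgt_opp, ← h3, P.src_opp] at h4

namespace Merged

variable {f₀ : F} {M : Set F} {w : List Δ} {R : Set Δ}

theorem start_mem (h : P.Merged f₀ M w R) : f₀ ∈ M := by
  induction h with
  | base => rfl
  | step _ _ _ ih => exact Set.mem_insert_of_mem _ ih

theorem face_mem (h : P.Merged f₀ M w R) {x : Δ} (hx : x ∈ R) : P.face x ∈ M := by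
  induction h with
  | base => exact hx.elim
  | @step M w₁ w₂ r d f R h hf hr ih =>
    have hd : P.face (P.opp d) = f := (face_of_isRotated hr _).1 (Or.inl rfl)
    have key : ∀ {M : Set F} {w : List Δ} {R : Set Δ}, P.Merged f₀ M w R →
        ∀ x ∈ w, P.face x ∈ M := by
      intro M w R h
      induction h with
      | base => exact fun x hx ↦ (P.mem_bd _ _).1 hx
      | @step M w₁ w₂ r d f R h hf hr ih =>
        intro x hx
        rw [List.append_assoc, List.mem_append, List.mem_append] at hx
        rcases hx with hx | hx | hx
        · exact Set.mem_insert_of_mem _ (ih x (by simp [hx]))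
        · exact Or.inl ((face_of_isRotated hr _).1 (Or.inr hx))
        · exact Set.mem_insert_of_mem _ (ih x (by simp [hx]))
    rcases hx with rfl | rfl | hx
    · exact Set.mem_insert_of_mem _ (key h _ (by simp))
    · exact Or.inl hd
    · exact Set.mem_insert_of_mem _ (ih hx)

theorem opp_mem (h : P.Merged f₀ M w R) {x : Δ} (hx : x ∈ R) : P.opp x ∈ R := by
  induction h with
  | base => exact hx.elim
  | step h hf hr ih =>
    rcases hx with rfl | rfl | hx
    · exact Or.inr (Or.inl rfl)
    · exact Or.inl (P.opp_opp _)
    · exact Or.inr (Or.inr (ih hx))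

theorem nodup_and_mem_iff (h : P.Merged f₀ M w R) :
    w.Nodup ∧ ∀ x, x ∈ w ↔ P.face x ∈ M ∧ x ∉ R := by
  induction h with
  | base => exact ⟨P.nodup_bd _, fun x ↦ by simp [P.mem_bd]⟩
  | @step M w₁ w₂ r d f R h hf hr ih =>
    obtain ⟨hn, hm⟩ := ih
    have hn' : (P.opp d :: r).Nodup := hr.nodup_iff.2 (P.nodup_bd f)
    have hface := face_of_isRotated hr
    have hdM : P.face d ∈ M := ((hm d).1 (by simp)).1
    have hrf : ∀ x ∈ r, P.face x = f := fun x hx ↦ (hface x).1 (Or.inr hx)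
    have hwM : ∀ x ∈ w₁ ++ d :: w₂, x ∉ r := fun x hx hx' ↦
      hf (hrf x hx' ▸ ((hm x).1 hx).1)
    have hof : P.face (P.opp d) = f := (hface _).1 (Or.inl rfl)
    rw [List.nodup_cons] at hn'
    rw [List.nodup_middle, List.nodup_cons] at hn
    constructor
    · have hp : (w₁ ++ r ++ w₂).Perm (r ++ (w₁ ++ w₂)) := by
        have := (List.perm_append_comm (l₁ := w₁) (l₂ := r)).append_right w₂
        simpa [List.append_assoc] using this
      rw [hp.nodup_iff, List.nodup_append]
      refine ⟨hn'.2, hn.2, ?_⟩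
      rintro a ha b hb rfl
      refine hwM a ?_ ha
      simp only [List.mem_append, List.mem_cons] at hb ⊢
      tauto
    · intro x
      have hx1 := hm x
      have hx2 := hface x
      simp only [List.mem_append, List.mem_cons, Set.mem_insert_iff, not_or] at hx1 hx2 ⊢
      have hxR : x ∈ R → P.face x ∈ M := fun h' ↦ h.face_mem h'
      have hxd : x = d → x ∉ w₁ ∧ x ∉ w₂ := by
        rintro rfl
        simpa using hn.1
      have hxd' : x = d → P.face x ∈ M := by
        rintro rfl
        exact hdM
      have hxo : x = P.opp d → x ∉ r := by
        rintro rfl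
        exact hn'.1
      have hxf : P.face x = f → P.face x ∉ M := fun h' ↦ h'.symm ▸ hf
      by_cases hx : P.face x = f
      · have hxw : x ∉ w₁ ∧ x ∉ w₂ :=
          ⟨fun h' ↦ hxf hx (hx1.1 (Or.inl h')).1, fun h' ↦ hxf hx (hx1.1 (Or.inr (Or.inr h'))).1⟩
        have hxd2 : x ≠ d := fun h' ↦ hxf hx (hxd' h')
        have hxR2 : x ∉ R := fun h' ↦ hxf hx (hxR h')
        simp only [hx, hxw.1, hxw.2, hxd2, hxR2, true_or, false_or, or_false, true_and,
          not_false_eq_true, and_true]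
        exact ⟨fun h' h'' ↦ hxo h'' h', fun h' ↦ (hx2.2 hx).resolve_left h'⟩
      · have hxr : x ∉ r := fun h' ↦ hx (hx2.1 (Or.inr h'))
        have hxo2 : x ≠ P.opp d := fun h' ↦ hx (hx2.1 (Or.inl h'))
        simp only [hx, hxr, hxo2, false_or, or_false, true_and, not_false_eq_true]
        constructor
        · intro h'
          refine ⟨(hx1.1 (h'.imp_right Or.inr)).1, fun h'' ↦ ?_,
            (hx1.1 (h'.imp_right Or.inr)).2⟩
          exact h'.elim (hxd h'').1 (hxd h'').2
        · rintro ⟨h1, h2, h3⟩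
          exact (hx1.2 ⟨h1, h3⟩).imp_right fun h' ↦ h'.resolve_left h2

theorem nodup (h : P.Merged f₀ M w R) : w.Nodup := h.nodup_and_mem_iff.1

theorem mem_iff (h : P.Merged f₀ M w R) {x : Δ} : x ∈ w ↔ P.face x ∈ M ∧ x ∉ R :=
  h.nodup_and_mem_iff.2 x

theorem exists_isWalk (h : P.Merged f₀ M w R) : ∃ x, IsWalk P.src P.tgt x w x := by
  induction h with
  | base => exact P.isWalk_bd _
  | step h hf hr ih =>
    obtain ⟨x, hx⟩ := ih
    obtain ⟨y, h1, rfl, h2⟩ := isWalk_append.1 hx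
    exact ⟨x, isWalk_append.2 ⟨_, isWalk_append.2 ⟨_, h1, isWalk_of_isRotated hr⟩, h2⟩⟩

/-- Merging a polygon with trivial holonomy does not change the holonomy of the boundary word. -/
theorem hol_eq {G : Type*} [Group G] {g : Δ → G} (hg : ∀ d, g (P.opp d) = (g d)⁻¹)
    (h : P.Merged f₀ M w R) (hflat : ∀ f ∈ M, f ≠ f₀ → hol g (P.bd f) = 1) :
    hol g w = hol g (P.bd f₀) := by
  induction h with
  | base => rfl
  | @step M w₁ w₂ r d f R h hf hr ih =>
    rw [← ih fun f hf ↦ hflat f (Set.mem_insert_of_mem _ hf)]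
    have h1 := hflat f (Set.mem_insert _ _) (fun h' ↦ hf (h' ▸ h.start_mem))
    rw [← hol_isRotated_iff g hr, hol_cons, hg, inv_mul_eq_one] at h1
    simp [h1]

open Classical in
/-- Labels outside the glued darts can be prescribed arbitrarily: the labels of the glued darts are
then determined by the requirement that the holonomy around the merged polygons be trivial. -/
theorem exists_flat {G : Type*} [Group G] (h : P.Merged f₀ M w R) (k : Δ → G)
    (hk : ∀ d, k (P.opp d) = (k d)⁻¹) :
    ∃ g : Δ → G, (∀ d, g (P.opp d) = (g d)⁻¹) ∧ (∀ x ∉ R, g x = k x) ∧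
      ∀ f ∈ M, f ≠ f₀ → hol g (P.bd f) = 1 := by
  induction h generalizing k with
  | base => exact ⟨k, hk, fun _ _ ↦ rfl, fun f hf hf' ↦ (hf' hf).elim⟩
  | @step M w₁ w₂ r d f R h hf hr ih =>
    let k' : Δ → G := fun x ↦
      if x = d then hol k r else if x = P.opp d then (hol k r)⁻¹ else k x
    have hk' : ∀ x, k' (P.opp x) = (k' x)⁻¹ := by
      intro x
      by_cases h1 : x = d
      · subst h1
        simp [k', P.opp_ne]
      · by_cases h2 : x = P.opp d
        · subst h2
          simp [k', P.opp_ne, P.opp_opp]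
        · have h3 : P.opp x ≠ d := fun h3 ↦ h2 (by rw [← h3, P.opp_opp])
          have h4 : P.opp x ≠ P.opp d := fun h4 ↦ h1 (P.opp_injective h4)
          simp [k', h1, h2, h3, h4, hk]
    obtain ⟨g, hg1, hg2, hg3⟩ := ih k' hk'
    have hface := face_of_isRotated hr
    have hn' : (P.opp d :: r).Nodup := hr.nodup_iff.2 (P.nodup_bd f)
    rw [List.nodup_cons] at hn'
    have hdw := h.mem_iff.1 (show d ∈ w₁ ++ d :: w₂ by simp)
    have hdf : P.face d ≠ f := fun h' ↦ hf (h' ▸ hdw.1)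
    refine ⟨g, hg1, fun x hx ↦ ?_, fun f' hf' hne ↦ ?_⟩
    · simp only [Set.mem_insert_iff, not_or] at hx
      rw [hg2 x hx.2.2]
      simp [k', hx.1, hx.2.1]
    · rcases hf' with rfl | hf'
      · rw [← hol_isRotated_iff g hr, hol_cons, hg1, hg2 d hdw.2, inv_mul_eq_one]
        have : hol g r = hol k r := hol_congr fun x hx ↦ by
          have hxf : P.face x = f' := (hface x).1 (Or.inr hx)
          rw [hg2 x fun hxR ↦ hf (hxf ▸ h.face_mem hxR)]
          have h1 : x ≠ d := fun h1 ↦ hdf (h1 ▸ hxf)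
          have h2 : x ≠ P.opp d := fun h2 ↦ hn'.1 (h2 ▸ hx)
          simp [k', h1, h2]
        rw [this]
        simp [k']
      · exact hg3 f' hf' hne

end Merged

/-- If the polygons are connected through their sides, all of them can be merged into one. -/
theorem exists_merged_univ [Finite F] (f₀ : F)
    (hconn : ∀ M : Set F, M.Nonempty → M ≠ Set.univ → ∃ d, P.face d ∈ M ∧ P.face (P.opp d) ∉ M) :
    ∃ w R, P.Merged f₀ Set.univ w R := by
  have key : ∀ n : ℕ, ∀ M w R, P.Merged f₀ M w R → Mᶜ.ncard = n →
      ∃ w R, P.Merged f₀ Set.univ w R := by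
    intro n
    induction n using Nat.strong_induction_on with
    | _ n ih =>
      intro M w R h hn
      by_cases hM : M = Set.univ
      · subst hM
        exact ⟨w, R, h⟩
      · obtain ⟨d, hd1, hd2⟩ := hconn M ⟨_, h.start_mem⟩ hM
        have hdw : d ∈ w := h.mem_iff.2 ⟨hd1, fun hR ↦ hd2 (h.face_mem (h.opp_mem hR))⟩
        obtain ⟨w₁, w₂, rfl⟩ := List.append_of_mem hdw
        have hdb : P.opp d ∈ P.bd (P.face (P.opp d)) := (P.mem_bd _ _).2 rfl
        obtain ⟨s, t, hst⟩ := List.append_of_mem hdb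
        have hr : (P.opp d :: (t ++ s)) ~r P.bd (P.face (P.opp d)) := by
          rw [hst]
          exact (List.isRotated_append (l := s) (l' := P.opp d :: t)).symm
        refine ih _ ?_ _ _ _ (h.step hd2 hr) rfl
        rw [← hn]
        refine Set.ncard_lt_ncard ?_ (Set.toFinite _)
        exact compl_lt_compl_iff_lt.2 (Set.ssubset_insert hd2)
  exact key _ _ _ _ .base rfl

variable (P)

/-- The word can be reduced to the empty word by cancelling adjacent pairs `d`, `opp d`: its sides
are glued in pairs without crossings. -/
inductive Folds : List Δ → Prop
  | nil : Folds []
  | step {u v : List Δ} {d : Δ} : Folds (u ++ v) → Folds (u ++ d :: P.opp d :: v)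

variable {P}

/-- Adjacent mutually inverse factors cancel, so a word which folds up has trivial holonomy. -/
theorem Folds.hol_eq_one {G : Type*} [Group G] {g : Δ → G} (hg : ∀ d, g (P.opp d) = (g d)⁻¹)
    {w : List Δ} (h : P.Folds w) : hol g w = 1 := by
  induction h with
  | nil => rfl
  | step h ih => simpa [hg] using ih

/-- A nonempty word without crossing pairs has two adjacent opposite letters: a letter between two
opposite letters either crosses them or has its opposite between them as well, at a smaller
distance. -/
theorem crossing_or_exists_adjacent {w : List Δ} (hn : w.Nodup) (hw : ∀ d ∈ w, P.opp d ∈ w)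
    (hne : w ≠ []) :
    (∃ a b : Δ, [a, b, P.opp a, P.opp b].Sublist w) ∨
      ∃ u v d, w = u ++ d :: P.opp d :: v := by
  have key : ∀ n : ℕ, ∀ u a m v, m.length = n → w = u ++ a :: (m ++ P.opp a :: v) →
      (∃ a b : Δ, [a, b, P.opp a, P.opp b].Sublist w) ∨
        ∃ u v d, w = u ++ d :: P.opp d :: v := by
    intro n
    induction n using Nat.strong_induction_on with
    | _ n ih =>
      rintro u a (_ | ⟨b, m⟩) v hm rfl
      · exact Or.inr ⟨u, v, a, rfl⟩
      · have hb := hw b (by simp)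
        simp only [List.cons_append, List.mem_append, List.mem_cons] at hb
        rcases hb with hb | hb | hb | hb | hb | hb
        · refine Or.inl ⟨P.opp b, a, ?_⟩
          rw [P.opp_opp]
          refine List.Sublist.append (l₁ := [P.opp b]) (List.singleton_sublist.2 hb) ?_
          refine List.Sublist.cons_cons _ (List.Sublist.cons_cons _ ?_)
          exact (List.singleton_sublist.2 (List.mem_cons_self)).trans (List.sublist_append_right _ _)
        · rw [← hb, P.opp_opp] at hn
          simp [List.nodup_append] at hn
        · exact (P.opp_ne b hb).elim
        · obtain ⟨m₁, m₂, rfl⟩ := List.append_of_mem hb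
          refine ih m₁.length ?_ (u ++ [a]) b m₁ (m₂ ++ P.opp a :: v) rfl (by simp)
          rw [← hm]
          simp
        · rw [P.opp_injective hb] at hn
          simp [List.nodup_append] at hn
        · refine Or.inl ⟨a, b, List.Sublist.trans ?_ (List.sublist_append_right _ _)⟩
          refine List.Sublist.cons_cons _ (List.Sublist.cons_cons _ ?_)
          refine List.Sublist.trans ?_ (List.sublist_append_right _ _)
          exact List.Sublist.cons_cons _ (List.singleton_sublist.2 hb)
  obtain ⟨d, w', rfl⟩ := List.exists_cons_of_ne_nil hne
  have hd := (List.mem_cons.1 (hw d (by simp))).resolve_left (P.opp_ne d)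
  obtain ⟨m, v, rfl⟩ := List.append_of_mem hd
  exact key _ [] d m v rfl rfl

/-- A word in which every side is glued to another one either folds up or has two crossing pairs
of sides. -/
theorem folds_or_crossing {w : List Δ} (hn : w.Nodup) (hw : ∀ d ∈ w, P.opp d ∈ w) :
    P.Folds w ∨ ∃ a b : Δ, [a, b, P.opp a, P.opp b].Sublist w := by
  induction h : w.length using Nat.strong_induction_on generalizing w with
  | _ n ih =>
    by_cases hne : w = []
    · subst hne
      exact Or.inl .nil
    obtain h1 | ⟨u, v, d, rfl⟩ := crossing_or_exists_adjacent hn hw hne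
    · exact Or.inr h1
    · have hs : (u ++ v).Sublist (u ++ d :: P.opp d :: v) :=
        List.Sublist.append_left ((List.sublist_cons_self _ _).trans (List.sublist_cons_self _ _)) _
      have hd : d ∉ u ++ v ∧ P.opp d ∉ u ++ v := by
        simp only [List.nodup_append, List.nodup_cons, List.mem_cons, List.mem_append] at hn ⊢
        refine ⟨?_, ?_⟩ <;> rintro (h' | h')
        · exact hn.2.2 _ h' _ (Or.inl rfl) rfl
        · exact hn.2.1.1 (Or.inr h')
        · exact hn.2.2 _ h' _ (Or.inr (Or.inl rfl)) rfl
        · exact hn.2.1.2.1 h'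
      have huv : ∀ x ∈ u ++ v, P.opp x ∈ u ++ v := by
        intro x hx
        have h2 := hw x (hs.subset hx)
        have h3 : P.opp x ≠ d := fun h3 ↦ hd.2 (by rwa [← h3, P.opp_opp])
        have h4 : P.opp x ≠ P.opp d := fun h4 ↦ hd.1 (P.opp_injective h4 ▸ hx)
        simpa only [List.mem_append, List.mem_cons, h3, h4, false_or] using h2
      obtain h1 | ⟨a, b, h1⟩ := ih (u ++ v).length (by rw [← h]; simp) (hn.sublist hs) huv rfl
      · exact Or.inl h1.step
      · exact Or.inr ⟨a, b, h1.trans hs⟩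

theorem exists_eq_of_crossing {w : List Δ} {a b : Δ}
    (h : [a, b, P.opp a, P.opp b].Sublist w) : ∃ u₁ u₂ u₃ u₄ u₅ : List Δ,
      w = u₁ ++ a :: (u₂ ++ b :: (u₃ ++ P.opp a :: (u₄ ++ P.opp b :: u₅))) := by
  have key : ∀ (x : Δ) (l w : List Δ), (x :: l).Sublist w → ∃ u v, w = u ++ x :: v ∧
      l.Sublist v := by
    intro x l w h
    obtain ⟨r₁, r₂, rfl, h1, h2⟩ := List.cons_sublist_iff.1 h
    obtain ⟨s, t, rfl⟩ := List.append_of_mem h1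
    exact ⟨s, t ++ r₂, by simp, h2.trans (List.sublist_append_right _ _)⟩
  obtain ⟨u₁, w₁, rfl, h1⟩ := key _ _ _ h
  obtain ⟨u₂, w₂, rfl, h2⟩ := key _ _ _ h1
  obtain ⟨u₃, w₃, rfl, h3⟩ := key _ _ _ h2
  obtain ⟨u₄, u₅, rfl, -⟩ := key _ _ _ h3
  exact ⟨_, _, _, _, _, rfl⟩

/-- If two pairs of sides of the merged polygon cross, their labels can be prescribed, all other
sides of the polygon being labelled by `1`. -/
theorem exists_flat_of_crossing {G : Type*} [Group G] {f₀ : F} {w : List Δ} {R : Set Δ}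
    {a b : Δ} {u₁ u₂ u₃ u₄ u₅ : List Δ}
    (hw : w = u₁ ++ a :: (u₂ ++ b :: (u₃ ++ P.opp a :: (u₄ ++ P.opp b :: u₅))))
    (h : P.Merged f₀ Set.univ w R) (x y : G) :
    ∃ g : Δ → G, (∀ d, g (P.opp d) = (g d)⁻¹) ∧ (∀ f ≠ f₀, hol g (P.bd f) = 1) ∧
      g a = x ∧ g b = y ∧ hol g u₁ = 1 ∧ hol g u₂ = 1 ∧ hol g u₃ = 1 ∧ hol g u₄ = 1 ∧
        hol g u₅ = 1 := by
  classical
  have hn := h.nodup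
  rw [hw] at hn
  have hba : b ≠ a ∧ b ≠ P.opp a := by
    simp [List.nodup_append] at hn
    tauto
  have hba' : P.opp b ≠ P.opp a ∧ P.opp b ≠ a := by
    refine ⟨fun h' ↦ hba.1 (P.opp_injective h'), fun h' ↦ hba.2 ?_⟩
    rw [← h', P.opp_opp]
  let k : Δ → G := fun d ↦ if d = a then x else if d = P.opp a then x⁻¹ else
    if d = b then y else if d = P.opp b then y⁻¹ else 1
  have ka : k a = x := by simp [k]
  have ka' : k (P.opp a) = x⁻¹ := by simp [k, P.opp_ne]
  have kb : k b = y := by simp [k, hba]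
  have kb' : k (P.opp b) = y⁻¹ := by simp [k, hba', P.opp_ne]
  have k1 : ∀ d, d ≠ a → d ≠ P.opp a → d ≠ b → d ≠ P.opp b → k d = 1 := by
    intro d h1 h2 h3 h4
    simp [k, h1, h2, h3, h4]
  have hk : ∀ d, k (P.opp d) = (k d)⁻¹ := by
    intro d
    by_cases h1 : d = a
    · rw [h1, ka, ka']
    by_cases h2 : d = P.opp a
    · rw [h2, ka', P.opp_opp, ka, inv_inv]
    by_cases h3 : d = b
    · rw [h3, kb, kb']
    by_cases h4 : d = P.opp b
    · rw [h4, kb', P.opp_opp, kb, inv_inv]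
    have ho : ∀ c, d ≠ P.opp c → P.opp d ≠ c := fun c h h' ↦ h (by rw [← h', P.opp_opp])
    rw [k1 d h1 h2 h3 h4, k1 (P.opp d) (ho a h2) (fun h' ↦ h1 (P.opp_injective h')) (ho b h4)
      (fun h' ↦ h3 (P.opp_injective h')), inv_one]
  obtain ⟨g, hg1, hg2, hg3⟩ := h.exists_flat k hk
  have hgk : ∀ d ∈ w, g d = k d := fun d hd ↦ hg2 d (h.mem_iff.1 hd).2
  refine ⟨g, hg1, fun f hf ↦ hg3 f (Set.mem_univ _) hf, ?_, ?_, ?_⟩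
  · rw [hgk a (by simp [hw]), ka]
  · rw [hgk b (by simp [hw]), kb]
  have hd : ∀ u, (∀ d ∈ u, d ∈ w) → (∀ d ∈ u, d ≠ a ∧ d ≠ P.opp a ∧ d ≠ b ∧ d ≠ P.opp b) →
      hol g u = 1 :=
    fun u hu hu' ↦ hol_eq_one _ fun d hd ↦ by
      rw [hgk d (hu d hd), k1 d (hu' d hd).1 (hu' d hd).2.1 (hu' d hd).2.2.1 (hu' d hd).2.2.2]
  have hw' : ∀ d ∈ u₁ ++ a :: (u₂ ++ b :: (u₃ ++ P.opp a :: (u₄ ++ P.opp b :: u₅))), d ∈ w :=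
    fun d hd ↦ hw ▸ hd
  clear hk hg1 hg2 hg3 k1 ka ka' kb kb' h hgk
  simp only [List.nodup_append, List.nodup_cons, List.mem_append, List.mem_cons, not_or] at hn hw'
  refine ⟨hd _ (fun d h ↦ hw' d ?_) ?_, hd _ (fun d h ↦ hw' d ?_) ?_,
    hd _ (fun d h ↦ hw' d ?_) ?_, hd _ (fun d h ↦ hw' d ?_) ?_, hd _ (fun d h ↦ hw' d ?_) ?_⟩
  all_goals clear hd hw' k
  on_goal 1 => exact Or.inl h
  on_goal 2 => exact Or.inr (Or.inr (Or.inl h))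
  on_goal 3 => exact Or.inr (Or.inr (Or.inr (Or.inr (Or.inl h))))
  on_goal 4 => exact Or.inr (Or.inr (Or.inr (Or.inr (Or.inr (Or.inr (Or.inl h))))))
  on_goal 5 => exact Or.inr (Or.inr (Or.inr (Or.inr (Or.inr (Or.inr (Or.inr (Or.inr h)))))))
  all_goals refine fun d h ↦ ⟨?_, ?_, ?_, ?_⟩ <;> rintro rfl <;> grind only

/-- If two pairs of sides of the merged polygon cross, a commutator `x * y * x⁻¹ * y⁻¹` can be
prescribed as the holonomy around `f₀`. -/
theorem exists_hol_eq_commutator {G : Type*} [Group G] {f₀ : F} {w : List Δ} {R : Set Δ}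
    (h : P.Merged f₀ Set.univ w R) {a b : Δ} (hab : [a, b, P.opp a, P.opp b].Sublist w) (x y : G) :
    ∃ g : Δ → G, (∀ d, g (P.opp d) = (g d)⁻¹) ∧ (∀ f ≠ f₀, hol g (P.bd f) = 1) ∧
      hol g (P.bd f₀) = x * y * x⁻¹ * y⁻¹ := by
  obtain ⟨u₁, u₂, u₃, u₄, u₅, hw⟩ := exists_eq_of_crossing hab
  obtain ⟨g, hg, hflat, ha, hb, h1, h2, h3, h4, h5⟩ := exists_flat_of_crossing hw h x y
  refine ⟨g, hg, hflat, ?_⟩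
  rw [← h.hol_eq hg fun f _ hf ↦ hflat f hf, hw]
  simp [hg, ha, hb, h1, h2, h3, h4, h5, mul_assoc]

/-- The holonomy of a coboundary telescopes along walks. -/
theorem isWalk_hol {G : Type*} [CommGroup G] {g : Δ → G} {φ : V → G}
    (hφ : ∀ d, g d = (φ (P.src d))⁻¹ * φ (P.tgt d)) {w : List Δ} {x y : V}
    (h : IsWalk P.src P.tgt x w y) : hol g w = (φ x)⁻¹ * φ y := by
  induction w generalizing x with
  | nil => simp [show x = y from h]
  | cons d w ih =>
    obtain ⟨rfl, h⟩ := h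
    rw [hol_cons, ih h, hφ]
    group

/-- In a commutative group, opposite letters cancel in pairs wherever they stand in the word. -/
theorem hol_eq_one_of_comm {G : Type*} [CommGroup G] {g : Δ → G}
    (hg : ∀ d, g (P.opp d) = (g d)⁻¹) {w : List Δ} (hn : w.Nodup)
    (hw : ∀ d ∈ w, P.opp d ∈ w) : hol g w = 1 := by
  classical
  rw [hol, ← List.prod_toFinset _ hn]
  refine Finset.prod_involution (fun d _ ↦ P.opp d) (fun d _ ↦ by simp [hg])
    (fun d _ _ ↦ P.opp_ne d) (fun d hd ↦ ?_) (fun d _ ↦ P.opp_opp d)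
  simpa using hw d (by simpa using hd)

namespace Merged

variable {f₀ : F} {w : List Δ} {R : Set Δ}

theorem opp_mem_word (h : P.Merged f₀ Set.univ w R) : ∀ d ∈ w, P.opp d ∈ w := fun d hd ↦ by
  rw [h.mem_iff] at hd ⊢
  exact ⟨trivial, fun h' ↦ hd.2 (by simpa [P.opp_opp] using h.opp_mem h')⟩

theorem hol_eq_one_of_comm {G : Type*} [CommGroup G] {g : Δ → G}
    (h : P.Merged f₀ Set.univ w R) (hg : ∀ d, g (P.opp d) = (g d)⁻¹)
    (hflat : ∀ f ≠ f₀, hol g (P.bd f) = 1) : hol g (P.bd f₀) = 1 := by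
  rw [← h.hol_eq hg fun f _ hf ↦ hflat f hf]
  exact PolygonGluing.hol_eq_one_of_comm hg h.nodup h.opp_mem_word

/-- If the first cohomology of the glued surface vanishes, the merged polygon has no crossing pairs
of sides: two crossing pairs `a`, `b` give an integral cocycle taking the value `1` on `a` and
a nonzero value on the loop which runs through the boundary of the merged polygon from the
beginning of `b` to the end of `opp b`. -/
theorem folds_of_cohomology (h : P.Merged f₀ Set.univ w R)
    (hH : ∀ g : Δ → Multiplicative ℤ, (∀ d, g (P.opp d) = (g d)⁻¹) →
      (∀ f, hol g (P.bd f) = 1) →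
      ∃ φ : V → Multiplicative ℤ, ∀ d, g d = (φ (P.src d))⁻¹ * φ (P.tgt d)) :
    P.Folds w := by
  refine (folds_or_crossing h.nodup h.opp_mem_word).resolve_right ?_
  rintro ⟨a, b, hab⟩
  obtain ⟨u₁, u₂, u₃, u₄, u₅, hw⟩ := exists_eq_of_crossing hab
  obtain ⟨g, hg, hflat, ha, hb, h1, h2, h3, h4, h5⟩ :=
    exists_flat_of_crossing hw h (Multiplicative.ofAdd (1 : ℤ)) 1
  have hflat' : ∀ f, hol g (P.bd f) = 1 := by
    intro f
    by_cases hf : f = f₀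
    · rw [hf]
      exact h.hol_eq_one_of_comm hg hflat
    · exact hflat f hf
  obtain ⟨φ, hφ⟩ := hH g hg hflat'
  obtain ⟨x, hx⟩ := h.exists_isWalk
  have hsplit : w = (u₁ ++ a :: u₂) ++ ((b :: (u₃ ++ P.opp a :: (u₄ ++ [P.opp b]))) ++ u₅) := by
    rw [hw]
    simp
  rw [hsplit, isWalk_append] at hx
  obtain ⟨y, -, hy⟩ := hx
  rw [isWalk_append] at hy
  obtain ⟨z, hz, -⟩ := hy
  have hyz : y = z := by
    have hz1 := hz.1
    rw [show b :: (u₃ ++ P.opp a :: (u₄ ++ [P.opp b])) =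
      (b :: (u₃ ++ P.opp a :: u₄)) ++ [P.opp b] by simp, isWalk_append] at hz
    obtain ⟨t, -, -, ht⟩ := hz
    rw [← hz1, ← P.tgt_opp]
    exact ht
  have hhol := isWalk_hol hφ hz
  rw [hyz, inv_mul_cancel] at hhol
  simp [hg, ha, hb, h3, h4] at hhol

end Merged

end PolygonGluing

/-! ### Paths up to reparametrization -/

/-- A function on the image of a compact set is continuous if it pulls back to a continuous
function: a continuous map from a compact space to a Hausdorff space is a quotient map. -/
theorem continuousOn_image_of_comp {A B C : Type*} [TopologicalSpace A] [TopologicalSpace B]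
    [TopologicalSpace C] [T2Space B] {K : Set A} (hK : IsCompact K) {p : A → B}
    (hp : ContinuousOn p K) {f : B → C} (hf : ContinuousOn (f ∘ p) K) :
    ContinuousOn f (p '' K) := by
  rw [continuousOn_iff_isClosed]
  intro t ht
  refine ⟨p '' (K ∩ (f ∘ p) ⁻¹' t), ?_, ?_⟩
  · obtain ⟨u, hu, hu'⟩ := continuousOn_iff_isClosed.1 hf t ht
    have h1 : IsCompact (K ∩ (f ∘ p) ⁻¹' t) := by
      rw [inter_comm, hu', inter_comm]
      exact hK.inter_right hu
    exact (h1.image_of_continuousOn (hp.mono inter_subset_left)).isClosed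
  · ext y
    constructor
    · rintro ⟨hy, x, hx, rfl⟩
      exact ⟨⟨x, ⟨hx, hy⟩, rfl⟩, x, hx, rfl⟩
    · rintro ⟨⟨x, ⟨hx, hy⟩, rfl⟩, h⟩
      exact ⟨hy, h⟩

/-- Concatenation of two paths, given as functions on the unit interval. -/
noncomputable def cat {X : Type*} (b c : ℝ → X) (t : ℝ) : X :=
  if t ≤ 1 / 2 then b (2 * t) else c (2 * t - 1)

/-- The reversed path. -/
def rev {X : Type*} (b : ℝ → X) (t : ℝ) : X := b (1 - t)

section cat
variable {X : Type*} {b c : ℝ → X}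

theorem cat_of_le {t : ℝ} (ht : t ≤ 1 / 2) : cat b c t = b (2 * t) := if_pos ht

theorem cat_of_lt {t : ℝ} (ht : 1 / 2 < t) : cat b c t = c (2 * t - 1) := if_neg ht.not_ge

theorem cat_of_ge (h : b 1 = c 0) {t : ℝ} (ht : 1 / 2 ≤ t) : cat b c t = c (2 * t - 1) := by
  rcases ht.eq_or_lt with rfl | ht
  · rw [cat_of_le le_rfl]
    norm_num [h]
  · exact cat_of_lt ht

@[simp] theorem cat_zero : cat b c 0 = b 0 := by
  rw [cat_of_le (by norm_num), mul_zero]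

@[simp] theorem cat_one : cat b c 1 = c 1 := by
  rw [cat_of_lt (by norm_num)]
  norm_num

theorem image_cat (h : b 1 = c 0) :
    cat b c '' Icc 0 1 = b '' Icc 0 1 ∪ c '' Icc 0 1 := by
  ext x
  constructor
  · rintro ⟨t, ⟨h0, h1⟩, rfl⟩
    rcases le_or_gt t (1 / 2) with ht | ht
    · exact Or.inl ⟨2 * t, ⟨by linarith, by linarith⟩, (cat_of_le ht).symm⟩
    · exact Or.inr ⟨2 * t - 1, ⟨by linarith, by linarith⟩, (cat_of_lt ht).symm⟩
  · rintro (⟨t, ⟨h0, h1⟩, rfl⟩ | ⟨t, ⟨h0, h1⟩, rfl⟩)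
    · refine ⟨t / 2, ⟨by linarith, by linarith⟩, ?_⟩
      rw [cat_of_le (by linarith)]
      congr 1
      ring
    · refine ⟨(t + 1) / 2, ⟨by linarith, by linarith⟩, ?_⟩
      rw [cat_of_ge h (by linarith)]
      congr 1
      ring

theorem image_rev : rev b '' Icc 0 1 = b '' Icc 0 1 := by
  ext x
  constructor
  · rintro ⟨t, ⟨h0, h1⟩, rfl⟩
    exact ⟨1 - t, ⟨by linarith, by linarith⟩, rfl⟩
  · rintro ⟨t, ⟨h0, h1⟩, rfl⟩
    exact ⟨1 - t, ⟨by linarith, by linarith⟩, by simp [rev]⟩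

end cat

/-- The path `b'` is a reparametrization of `b`, by a homeomorphism of the unit interval which
fixes the endpoints. -/
def Reparam {X : Type*} (b b' : ℝ → X) : Prop :=
  ∃ σ : ℝ → ℝ, ContinuousOn σ (Icc 0 1) ∧ BijOn σ (Icc 0 1) (Icc 0 1) ∧ σ 0 = 0 ∧ σ 1 = 1 ∧
    ∀ t ∈ Icc (0 : ℝ) 1, b' t = b (σ t)

namespace Reparam

variable {X : Type*} {a b c b' c' : ℝ → X}

theorem of_strictMono {σ : ℝ → ℝ} (hc : ContinuousOn σ (Icc 0 1))
    (hm : StrictMonoOn σ (Icc 0 1)) (h0 : σ 0 = 0) (h1 : σ 1 = 1)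
    (h : ∀ t ∈ Icc (0 : ℝ) 1, b' t = b (σ t)) : Reparam b b' := by
  have h01 : (0 : ℝ) ≤ 1 := zero_le_one
  refine ⟨σ, hc, ⟨fun t ht ↦ ?_, hm.injOn, ?_⟩, h0, h1, h⟩
  · constructor
    · rw [← h0]
      exact hm.monotoneOn (left_mem_Icc.2 h01) ht ht.1
    · rw [← h1]
      exact hm.monotoneOn ht (right_mem_Icc.2 h01) ht.2
  · have := intermediate_value_Icc h01 hc
    rwa [h0, h1] at this

theorem refl (b : ℝ → X) : Reparam b b :=
  ⟨id, continuousOn_id, bijOn_id _, rfl, rfl, fun _ _ ↦ rfl⟩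

theorem of_eqOn (h : ∀ t ∈ Icc (0 : ℝ) 1, b' t = b t) : Reparam b b' :=
  ⟨id, continuousOn_id, bijOn_id _, rfl, rfl, h⟩

theorem symm (h : Reparam b b') : Reparam b' b := by
  obtain ⟨σ, hc, hb, h0, h1, h⟩ := h
  have hinv : LeftInvOn (Function.invFunOn σ (Icc 0 1)) σ (Icc 0 1) := hb.injOn.leftInvOn_invFunOn
  have hinv' : ∀ t ∈ Icc (0 : ℝ) 1, σ (Function.invFunOn σ (Icc 0 1) t) = t :=
    fun t ht ↦ Function.invFunOn_eq (hb.surjOn ht)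
  have hb' : BijOn (Function.invFunOn σ (Icc 0 1)) (Icc 0 1) (Icc 0 1) :=
    (bijOn_comm ⟨hinv, hinv'⟩).2 hb
  refine ⟨_, ?_, hb', ?_, ?_, fun t ht ↦ ?_⟩
  · have := continuousOn_image_of_comp (f := Function.invFunOn σ (Icc 0 1)) isCompact_Icc hc
      (continuousOn_id.congr hinv)
    rwa [hb.image_eq] at this
  · have := hinv (show (0 : ℝ) ∈ Icc (0 : ℝ) 1 by simp)
    rwa [h0] at this
  · have := hinv (show (1 : ℝ) ∈ Icc (0 : ℝ) 1 by simp)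
    rwa [h1] at this
  · rw [h _ (hb'.mapsTo ht), hinv' t ht]

theorem trans (h : Reparam a b) (h' : Reparam b c) : Reparam a c := by
  obtain ⟨σ, hc, hb, h0, h1, h⟩ := h
  obtain ⟨τ, hc', hb', h0', h1', h'⟩ := h'
  refine ⟨σ ∘ τ, hc.comp hc' hb'.mapsTo, hb.comp hb', ?_, ?_, fun t ht ↦ ?_⟩
  · simp [h0', h0]
  · simp [h1', h1]
  · rw [h' t ht, h _ (hb'.mapsTo ht)]
    rfl

theorem apply_zero (h : Reparam b b') : b' 0 = b 0 := by
  obtain ⟨σ, hc, hb, h0, h1, h⟩ := h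
  rw [h 0 (by simp), h0]

theorem apply_one (h : Reparam b b') : b' 1 = b 1 := by
  obtain ⟨σ, hc, hb, h0, h1, h⟩ := h
  rw [h 1 (by simp), h1]

theorem image_eq (h : Reparam b b') : b' '' Icc 0 1 = b '' Icc 0 1 := by
  obtain ⟨σ, hc, hb, h0, h1, h⟩ := h
  conv_rhs => rw [← hb.image_eq, ← image_comp]
  exact image_congr h

theorem cat (h : Reparam b b') (h' : Reparam c c') :
    Reparam (SurfaceIncidence.cat b c) (SurfaceIncidence.cat b' c') := by
  obtain ⟨σ, hc, hb, h0, h1, h⟩ := h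
  obtain ⟨τ, hc', hb', h0', h1', h'⟩ := h'
  have hτ : ∀ t ∈ Icc (0 : ℝ) 1, 0 < t → 0 < τ t := fun t ht h ↦
    lt_of_le_of_ne (hb'.mapsTo ht).1 fun h'' ↦
      h.ne (hb'.injOn (by simp) ht (h0'.trans h''))
  let ρ : ℝ → ℝ := fun t ↦ if t ≤ 1 / 2 then σ (2 * t) / 2 else (1 + τ (2 * t - 1)) / 2
  have ρ1 : ∀ t, t ≤ 1 / 2 → ρ t = σ (2 * t) / 2 := fun t ht ↦ if_pos ht
  have ρ2 : ∀ t, 1 / 2 < t → ρ t = (1 + τ (2 * t - 1)) / 2 := fun t ht ↦ if_neg ht.not_ge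
  have m1 : ∀ t ∈ Icc (0 : ℝ) 1, t ≤ 1 / 2 → 2 * t ∈ Icc (0 : ℝ) 1 := fun t ht h ↦
    ⟨by linarith [ht.1], by linarith⟩
  have m2 : ∀ t ∈ Icc (0 : ℝ) 1, 1 / 2 < t → 2 * t - 1 ∈ Icc (0 : ℝ) 1 := fun t ht h ↦
    ⟨by linarith, by linarith [ht.2]⟩
  refine ⟨ρ, ?_, ⟨?_, ?_, ?_⟩, ?_, ?_, ?_⟩
  · refine ContinuousOn.if' ?_ ?_ ?_ ?_
    · rintro a ⟨ha, hfr⟩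
      have ha' : a = 1 / 2 := by
        have := frontier_le_subset_eq continuous_id continuous_const hfr
        simpa using this
      subst ha'
      have e : σ (2 * (1 / 2)) / 2 = 1 / 2 := by norm_num [h1]
      simp only [le_refl, if_true, e]
      have : ContinuousOn (fun t ↦ σ (2 * t) / 2) (Icc 0 1 ∩ {a | a ≤ 1 / 2}) :=
        (hc.comp (by fun_prop) fun t ht ↦ m1 t ht.1 ht.2).div_const 2
      have := this (1 / 2) ⟨ha, le_refl (1 / 2 : ℝ)⟩
      simpa only [ContinuousWithinAt, e] using this
    · rintro a ⟨ha, hfr⟩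
      have ha' : a = 1 / 2 := by
        have := frontier_le_subset_eq continuous_id continuous_const hfr
        simpa using this
      subst ha'
      have e : (1 + τ (2 * (1 / 2) - 1)) / 2 = 1 / 2 := by norm_num [h0']
      have e' : σ (2 * (1 / 2)) / 2 = 1 / 2 := by norm_num [h1]
      simp only [le_refl, if_true, e']
      have : ContinuousOn (fun t ↦ (1 + τ (2 * t - 1)) / 2) (Icc 0 1 ∩ {a | 1 / 2 ≤ a}) :=
        (continuousOn_const.add (hc'.comp (by fun_prop) fun t ht ↦
          ⟨by linarith [ht.2.out], by linarith [ht.1.2]⟩)).div_const 2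
      have := this (1 / 2) ⟨ha, le_refl (1 / 2 : ℝ)⟩
      rw [ContinuousWithinAt, e] at this
      exact this.mono_left (nhdsWithin_mono _ fun t ht ↦ ⟨ht.1, (not_le.1 ht.2).le⟩)
    · exact (hc.comp (by fun_prop) fun t ht ↦ m1 t ht.1 ht.2).div_const 2
    · exact (continuousOn_const.add (hc'.comp (by fun_prop) fun t ht ↦
        m2 t ht.1 (not_le.1 ht.2))).div_const 2
  · intro t ht
    rcases le_or_gt t (1 / 2) with h2 | h2
    · have := hb.mapsTo (m1 t ht h2)
      rw [ρ1 t h2]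
      exact ⟨by linarith [this.1], by linarith [this.2]⟩
    · have := hb'.mapsTo (m2 t ht h2)
      rw [ρ2 t h2]
      exact ⟨by linarith [this.1], by linarith [this.2]⟩
  · intro s hs t ht hst
    rcases le_or_gt s (1 / 2) with h2 | h2 <;> rcases le_or_gt t (1 / 2) with h3 | h3
    · rw [ρ1 s h2, ρ1 t h3] at hst
      linarith [hb.injOn (m1 s hs h2) (m1 t ht h3) (by linarith)]
    · rw [ρ1 s h2, ρ2 t h3] at hst
      linarith [(hb.mapsTo (m1 s hs h2)).2, hτ _ (m2 t ht h3) (by linarith)]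
    · rw [ρ2 s h2, ρ1 t h3] at hst
      linarith [(hb.mapsTo (m1 t ht h3)).2, hτ _ (m2 s hs h2) (by linarith)]
    · rw [ρ2 s h2, ρ2 t h3] at hst
      linarith [hb'.injOn (m2 s hs h2) (m2 t ht h3) (by linarith)]
  · intro y hy
    rcases le_or_gt y (1 / 2) with h2 | h2
    · obtain ⟨t, ht, hty⟩ := hb.surjOn (m1 y hy h2)
      refine ⟨t / 2, ⟨by linarith [ht.1], by linarith [ht.2]⟩, ?_⟩
      rw [ρ1 _ (by linarith [ht.2]), mul_div_cancel₀ t two_ne_zero, hty]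
      ring
    · obtain ⟨t, ht, hty⟩ := hb'.surjOn (m2 y hy h2)
      have h3 : 0 < t := lt_of_le_of_ne ht.1 fun h3 ↦ by
        rw [← h3, h0'] at hty
        linarith
      refine ⟨(t + 1) / 2, ⟨by linarith [ht.1], by linarith [ht.2]⟩, ?_⟩
      rw [ρ2 _ (by linarith), show 2 * ((t + 1) / 2) - 1 = t by ring, hty]
      ring
  · rw [ρ1 _ (by norm_num), mul_zero, h0, zero_div]
  · rw [ρ2 _ (by norm_num)]
    norm_num [h1']
  · intro t ht
    rcases le_or_gt t (1 / 2) with h2 | h2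
    · rw [cat_of_le h2, h _ (m1 t ht h2), ρ1 t h2,
        cat_of_le (by linarith [(hb.mapsTo (m1 t ht h2)).2])]
      congr 1
      ring
    · rw [cat_of_lt h2, h' _ (m2 t ht h2), ρ2 t h2,
        cat_of_lt (by linarith [hτ _ (m2 t ht h2) (by linarith)])]
      congr 1
      ring

theorem cat_assoc (a b c : ℝ → X) :
    Reparam (SurfaceIncidence.cat a (SurfaceIncidence.cat b c))
      (SurfaceIncidence.cat (SurfaceIncidence.cat a b) c) := by
  -- the homeomorphism with breakpoints `1 / 4 ↦ 1 / 2` and `1 / 2 ↦ 3 / 4`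
  let σ : ℝ → ℝ := fun t ↦ min (2 * t) (min (t + 1 / 4) ((t + 1) / 2))
  have σ1 : ∀ t, t ≤ 1 / 4 → σ t = 2 * t := fun t ht ↦
    min_eq_left (le_min (by linarith) (by linarith))
  have σ2 : ∀ t, 1 / 4 ≤ t → t ≤ 1 / 2 → σ t = t + 1 / 4 := fun t ht ht' ↦ by
    simp only [σ]
    rw [min_eq_left (show t + 1 / 4 ≤ (t + 1) / 2 by linarith), min_eq_right (by linarith)]
  have σ3 : ∀ t, 1 / 2 ≤ t → σ t = (t + 1) / 2 := fun t ht ↦ by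
    simp only [σ]
    rw [min_eq_right (show (t + 1) / 2 ≤ t + 1 / 4 by linarith), min_eq_right (by linarith)]
  refine of_strictMono (σ := σ) (by fun_prop) (fun s _ t _ hst ↦ ?_) ?_ ?_ fun t _ ↦ ?_
  · exact min_lt_min (by linarith) (min_lt_min (by linarith) (by linarith))
  · rw [σ1 _ (by norm_num), mul_zero]
  · rw [σ3 _ (by norm_num)]
    norm_num
  · rcases le_or_gt t (1 / 4) with h1 | h1
    · rw [σ1 t h1, cat_of_le (by linarith), cat_of_le (by linarith), cat_of_le (by linarith)]
    rcases le_or_gt t (1 / 2) with h2 | h2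
    · rw [σ2 t h1.le h2, cat_of_le h2, cat_of_lt (by linarith), cat_of_lt (by linarith),
        cat_of_le (by linarith)]
      congr 1
      ring
    · rw [σ3 t h2.le, cat_of_lt h2, cat_of_lt (by linarith), cat_of_lt (by linarith)]
      congr 1
      ring

/-- Two injective paths with the same image and the same endpoints. -/
theorem of_injOn [TopologicalSpace X] [T2Space X] (hb : ContinuousOn b (Icc 0 1))
    (hc : ContinuousOn c (Icc 0 1)) (hb' : InjOn b (Icc 0 1)) (hc' : InjOn c (Icc 0 1))
    (h : c '' Icc 0 1 = b '' Icc 0 1) (h0 : c 0 = b 0) (h1 : c 1 = b 1) : Reparam b c := by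
  have hinv : LeftInvOn (Function.invFunOn b (Icc 0 1)) b (Icc 0 1) := hb'.leftInvOn_invFunOn
  have hinv' : ∀ x ∈ b '' Icc 0 1, b (Function.invFunOn b (Icc 0 1) x) = x ∧
      Function.invFunOn b (Icc 0 1) x ∈ Icc (0 : ℝ) 1 :=
    fun x hx ↦ ⟨Function.invFunOn_eq hx, Function.invFunOn_mem hx⟩
  have hcm : MapsTo c (Icc 0 1) (b '' Icc 0 1) := fun t ht ↦ h ▸ mem_image_of_mem c ht
  refine ⟨Function.invFunOn b (Icc 0 1) ∘ c, ?_, ⟨fun t ht ↦ (hinv' _ (hcm ht)).2, ?_, ?_⟩,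
    ?_, ?_, fun t ht ↦ ((hinv' _ (hcm ht)).1).symm⟩
  · exact (continuousOn_image_of_comp (f := Function.invFunOn b (Icc 0 1)) isCompact_Icc hb
      (continuousOn_id.congr hinv)).comp hc hcm
  · intro s hs t ht hst
    refine hc' hs ht ?_
    rw [← (hinv' _ (hcm hs)).1, ← (hinv' _ (hcm ht)).1]
    exact congrArg b hst
  · intro t ht
    obtain ⟨s, hs, hst⟩ := h.symm ▸ mem_image_of_mem b ht
    exact ⟨s, hs, by rw [Function.comp, hst, hinv ht]⟩
  · simp [h0, hinv (show (0 : ℝ) ∈ Icc (0 : ℝ) 1 by simp)]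
  · simp [h1, hinv (show (1 : ℝ) ∈ Icc (0 : ℝ) 1 by simp)]

end Reparam

/-- A linear path on an interval is split at an interior point. -/
theorem reparam_cat_of_lt {X : Type*} (b : ℝ → X) {p q r : ℝ} (hpq : p < q) (hqr : q < r) :
    Reparam (fun t ↦ b (p + t * (r - p)))
      (cat (fun t ↦ b (p + t * (q - p))) (fun t ↦ b (q + t * (r - q)))) := by
  have hd : 0 < r - p := by linarith
  let σ : ℝ → ℝ := fun t ↦ if t ≤ 1 / 2 then 2 * t * (q - p) / (r - p) else
    (q - p + (2 * t - 1) * (r - q)) / (r - p)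
  have σ1 : ∀ t, t ≤ 1 / 2 → σ t * (r - p) = 2 * t * (q - p) := fun t ht ↦ by
    simp only [σ, if_pos ht]
    exact div_mul_cancel₀ _ hd.ne'
  have σ2 : ∀ t, 1 / 2 < t → σ t * (r - p) = q - p + (2 * t - 1) * (r - q) := fun t ht ↦ by
    simp only [σ, if_neg ht.not_ge]
    exact div_mul_cancel₀ _ hd.ne'
  refine .of_strictMono (σ := σ) ?_ (fun s _ t _ hst ↦ ?_) ?_ ?_ fun t _ ↦ ?_
  · refine (Continuous.if_le (by fun_prop) (by fun_prop) continuous_id continuous_const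
      fun t ht ↦ ?_).continuousOn
    simp only [id] at ht
    rw [ht]
    norm_num
  · refine lt_of_mul_lt_mul_right ?_ hd.le
    rcases le_or_gt s (1 / 2) with h1 | h1 <;> rcases le_or_gt t (1 / 2) with h2 | h2
    · rw [σ1 s h1, σ1 t h2]
      exact mul_lt_mul_of_pos_right (by linarith) (by linarith)
    · rw [σ1 s h1, σ2 t h2]
      nlinarith
    · linarith
    · rw [σ2 s h1, σ2 t h2]
      nlinarith
  · simp [σ]
  · refine mul_right_cancel₀ hd.ne' ?_
    rw [σ2 1 (by norm_num)]
    ring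
  · rcases le_or_gt t (1 / 2) with h1 | h1
    · rw [cat_of_le h1, σ1 t h1]
    · rw [cat_of_lt h1, σ2 t h1]
      congr 1
      ring

/-! ### The closed unit disk -/

/-- The point of the unit circle at `s` turns. -/
noncomputable def turnPoint (s : ℝ) : ℂ := Complex.exp (((2 * Real.pi * s : ℝ) : ℂ) * Complex.I)

/-- The argument of a complex number, measured in turns, in `[0, 1)`. -/
noncomputable def turn (z : ℂ) : ℝ :=
  if 0 ≤ z.arg then z.arg / (2 * Real.pi) else z.arg / (2 * Real.pi) + 1

theorem continuous_turnPoint : Continuous turnPoint := by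
  unfold turnPoint
  fun_prop

@[simp] theorem norm_turnPoint (s : ℝ) : ‖turnPoint s‖ = 1 := Complex.norm_exp_ofReal_mul_I _

@[simp] theorem turnPoint_re (s : ℝ) : (turnPoint s).re = Real.cos (2 * Real.pi * s) :=
  Complex.exp_ofReal_mul_I_re _

@[simp] theorem turnPoint_im (s : ℝ) : (turnPoint s).im = Real.sin (2 * Real.pi * s) :=
  Complex.exp_ofReal_mul_I_im _

@[simp] theorem turnPoint_zero : turnPoint 0 = 1 := by simp [turnPoint]

@[simp] theorem turnPoint_one : turnPoint 1 = 1 := by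
  simp [turnPoint, Complex.exp_two_pi_mul_I]

theorem turnPoint_add (s t : ℝ) : turnPoint (s + t) = turnPoint s * turnPoint t := by
  rw [turnPoint, turnPoint, turnPoint, ← Complex.exp_add]
  congr 1
  push_cast
  ring

theorem turnPoint_half : turnPoint (1 / 2) = -1 := by
  rw [turnPoint, show 2 * Real.pi * (1 / 2) = Real.pi by ring, Complex.exp_pi_mul_I]

theorem turnPoint_one_sub (s : ℝ) : turnPoint (1 - s) = starRingEnd ℂ (turnPoint s) := by
  have h : 2 * Real.pi * (1 - s) = 2 * Real.pi - 2 * Real.pi * s := by ring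
  apply Complex.ext
  · simp [h, Real.cos_two_pi_sub]
  · simp [h, Real.sin_two_pi_sub]

theorem turn_nonneg (z : ℂ) : 0 ≤ turn z := by
  unfold turn
  split_ifs with h
  · positivity
  · have := Complex.neg_pi_lt_arg z
    have h2 : -1 ≤ z.arg / (2 * Real.pi) := by
      rw [le_div_iff₀ (by positivity)]
      nlinarith [Real.pi_pos]
    linarith

theorem turn_lt_one (z : ℂ) : turn z < 1 := by
  unfold turn
  split_ifs with h
  · rw [div_lt_one (by positivity)]
    linarith [Complex.arg_le_pi z, Real.pi_pos]
  · have : z.arg / (2 * Real.pi) < 0 := div_neg_of_neg_of_pos (not_le.1 h) (by positivity)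
    linarith

theorem turnPoint_turn (z : ℂ) : turnPoint (turn z) = Complex.exp (z.arg * Complex.I) := by
  have h : turnPoint (z.arg / (2 * Real.pi)) = Complex.exp (z.arg * Complex.I) := by
    rw [turnPoint, mul_div_cancel₀ _ (by positivity)]
  unfold turn
  split_ifs
  · exact h
  · rw [turnPoint_add, h, turnPoint_one, mul_one]

theorem norm_mul_turnPoint_turn (z : ℂ) : (‖z‖ : ℂ) * turnPoint (turn z) = z := by
  rw [turnPoint_turn, Complex.norm_mul_exp_arg_mul_I]

theorem turnPoint_injOn : InjOn turnPoint (Ico 0 1) := by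
  intro s hs t ht h
  rw [turnPoint, turnPoint, Complex.exp_eq_exp_iff_exists_int] at h
  obtain ⟨n, hn⟩ := h
  have h2 : ((s : ℂ) - t - n) * (2 * Real.pi * Complex.I) = 0 := by
    push_cast at hn
    linear_combination hn
  have h3 : (2 * Real.pi * Complex.I : ℂ) ≠ 0 := by
    simp [Real.pi_ne_zero]
  have h4 : s - t = n := by
    have := (mul_eq_zero.1 h2).resolve_right h3
    have h5 : ((s - t - n : ℝ) : ℂ) = 0 := by
      push_cast
      exact this
    linarith [Complex.ofReal_eq_zero.1 h5]
  have h5 : (n : ℝ) < 1 := by linarith [hs.2, ht.1]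
  have h6 : (-1 : ℝ) < n := by linarith [hs.1, ht.2]
  have h7 : n = 0 := by
    have h5' : n < 1 := by exact_mod_cast h5
    have h6' : -1 < n := by exact_mod_cast h6
    omega
  rw [h7] at h4
  simp only [Int.cast_zero] at h4
  linarith

theorem turn_mul_turnPoint {r s : ℝ} (hr : 0 < r) (hs : s ∈ Ico (0 : ℝ) 1) :
    turn (r * turnPoint s) = s := by
  refine turnPoint_injOn ⟨turn_nonneg _, turn_lt_one _⟩ hs ?_
  have h := norm_mul_turnPoint_turn (r * turnPoint s)
  have hn : ‖(r : ℂ) * turnPoint s‖ = r := by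
    simp [abs_of_pos hr]
  rw [hn] at h
  exact mul_left_cancel₀ (by exact_mod_cast hr.ne') h

theorem exists_turnPoint_eq {z : ℂ} (hz : ‖z‖ = 1) : ∃ s ∈ Ico (0 : ℝ) 1, turnPoint s = z :=
  ⟨turn z, ⟨turn_nonneg _, turn_lt_one _⟩, by
    have := norm_mul_turnPoint_turn z
    rwa [hz, Complex.ofReal_one, one_mul] at this⟩

theorem turnPoint_im_nonneg {s : ℝ} (h : s ∈ Icc (0 : ℝ) (1 / 2)) : 0 ≤ (turnPoint s).im := by
  rw [turnPoint_im]
  exact Real.sin_nonneg_of_nonneg_of_le_pi (by have := h.1; positivity)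
    (by nlinarith [Real.pi_pos, h.2])

theorem turnPoint_im_pos {s : ℝ} (h : s ∈ Ioo (0 : ℝ) (1 / 2)) : 0 < (turnPoint s).im := by
  rw [turnPoint_im]
  exact Real.sin_pos_of_pos_of_lt_pi (by have := h.1; positivity)
    (by nlinarith [Real.pi_pos, h.2])

theorem turnPoint_im_nonpos {s : ℝ} (h : s ∈ Icc (1 / 2 : ℝ) 1) : (turnPoint s).im ≤ 0 := by
  have := turnPoint_im_nonneg (s := 1 - s) ⟨by linarith [h.2], by linarith [h.1]⟩
  rw [turnPoint_one_sub] at this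
  simpa using this

theorem turnPoint_im_neg {s : ℝ} (h : s ∈ Ioo (1 / 2 : ℝ) 1) : (turnPoint s).im < 0 := by
  have := turnPoint_im_pos (s := 1 - s) ⟨by linarith [h.2], by linarith [h.1]⟩
  rw [turnPoint_one_sub] at this
  simpa using this

theorem norm_sq_eq (z : ℂ) : ‖z‖ ^ 2 = z.re ^ 2 + z.im ^ 2 := by
  rw [Complex.sq_norm, Complex.normSq_apply]
  ring

theorem norm_le_one_iff (z : ℂ) : ‖z‖ ≤ 1 ↔ z.re ^ 2 + z.im ^ 2 ≤ 1 := by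
  rw [← norm_sq_eq, sq_le_one_iff₀ (norm_nonneg _)]

theorem norm_lt_one_iff (z : ℂ) : ‖z‖ < 1 ↔ z.re ^ 2 + z.im ^ 2 < 1 := by
  rw [← norm_sq_eq, sq_lt_one_iff₀ (norm_nonneg _)]

theorem norm_eq_one_iff' (z : ℂ) : ‖z‖ = 1 ↔ z.re ^ 2 + z.im ^ 2 = 1 := by
  rw [← norm_sq_eq, pow_eq_one_iff_of_nonneg (norm_nonneg z) two_ne_zero]

/-- The half-length of the vertical chord of the unit disk through `z`. -/
noncomputable def chord (z : ℂ) : ℝ := √(1 - z.re ^ 2)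

/-- The map of the upper half of the unit disk onto the unit disk which fixes the upper semicircle
and stretches every vertical segment affinely. -/
noncomputable def stretch (z : ℂ) : ℂ := ⟨z.re, 2 * z.im - chord z⟩

/-- The inverse of `stretch`. -/
noncomputable def shrink (z : ℂ) : ℂ := ⟨z.re, (z.im + chord z) / 2⟩

theorem continuous_chord : Continuous chord := by
  unfold chord
  fun_prop

theorem continuous_stretch : Continuous stretch := by
  have := continuous_chord
  have h : stretch = fun z ↦ ((z.re : ℝ) : ℂ) + ((2 * z.im - chord z : ℝ) : ℂ) * Complex.I := by
    funext z
    apply Complex.ext <;> simp [stretch]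
  rw [h]
  fun_prop

theorem continuous_shrink : Continuous shrink := by
  have := continuous_chord
  have h : shrink = fun z ↦ ((z.re : ℝ) : ℂ) + (((z.im + chord z) / 2 : ℝ) : ℂ) * Complex.I := by
    funext z
    apply Complex.ext <;> simp [shrink]
  rw [h]
  fun_prop

theorem chord_nonneg (z : ℂ) : 0 ≤ chord z := Real.sqrt_nonneg _

theorem chord_sq {z : ℂ} (hz : ‖z‖ ≤ 1) : chord z ^ 2 = 1 - z.re ^ 2 := by
  rw [norm_le_one_iff] at hz
  exact Real.sq_sqrt (by nlinarith [sq_nonneg z.im])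

theorem abs_im_le_chord {z : ℂ} (hz : ‖z‖ ≤ 1) : |z.im| ≤ chord z := by
  refine abs_le_of_sq_le_sq ?_ (chord_nonneg z)
  rw [chord_sq hz]
  rw [norm_le_one_iff] at hz
  linarith

theorem abs_im_lt_chord {z : ℂ} (hz : ‖z‖ < 1) : |z.im| < chord z := by
  refine abs_lt_of_sq_lt_sq ?_ (chord_nonneg z)
  rw [chord_sq hz.le]
  rw [norm_lt_one_iff] at hz
  linarith

theorem chord_eq_of_norm_eq_one {z : ℂ} (hz : ‖z‖ = 1) : chord z = |z.im| := by
  rw [← sq_eq_sq₀ (chord_nonneg z) (abs_nonneg _), chord_sq hz.le, sq_abs]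
  rw [norm_eq_one_iff'] at hz
  linarith

@[simp] theorem chord_stretch (z : ℂ) : chord (stretch z) = chord z := rfl

@[simp] theorem chord_shrink (z : ℂ) : chord (shrink z) = chord z := rfl

theorem shrink_stretch (z : ℂ) : shrink (stretch z) = z := by
  apply Complex.ext
  · rfl
  · simp [shrink]
    simp [stretch]

theorem stretch_shrink (z : ℂ) : stretch (shrink z) = z := by
  apply Complex.ext
  · rfl
  · simp [stretch]
    simp [shrink]
    ring

theorem norm_le_one_of_im {w z : ℂ} (hz : ‖z‖ ≤ 1) (hre : w.re = z.re) (him : |w.im| ≤ chord z) :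
    ‖w‖ ≤ 1 := by
  rw [norm_le_one_iff, hre]
  have := chord_sq hz
  nlinarith [sq_abs w.im, abs_nonneg w.im]

theorem norm_lt_one_of_im {w z : ℂ} (hz : ‖z‖ ≤ 1) (hre : w.re = z.re) (him : |w.im| < chord z) :
    ‖w‖ < 1 := by
  rw [norm_lt_one_iff, hre]
  have := chord_sq hz
  nlinarith [sq_abs w.im, abs_nonneg w.im]

theorem norm_stretch_le {z : ℂ} (hz : ‖z‖ ≤ 1) (him : 0 ≤ z.im) : ‖stretch z‖ ≤ 1 := by
  refine norm_le_one_of_im hz rfl ?_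
  have := (abs_le.1 (abs_im_le_chord hz)).2
  simp only [stretch]
  rw [abs_le]
  constructor <;> linarith

theorem norm_stretch_lt {z : ℂ} (hz : ‖z‖ < 1) (him : 0 < z.im) : ‖stretch z‖ < 1 := by
  refine norm_lt_one_of_im hz.le rfl ?_
  have := (abs_lt.1 (abs_im_lt_chord hz)).2
  simp only [stretch]
  rw [abs_lt]
  constructor <;> linarith

theorem norm_shrink_le {z : ℂ} (hz : ‖z‖ ≤ 1) : ‖shrink z‖ ≤ 1 := by
  refine norm_le_one_of_im hz rfl ?_
  have := (abs_le.1 (abs_im_le_chord hz))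
  simp only [shrink]
  rw [abs_le]
  constructor <;> linarith [chord_nonneg z]

theorem norm_shrink_lt {z : ℂ} (hz : ‖z‖ < 1) : ‖shrink z‖ < 1 := by
  refine norm_lt_one_of_im hz.le rfl ?_
  have := (abs_lt.1 (abs_im_lt_chord hz))
  simp only [shrink]
  rw [abs_lt]
  constructor <;> linarith [chord_nonneg z]

theorem shrink_im_nonneg {z : ℂ} (hz : ‖z‖ ≤ 1) : 0 ≤ (shrink z).im := by
  have := (abs_le.1 (abs_im_le_chord hz)).1
  simp only [shrink]
  linarith

theorem shrink_im_pos {z : ℂ} (hz : ‖z‖ < 1) : 0 < (shrink z).im := by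
  have := (abs_lt.1 (abs_im_lt_chord hz)).1
  simp only [shrink]
  linarith

theorem stretch_of_norm_eq_one {z : ℂ} (hz : ‖z‖ = 1) (him : 0 ≤ z.im) : stretch z = z := by
  apply Complex.ext
  · rfl
  · simp only [stretch, chord_eq_of_norm_eq_one hz, abs_of_nonneg him]
    ring

theorem shrink_of_norm_eq_one {z : ℂ} (hz : ‖z‖ = 1) (him : 0 ≤ z.im) : shrink z = z := by
  rw [← stretch_of_norm_eq_one hz him, shrink_stretch, stretch_of_norm_eq_one hz him]

/-- The diameter of the half disk is mapped to the lower semicircle. -/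
theorem stretch_ofReal {x : ℝ} (hx : x ∈ Icc (-1 : ℝ) 1) :
    stretch x = turnPoint (1 - Real.arccos x / (2 * Real.pi)) := by
  have h : 2 * Real.pi * (Real.arccos x / (2 * Real.pi)) = Real.arccos x :=
    mul_div_cancel₀ _ (by positivity)
  rw [turnPoint_one_sub]
  apply Complex.ext
  · simp only [Complex.conj_re, turnPoint_re, h, Real.cos_arccos hx.1 hx.2]
    rfl
  · simp only [Complex.conj_im, turnPoint_im, h, Real.sin_arccos]
    simp [stretch, chord]

theorem arccos_div_mem {x : ℝ} : Real.arccos x / (2 * Real.pi) ∈ Icc (0 : ℝ) (1 / 2) := by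
  constructor
  · have := Real.arccos_nonneg x
    positivity
  · rw [div_le_iff₀ (by positivity)]
    linarith [Real.arccos_le_pi x]

theorem arccos_div_pi_mem_Ioo {x : ℝ} (hx : x ∈ Ioo (-1 : ℝ) 1) :
    Real.arccos x / Real.pi ∈ Ioo (0 : ℝ) 1 := by
  have h1 := Real.arccos_pos.2 hx.2
  have h2 : Real.arccos x < Real.pi := by
    refine lt_of_le_of_ne (Real.arccos_le_pi x) fun h ↦ ?_
    rw [Real.arccos_eq_pi] at h
    linarith [hx.1]
  exact ⟨by positivity, (div_lt_one Real.pi_pos).2 h2⟩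

/-! ### Gluing disks -/

/-- `IsDisk U b`: there is a continuous map from the closed unit disk to `X` which maps the open
disk bijectively onto `U` and is given by the loop `b`, a function on the unit interval, on the
unit circle. -/
def IsDisk {X : Type*} [TopologicalSpace X] (U : Set X) (b : ℝ → X) : Prop :=
  ∃ q : ℂ → X, ContinuousOn q (closedBall 0 1) ∧ InjOn q (ball 0 1) ∧ q '' ball 0 1 = U ∧
    ∀ s ∈ Icc (0 : ℝ) 1, q (turnPoint s) = b s

theorem image_closedBall_eq {X : Type*} {U : Set X} {b : ℝ → X} {q : ℂ → X}
    (h3 : q '' ball 0 1 = U) (h4 : ∀ s ∈ Icc (0 : ℝ) 1, q (turnPoint s) = b s) :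
    q '' closedBall 0 1 = U ∪ b '' Icc 0 1 := by
  rw [← ball_union_sphere, image_union, h3]
  congr 1
  ext x
  constructor
  · rintro ⟨z, hz, rfl⟩
    obtain ⟨s, hs, rfl⟩ := exists_turnPoint_eq (mem_sphere_zero_iff_norm.1 hz)
    exact ⟨s, Ico_subset_Icc_self hs, (h4 s (Ico_subset_Icc_self hs)).symm⟩
  · rintro ⟨s, hs, rfl⟩
    exact ⟨turnPoint s, by simp, h4 s hs⟩

namespace IsDisk

variable {X : Type*} [TopologicalSpace X] {U U' : Set X} {b b' c p r : ℝ → X}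

/-- A homeomorphism of the circle extends radially to the disk. -/
theorem reparam (h : IsDisk U b) (hb : Reparam b b') : IsDisk U b' := by
  obtain ⟨q, h1, h2, h3, h4⟩ := h
  obtain ⟨σ, hc, hσ, h0, h1', hb⟩ := hb
  let H : ℂ → ℂ := fun z ↦ ‖z‖ * turnPoint (σ (turn z))
  have hσ1 : ∀ s ∈ Ico (0 : ℝ) 1, σ s ∈ Ico (0 : ℝ) 1 := fun s hs ↦ by
    have hm := hσ.mapsTo (Ico_subset_Icc_self hs)
    refine ⟨hm.1, lt_of_le_of_ne hm.2 fun h ↦ hs.2.ne ?_⟩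
    exact hσ.injOn (Ico_subset_Icc_self hs) (by simp) (h.trans h1'.symm)
  have hnorm : ∀ z, ‖H z‖ = ‖z‖ := fun z ↦ by simp [H]
  have hpolar : ∀ r ∈ Icc (0 : ℝ) 1, ∀ s ∈ Icc (0 : ℝ) 1,
      H (r * turnPoint s) = r * turnPoint (σ s) := by
    intro r hr s hs
    have hn : ‖(r : ℂ) * turnPoint s‖ = r := by
      simp [abs_of_nonneg hr.1]
    simp only [H, hn]
    rcases hr.1.eq_or_lt with rfl | hr0
    · simp
    rcases hs.2.eq_or_lt with rfl | hs1
    · have : turn (r * turnPoint 1) = 0 := by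
        rw [turnPoint_one, ← turnPoint_zero]
        exact turn_mul_turnPoint hr0 (by simp)
      rw [this, h0, h1']
      simp
    · rw [turn_mul_turnPoint hr0 ⟨hs.1, hs1⟩]
  have hHc : ContinuousOn H (closedBall 0 1) := by
    have hcomp : IsCompact (Icc (0 : ℝ) 1 ×ˢ Icc (0 : ℝ) 1) := isCompact_Icc.prod isCompact_Icc
    have hct := continuous_turnPoint
    have himg : (fun x : ℝ × ℝ ↦ (x.1 : ℂ) * turnPoint x.2) '' (Icc (0 : ℝ) 1 ×ˢ Icc (0 : ℝ) 1) =
        closedBall 0 1 := by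
      ext z
      constructor
      · rintro ⟨⟨r, s⟩, ⟨hr, hs⟩, rfl⟩
        simp only [mem_closedBall_zero_iff, norm_mul, norm_turnPoint, mul_one, Complex.norm_real,
          Real.norm_eq_abs, abs_of_nonneg hr.1]
        exact hr.2
      · intro hz
        exact ⟨(‖z‖, turn z), ⟨⟨norm_nonneg _, mem_closedBall_zero_iff.1 hz⟩,
          turn_nonneg z, (turn_lt_one z).le⟩, norm_mul_turnPoint_turn z⟩
    rw [← himg]
    refine continuousOn_image_of_comp hcomp (by fun_prop) ?_
    refine ContinuousOn.congr (f := fun x : ℝ × ℝ ↦ (x.1 : ℂ) * turnPoint (σ x.2)) ?_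
      fun x hx ↦ hpolar _ hx.1 _ hx.2
    refine ContinuousOn.mul (by fun_prop) (hct.comp_continuousOn ?_)
    exact hc.comp continuousOn_snd fun x hx ↦ hx.2
  have hHb : BijOn H (ball 0 1) (ball 0 1) := by
    refine ⟨fun z hz ↦ by simpa [hnorm] using hz, fun z hz w hw h ↦ ?_, fun w hw ↦ ?_⟩
    · have hn : ‖z‖ = ‖w‖ := by rw [← hnorm z, h, hnorm]
      rcases (norm_nonneg z).eq_or_lt with h' | h'
      · rw [norm_eq_zero.1 h'.symm, norm_eq_zero.1 (hn.symm.trans h'.symm)]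
      · simp only [H, ← hn] at h
        have h5 := mul_left_cancel₀ (by exact_mod_cast h'.ne') h
        have h6 := turnPoint_injOn (hσ1 _ ⟨turn_nonneg z, turn_lt_one z⟩)
          (hσ1 _ ⟨turn_nonneg w, turn_lt_one w⟩) h5
        have h7 := hσ.injOn ⟨turn_nonneg z, (turn_lt_one z).le⟩
          ⟨turn_nonneg w, (turn_lt_one w).le⟩ h6
        rw [← norm_mul_turnPoint_turn z, ← norm_mul_turnPoint_turn w, h7, hn]
    · obtain ⟨s, hs, hsw⟩ := hσ.surjOn ⟨turn_nonneg w, (turn_lt_one w).le⟩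
      rw [mem_ball_zero_iff] at hw
      refine ⟨‖w‖ * turnPoint s, by simpa using hw, ?_⟩
      rw [hpolar _ ⟨norm_nonneg _, hw.le⟩ s hs, hsw, norm_mul_turnPoint_turn]
  refine ⟨q ∘ H, h1.comp hHc fun z hz ↦ by simpa [hnorm] using hz,
    h2.comp hHb.injOn hHb.mapsTo, ?_, fun s hs ↦ ?_⟩
  · rw [image_comp, hHb.image_eq, h3]
  · have := hpolar 1 (by simp) s hs
    rw [Complex.ofReal_one, one_mul, one_mul] at this
    rw [Function.comp, this, h4 _ (hσ.mapsTo hs), hb s hs]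

theorem rotate (h : IsDisk U (cat b c)) (hbc : b 1 = c 0) : IsDisk U (cat c b) := by
  obtain ⟨q, h1, h2, h3, h4⟩ := h
  have hneg : (fun z : ℂ ↦ -z) '' ball 0 1 = ball 0 1 := by
    ext z
    constructor
    · rintro ⟨w, hw, rfl⟩
      simpa using hw
    · exact fun hz ↦ ⟨-z, by simpa using hz, neg_neg z⟩
  refine ⟨fun z ↦ q (-z), h1.comp continuousOn_neg fun z hz ↦ by simpa using hz,
    fun z hz w hw hzw ↦ neg_injective (h2 (by simpa using hz) (by simpa using hw) hzw), ?_,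
    fun s hs ↦ ?_⟩
  · rw [← h3]
    conv_rhs => rw [← hneg, image_image]
  · rcases le_or_gt s (1 / 2) with h | h
    · have h' : -turnPoint s = turnPoint (s + 1 / 2) := by
        rw [turnPoint_add, turnPoint_half, mul_neg_one]
      simp only [h']
      rw [h4 _ ⟨by linarith [hs.1], by linarith⟩, cat_of_le h,
        cat_of_ge hbc (by linarith [hs.1])]
      congr 1
      ring
    · have h' : -turnPoint s = turnPoint (s - 1 / 2) := by
        rw [← sub_add_cancel s (1 / 2), turnPoint_add, turnPoint_half]
        simp
      simp only [h']
      rw [h4 _ ⟨by linarith, by linarith [hs.2]⟩, cat_of_lt h,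
        cat_of_le (by linarith [hs.2])]
      congr 1
      ring

/-- Two disks with a common boundary path `c` are glued to a disk. -/
theorem merge [T2Space X] (h : IsDisk U (cat p c)) (h' : IsDisk U' (cat (rev c) r))
    (hpc : p 1 = c 0) (hc : InjOn c (Ioo 0 1)) (hUU : Disjoint U U')
    (hU : Disjoint U (c '' Ioo 0 1)) (hU' : Disjoint U' (c '' Ioo 0 1)) :
    IsDisk (U ∪ U' ∪ c '' Ioo 0 1) (cat p r) := by
  obtain ⟨q, h1, h2, h3, h4⟩ := h
  obtain ⟨q', h1', h2', h3', h4'⟩ := h'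
  let conj : ℂ → ℂ := starRingEnd ℂ
  let Q : ℂ → X := fun z ↦ if 0 ≤ z.im then q (stretch z) else q' (conj (stretch (conj z)))
  have Q1 : ∀ z, 0 ≤ z.im → Q z = q (stretch z) := fun z hz ↦ if_pos hz
  have Q2 : ∀ z, z.im < 0 → Q z = q' (conj (stretch (conj z))) := fun z hz ↦ if_neg hz.not_ge
  have hdiam : ∀ x ∈ Icc (-1 : ℝ) 1, q (stretch x) = c (1 - Real.arccos x / Real.pi) := by
    intro x hx
    have := @arccos_div_mem x
    rw [stretch_ofReal hx, h4 _ ⟨by linarith [this.2], by linarith [this.1]⟩,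
      cat_of_ge hpc (by linarith [this.2])]
    congr 1
    field_simp
    ring
  have hdiam' : ∀ x ∈ Icc (-1 : ℝ) 1, q' (conj (stretch x)) = c (1 - Real.arccos x / Real.pi) := by
    intro x hx
    have := @arccos_div_mem x
    rw [stretch_ofReal hx, turnPoint_one_sub]
    simp only [conj, Complex.conj_conj]
    rw [h4' _ ⟨this.1, by linarith [this.2]⟩, cat_of_le this.2, rev]
    congr 1
    field_simp
  have hreal : ∀ z : ℂ, z.im = 0 → z = (z.re : ℂ) := fun z hz ↦ by
    apply Complex.ext <;> simp [hz]
  have hre : ∀ z : ℂ, ‖z‖ ≤ 1 → z.re ∈ Icc (-1 : ℝ) 1 := fun z hz ↦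
    abs_le.1 ((Complex.abs_re_le_norm z).trans hz)
  have hnc : ∀ z, ‖conj z‖ = ‖z‖ := fun z ↦ Complex.norm_conj z
  have hci : ∀ z, (conj z).im = -z.im := fun z ↦ Complex.conj_im z
  have hcc : ∀ z, conj (conj z) = z := fun z ↦ Complex.conj_conj z
  have hcinj : Function.Injective conj := fun z w h ↦ by rw [← hcc z, h, hcc]
  have Q2' : ∀ z, ‖z‖ ≤ 1 → z.im ≤ 0 → Q z = q' (conj (stretch (conj z))) := by
    intro z hz hz'
    rcases hz'.eq_or_lt with h | h
    · have e : conj z = z := by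
        rw [hreal z h]
        exact Complex.conj_ofReal _
      rw [Q1 z h.ge, e, hreal z h, hdiam _ (hre z hz), hdiam' _ (hre z hz)]
    · exact Q2 z h
  have hQ1 : ∀ z, ‖z‖ < 1 → 0 < z.im → Q z ∈ U := fun z hz hz' ↦ by
    rw [Q1 z hz'.le, ← h3]
    exact ⟨_, mem_ball_zero_iff.2 (norm_stretch_lt hz hz'), rfl⟩
  have hQ2 : ∀ z, ‖z‖ < 1 → z.im < 0 → Q z ∈ U' := fun z hz hz' ↦ by
    rw [Q2 z hz', ← h3']
    refine ⟨_, mem_ball_zero_iff.2 ?_, rfl⟩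
    rw [hnc]
    exact norm_stretch_lt (by rwa [hnc]) (by rw [hci]; linarith)
  have hQ0 : ∀ z, ‖z‖ < 1 → z.im = 0 → Q z = c (1 - Real.arccos z.re / Real.pi) ∧
      1 - Real.arccos z.re / Real.pi ∈ Ioo (0 : ℝ) 1 := fun z hz hz' ↦ by
    have hx : z.re ∈ Ioo (-1 : ℝ) 1 := abs_lt.1 ((Complex.abs_re_le_norm z).trans_lt hz)
    have hx' := arccos_div_pi_mem_Ioo hx
    refine ⟨?_, by linarith [hx'.2], by linarith [hx'.1]⟩
    rw [Q1 z hz'.ge]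
    conv_lhs => rw [hreal z hz']
    exact hdiam _ (Ioo_subset_Icc_self hx)
  have hQ0' : ∀ z, ‖z‖ < 1 → z.im = 0 → Q z ∈ c '' Ioo 0 1 := fun z hz hz' ↦
    ⟨_, (hQ0 z hz hz').2, (hQ0 z hz hz').1.symm⟩
  have hsplit : closedBall (0 : ℂ) 1 =
      (closedBall 0 1 ∩ {z | 0 ≤ z.im}) ∪ (closedBall 0 1 ∩ {z | z.im ≤ 0}) := by
    rw [← inter_union_distrib_left]
    refine (inter_eq_left.2 fun z _ ↦ ?_).symm
    exact le_total 0 z.im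
  have hclosed1 : IsClosed (closedBall (0 : ℂ) 1 ∩ {z | 0 ≤ z.im}) :=
    isClosed_closedBall.inter (isClosed_le continuous_const Complex.continuous_im)
  have hclosed2 : IsClosed (closedBall (0 : ℂ) 1 ∩ {z | z.im ≤ 0}) :=
    isClosed_closedBall.inter (isClosed_le Complex.continuous_im continuous_const)
  refine ⟨Q, ?_, ?_, ?_, fun s hs ↦ ?_⟩
  · rw [hsplit]
    refine ContinuousOn.union_of_isClosed ?_ ?_ hclosed1 hclosed2
    · refine ContinuousOn.congr (h1.comp continuous_stretch.continuousOn fun z hz ↦ ?_)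
        fun z hz ↦ Q1 z hz.2
      exact mem_closedBall_zero_iff.2 (norm_stretch_le (mem_closedBall_zero_iff.1 hz.1) hz.2)
    · refine ContinuousOn.congr (h1'.comp (f := fun z ↦ conj (stretch (conj z)))
        (Complex.continuous_conj.comp
          (continuous_stretch.comp Complex.continuous_conj)).continuousOn fun z hz ↦ ?_)
        fun z hz ↦ Q2' z (mem_closedBall_zero_iff.1 hz.1) hz.2
      rw [mem_closedBall_zero_iff, hnc]
      refine norm_stretch_le ?_ ?_
      · rw [hnc]
        exact mem_closedBall_zero_iff.1 hz.1
      · rw [hci]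
        linarith [hz.2.out]
  · intro z hz w hw hzw
    rw [mem_ball_zero_iff] at hz hw
    rcases lt_trichotomy 0 z.im with hz' | hz' | hz' <;>
      rcases lt_trichotomy 0 w.im with hw' | hw' | hw'
    · rw [Q1 z hz'.le, Q1 w hw'.le] at hzw
      have := h2 (mem_ball_zero_iff.2 (norm_stretch_lt hz hz'))
        (mem_ball_zero_iff.2 (norm_stretch_lt hw hw')) hzw
      rw [← shrink_stretch z, this, shrink_stretch]
    · exact (hU.le_bot ⟨hQ1 z hz hz', hzw ▸ hQ0' w hw hw'.symm⟩).elim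
    · exact (hUU.le_bot ⟨hQ1 z hz hz', hzw ▸ hQ2 w hw hw'⟩).elim
    · exact (hU.le_bot ⟨hQ1 w hw hw', hzw ▸ hQ0' z hz hz'.symm⟩).elim
    · obtain ⟨e1, m1⟩ := hQ0 z hz hz'.symm
      obtain ⟨e2, m2⟩ := hQ0 w hw hw'.symm
      rw [e1, e2] at hzw
      have e3 := hc m1 m2 hzw
      have e4 : Real.arccos z.re = Real.arccos w.re := by
        have e5 : Real.arccos z.re / Real.pi = Real.arccos w.re / Real.pi := by linarith
        exact (div_left_inj' Real.pi_ne_zero).1 e5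
      exact Complex.ext (Real.arccos_injOn (hre z hz.le) (hre w hw.le) e4) (hz'.symm.trans hw')
    · exact (hU'.le_bot ⟨hQ2 w hw hw', hzw ▸ hQ0' z hz hz'.symm⟩).elim
    · exact (hUU.le_bot ⟨hQ1 w hw hw', hzw ▸ hQ2 z hz hz'⟩).elim
    · exact (hU'.le_bot ⟨hQ2 z hz hz', hzw ▸ hQ0' w hw hw'.symm⟩).elim
    · rw [Q2 z hz', Q2 w hw'] at hzw
      have hm : ∀ z : ℂ, ‖z‖ < 1 → z.im < 0 → conj (stretch (conj z)) ∈ ball (0 : ℂ) 1 := by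
        intro z hz hz'
        rw [mem_ball_zero_iff, hnc]
        exact norm_stretch_lt (by rwa [hnc]) (by rw [hci]; linarith)
      have := hcinj (h2' (hm z hz hz') (hm w hw hw') hzw)
      rw [← hcc z, ← shrink_stretch (conj z), this, shrink_stretch, hcc]
  · ext x
    constructor
    · rintro ⟨z, hz, rfl⟩
      rw [mem_ball_zero_iff] at hz
      rcases lt_trichotomy 0 z.im with hz' | hz' | hz'
      · exact Or.inl (Or.inl (hQ1 z hz hz'))
      · exact Or.inr (hQ0' z hz hz'.symm)
      · exact Or.inl (Or.inr (hQ2 z hz hz'))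
    · rintro ((hx | hx) | ⟨t, ht, rfl⟩)
      · rw [← h3] at hx
        obtain ⟨z, hz, rfl⟩ := hx
        rw [mem_ball_zero_iff] at hz
        refine ⟨shrink z, mem_ball_zero_iff.2 (norm_shrink_lt hz), ?_⟩
        rw [Q1 _ (shrink_im_pos hz).le, stretch_shrink]
      · rw [← h3'] at hx
        obtain ⟨z, hz, rfl⟩ := hx
        rw [mem_ball_zero_iff, ← hnc] at hz
        refine ⟨conj (shrink (conj z)), ?_, ?_⟩
        · rw [mem_ball_zero_iff, hnc]
          exact norm_shrink_lt hz
        · rw [Q2 _ (by rw [hci]; linarith [shrink_im_pos hz]), hcc, stretch_shrink, hcc]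
      · have ht' : (1 - t) * Real.pi ∈ Ioo 0 Real.pi :=
          ⟨mul_pos (by linarith [ht.2]) Real.pi_pos, by nlinarith [Real.pi_pos, ht.1]⟩
        have hcos : Real.arccos (Real.cos ((1 - t) * Real.pi)) = (1 - t) * Real.pi :=
          Real.arccos_cos ht'.1.le ht'.2.le
        have hnorm : ‖((Real.cos ((1 - t) * Real.pi) : ℝ) : ℂ)‖ < 1 := by
          rw [norm_lt_one_iff]
          have h5 := Real.sin_pos_of_pos_of_lt_pi ht'.1 ht'.2
          have h6 := Real.sin_sq_add_cos_sq ((1 - t) * Real.pi)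
          simp only [Complex.ofReal_re, Complex.ofReal_im]
          nlinarith
        refine ⟨(Real.cos ((1 - t) * Real.pi) : ℝ), mem_ball_zero_iff.2 hnorm, ?_⟩
        rw [(hQ0 _ hnorm (Complex.ofReal_im _)).1, Complex.ofReal_re, hcos,
          mul_div_cancel_right₀ _ Real.pi_ne_zero]
        congr 1
        ring
  · rcases le_or_gt s (1 / 2) with h | h
    · have him := turnPoint_im_nonneg (s := s) ⟨hs.1, h⟩
      rw [Q1 _ him, stretch_of_norm_eq_one (norm_turnPoint s) him, h4 s hs, cat_of_le h,
        cat_of_le h]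
    · have him := turnPoint_im_nonpos (s := s) ⟨h.le, hs.2⟩
      rw [Q2' _ (norm_turnPoint s).le him,
        stretch_of_norm_eq_one (by rw [hnc, norm_turnPoint]) (by rw [hci]; linarith), hcc, h4' s hs,
        cat_of_lt h, cat_of_lt h]

end IsDisk

/-- If the boundary path of a disk ends with `c` and `rev c`, each of them running over a quarter of
the circle, then on the lower half circle, which is the image of the diameter under `stretch`, the
boundary values at mirror points agree. -/
theorem apply_stretch_of_cat_rev {X : Type*} {q : ℂ → X} {p c : ℝ → X}
    (hq : ∀ s ∈ Icc (0 : ℝ) 1, q (turnPoint s) = cat p (cat c (rev c)) s) (hpc : p 1 = c 0)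
    {x : ℝ} (hx : x ∈ Icc (-1 : ℝ) 1) :
    q (stretch x) = c (2 * (Real.arccos |x| / Real.pi)) := by
  have hm := @arccos_div_mem x
  have hjoin : p 1 = cat c (rev c) 0 := by rw [cat_zero, hpc]
  have hrev : c 1 = rev c 0 := by simp [rev]
  have e : 2 * (1 - Real.arccos x / (2 * Real.pi)) - 1 = 1 - Real.arccos x / Real.pi := by
    field_simp
    ring
  rw [stretch_ofReal hx, hq _ ⟨by linarith [hm.2], by linarith [hm.1]⟩,
    cat_of_ge hjoin (by linarith [hm.2]), e]
  rcases le_total 0 x with h0 | h0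
  · have h1 : Real.arccos x / Real.pi ≤ 1 / 2 := by
      rw [div_le_iff₀ Real.pi_pos]
      linarith [Real.arccos_le_pi_div_two.2 h0]
    rw [cat_of_ge hrev (by linarith), abs_of_nonneg h0, rev]
    congr 1
    ring
  · have h1 : Real.arccos (-x) / Real.pi ≤ 1 / 2 := by
      rw [div_le_iff₀ Real.pi_pos]
      linarith [Real.arccos_le_pi_div_two.2 (neg_nonneg.2 h0)]
    have h2 : 1 - Real.arccos x / Real.pi = Real.arccos (-x) / Real.pi := by
      rw [Real.arccos_neg]
      field_simp
    rw [h2, cat_of_le h1, abs_of_nonpos h0]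

theorem two_mul_arccos_abs_mem {x : ℝ} (hx : x ∈ Ioo (-1 : ℝ) 1) :
    2 * (Real.arccos |x| / Real.pi) ∈ Ioc (0 : ℝ) 1 := by
  have h1 := Real.arccos_pos.2 (abs_lt.2 hx)
  have h2 := Real.arccos_le_pi_div_two.2 (abs_nonneg x)
  refine ⟨by positivity, ?_⟩
  rw [← mul_div_assoc, div_le_one Real.pi_pos]
  linarith

theorem abs_eq_of_two_mul_arccos_abs_eq {x y : ℝ} (hx : x ∈ Icc (-1 : ℝ) 1)
    (hy : y ∈ Icc (-1 : ℝ) 1)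
    (h : 2 * (Real.arccos |x| / Real.pi) = 2 * (Real.arccos |y| / Real.pi)) : |x| = |y| := by
  have h1 : Real.arccos |x| = Real.arccos |y| :=
    (div_left_inj' Real.pi_ne_zero).1 (mul_left_cancel₀ two_ne_zero h)
  exact Real.arccos_injOn ⟨by linarith [abs_nonneg x], abs_le.2 hx⟩
    ⟨by linarith [abs_nonneg y], abs_le.2 hy⟩ h1

theorem re_mem_Icc {z : ℂ} (hz : ‖z‖ ≤ 1) : z.re ∈ Icc (-1 : ℝ) 1 :=
  abs_le.1 ((Complex.abs_re_le_norm z).trans hz)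

theorem re_mem_Ioo {z : ℂ} (hz : ‖z‖ < 1) : z.re ∈ Ioo (-1 : ℝ) 1 :=
  abs_lt.1 ((Complex.abs_re_le_norm z).trans_lt hz)

theorem eq_ofReal_of_im {z : ℂ} (hz : z.im = 0) : z = (z.re : ℂ) := by
  apply Complex.ext <;> simp [hz]

/-- The square root with nonnegative imaginary part. -/
noncomputable def upperSqrt (w : ℂ) : ℂ := √‖w‖ * turnPoint (turn w / 2)

theorem norm_upperSqrt (w : ℂ) : ‖upperSqrt w‖ = √‖w‖ := by
  simp [upperSqrt]

theorem upperSqrt_im_nonneg (w : ℂ) : 0 ≤ (upperSqrt w).im := by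
  rw [upperSqrt, Complex.im_ofReal_mul]
  exact mul_nonneg (Real.sqrt_nonneg _) (turnPoint_im_nonneg
    ⟨by linarith [turn_nonneg w], by linarith [turn_lt_one w]⟩)

theorem upperSqrt_sq (w : ℂ) : upperSqrt w ^ 2 = w := by
  rw [upperSqrt, mul_pow, sq (turnPoint _), ← turnPoint_add, add_halves, ← Complex.ofReal_pow,
    Real.sq_sqrt (norm_nonneg w), norm_mul_turnPoint_turn]

theorem upperSqrt_sq_eq {z : ℂ} (hz : 0 ≤ z.im) :
    upperSqrt (z ^ 2) = z ∨ z.im = 0 ∧ upperSqrt (z ^ 2) = -z := by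
  rcases sq_eq_sq_iff_eq_or_eq_neg.1 (upperSqrt_sq (z ^ 2)) with h | h
  · exact Or.inl h
  · refine Or.inr ⟨?_, h⟩
    have := upperSqrt_im_nonneg (z ^ 2)
    rw [h, Complex.neg_im] at this
    linarith

namespace IsDisk

variable {X : Type*} [TopologicalSpace X] {U U' : Set X} {b b' c p r : ℝ → X}

/-- Two adjacent, mutually inverse boundary paths of a disk are glued: the map `z ↦ z ^ 2` folds up
the diameter of a half disk. -/
theorem fold (h : IsDisk U (cat p (cat c (rev c)))) (hpc : p 1 = c 0)
    (hc : InjOn c (Ioc 0 1)) (hU : Disjoint U (c '' Ioc 0 1)) : IsDisk (U ∪ c '' Ioc 0 1) p := by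
  obtain ⟨q, h1, h2, h3, h4⟩ := h
  have hdiam : ∀ z : ℂ, ‖z‖ ≤ 1 → z.im = 0 →
      q (stretch z) = c (2 * (Real.arccos |z.re| / Real.pi)) := fun z hz hz' ↦ by
    conv_lhs => rw [eq_ofReal_of_im hz']
    exact apply_stretch_of_cat_rev h4 hpc (re_mem_Icc hz)
  let Q : ℂ → X := fun w ↦ q (stretch (upperSqrt w))
  have hQ : ∀ z : ℂ, ‖z‖ ≤ 1 → 0 ≤ z.im → Q (z ^ 2) = q (stretch z) := by
    intro z hz hz'
    rcases upperSqrt_sq_eq hz' with h | ⟨h, h'⟩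
    · simp only [Q, h]
    · simp only [Q, h']
      rw [hdiam z hz h, hdiam (-z) (by rwa [norm_neg]) (by simpa using h)]
      simp
  have hsq : ∀ w : ℂ, ‖w‖ ≤ 1 → ‖upperSqrt w‖ ≤ 1 := fun w hw ↦ by
    rw [norm_upperSqrt]
    exact Real.sqrt_le_one.2 hw
  have hsq' : ∀ w : ℂ, ‖w‖ < 1 → ‖upperSqrt w‖ < 1 := fun w hw ↦ by
    rw [norm_upperSqrt, Real.sqrt_lt' one_pos]
    simpa using hw
  have hQU : ∀ w : ℂ, ‖w‖ < 1 → 0 < (upperSqrt w).im → Q w ∈ U := fun w hw hw' ↦ by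
    rw [← h3]
    exact ⟨_, mem_ball_zero_iff.2 (norm_stretch_lt (hsq' w hw) hw'), rfl⟩
  have hQc : ∀ w : ℂ, ‖w‖ < 1 → (upperSqrt w).im = 0 → Q w ∈ c '' Ioc 0 1 := fun w hw hw' ↦
    ⟨_, two_mul_arccos_abs_mem (re_mem_Ioo (hsq' w hw)), (hdiam _ (hsq' w hw).le hw').symm⟩
  have himg : (fun z : ℂ ↦ z ^ 2) '' (closedBall 0 1 ∩ {z | 0 ≤ z.im}) = closedBall 0 1 := by
    ext w
    constructor
    · rintro ⟨z, hz, rfl⟩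
      have := mem_closedBall_zero_iff.1 hz.1
      simpa using this
    · intro hw
      exact ⟨upperSqrt w, ⟨mem_closedBall_zero_iff.2 (hsq w (mem_closedBall_zero_iff.1 hw)),
        upperSqrt_im_nonneg w⟩, upperSqrt_sq w⟩
  refine ⟨Q, ?_, fun z hz w hw hzw ↦ ?_, ?_, fun s hs ↦ ?_⟩
  · rw [← himg]
    refine continuousOn_image_of_comp ((isCompact_closedBall 0 1).inter_right
      (isClosed_le continuous_const Complex.continuous_im)) (by fun_prop) ?_
    refine ContinuousOn.congr (h1.comp continuous_stretch.continuousOn fun z hz ↦ ?_)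
      fun z hz ↦ hQ z (mem_closedBall_zero_iff.1 hz.1) hz.2
    exact mem_closedBall_zero_iff.2 (norm_stretch_le (mem_closedBall_zero_iff.1 hz.1) hz.2)
  · rw [mem_ball_zero_iff] at hz hw
    rcases (upperSqrt_im_nonneg z).eq_or_lt with hz' | hz' <;>
      rcases (upperSqrt_im_nonneg w).eq_or_lt with hw' | hw'
    · have e := hzw
      simp only [Q] at e
      rw [hdiam _ (hsq' z hz).le hz'.symm, hdiam _ (hsq' w hw).le hw'.symm] at e
      have e1 := hc (two_mul_arccos_abs_mem (re_mem_Ioo (hsq' z hz)))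
        (two_mul_arccos_abs_mem (re_mem_Ioo (hsq' w hw))) e
      have e2 := abs_eq_of_two_mul_arccos_abs_eq (re_mem_Icc (hsq' z hz).le)
        (re_mem_Icc (hsq' w hw).le) e1
      rw [← upperSqrt_sq z, ← upperSqrt_sq w, eq_ofReal_of_im hz'.symm, eq_ofReal_of_im hw'.symm]
      exact_mod_cast (sq_eq_sq_iff_abs_eq_abs _ _).2 e2
    · exact (hU.le_bot ⟨hQU w hw hw', hzw ▸ hQc z hz hz'.symm⟩).elim
    · exact (hU.le_bot ⟨hQU z hz hz', hzw ▸ hQc w hw hw'.symm⟩).elim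
    · have e := h2 (mem_ball_zero_iff.2 (norm_stretch_lt (hsq' z hz) hz'))
        (mem_ball_zero_iff.2 (norm_stretch_lt (hsq' w hw) hw')) hzw
      rw [← upperSqrt_sq z, ← upperSqrt_sq w, ← shrink_stretch (upperSqrt z), e, shrink_stretch]
  · ext x
    constructor
    · rintro ⟨z, hz, rfl⟩
      rw [mem_ball_zero_iff] at hz
      rcases (upperSqrt_im_nonneg z).eq_or_lt with hz' | hz'
      · exact Or.inr (hQc z hz hz'.symm)
      · exact Or.inl (hQU z hz hz')
    · rintro (hx | ⟨t, ht, rfl⟩)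
      · rw [← h3] at hx
        obtain ⟨z, hz, rfl⟩ := hx
        rw [mem_ball_zero_iff] at hz
        have hn := norm_shrink_lt hz
        refine ⟨shrink z ^ 2, ?_, ?_⟩
        · rw [mem_ball_zero_iff, norm_pow]
          exact pow_lt_one₀ (norm_nonneg _) hn two_ne_zero
        · rw [hQ _ hn.le (shrink_im_pos hz).le, stretch_shrink]
      · have ht1 : t / 2 * Real.pi ≤ Real.pi / 2 := by nlinarith [ht.2, Real.pi_pos]
        have ht0 : 0 < t / 2 * Real.pi := mul_pos (by linarith [ht.1]) Real.pi_pos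
        have hcos0 : 0 ≤ Real.cos (t / 2 * Real.pi) :=
          Real.cos_nonneg_of_mem_Icc ⟨by linarith [Real.pi_pos], ht1⟩
        have hcos : Real.arccos |Real.cos (t / 2 * Real.pi)| = t / 2 * Real.pi := by
          rw [abs_of_nonneg hcos0]
          exact Real.arccos_cos ht0.le (by linarith [Real.pi_pos])
        have hcos1 : Real.cos (t / 2 * Real.pi) < 1 := by
          rw [← Real.cos_zero]
          exact Real.cos_lt_cos_of_nonneg_of_le_pi le_rfl (by linarith [Real.pi_pos]) ht0
        have hn : ‖((Real.cos (t / 2 * Real.pi) : ℝ) : ℂ)‖ < 1 := by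
          rwa [Complex.norm_real, Real.norm_eq_abs, abs_of_nonneg hcos0]
        refine ⟨((Real.cos (t / 2 * Real.pi) : ℝ) : ℂ) ^ 2, ?_, ?_⟩
        · rw [mem_ball_zero_iff, norm_pow]
          exact pow_lt_one₀ (norm_nonneg _) hn two_ne_zero
        · rw [hQ _ hn.le (Complex.ofReal_im _).ge, hdiam _ hn.le (Complex.ofReal_im _),
            Complex.ofReal_re, hcos, mul_div_cancel_right₀ _ Real.pi_ne_zero]
          congr 1
          ring
  · have e : turnPoint s = turnPoint (s / 2) ^ 2 := by
      rw [sq, ← turnPoint_add, add_halves]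
    have him := turnPoint_im_nonneg (s := s / 2) ⟨by linarith [hs.1], by linarith [hs.2]⟩
    rw [e, hQ _ (norm_turnPoint _).le him, stretch_of_norm_eq_one (norm_turnPoint _) him,
      h4 _ ⟨by linarith [hs.1], by linarith [hs.2]⟩, cat_of_le (by linarith [hs.2])]
    congr 1
    ring

/-- A disk with two mutually inverse boundary paths is glued to a sphere. -/
theorem nonempty_homeomorph_sphere [T2Space X] (h : IsDisk U (cat c (rev c)))
    (hc : InjOn c (Icc 0 1)) (hU : Disjoint U (c '' Icc 0 1)) (hX : U ∪ c '' Icc 0 1 = univ) :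
    IsTwoSphere X := by
  obtain ⟨q, h1, h2, h3, h4⟩ := h
  let conj : ℂ → ℂ := starRingEnd ℂ
  have hnc : ∀ z, ‖conj z‖ = ‖z‖ := fun z ↦ Complex.norm_conj z
  have hci : ∀ z, (conj z).im = -z.im := fun z ↦ Complex.conj_im z
  have hcc : ∀ z, conj (conj z) = z := fun z ↦ Complex.conj_conj z
  have hconj : Continuous conj := Complex.continuous_conj
  let T := sphere (0 : EuclideanSpace ℝ (Fin 3)) 1
  have hT : ∀ x : EuclideanSpace ℝ (Fin 3), x ∈ T ↔ x 0 ^ 2 + x 1 ^ 2 + x 2 ^ 2 = 1 := by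
    intro x
    rw [mem_sphere_zero_iff_norm, ← pow_eq_one_iff_of_nonneg (norm_nonneg x) two_ne_zero,
      EuclideanSpace.real_norm_sq_eq, Fin.sum_univ_three]
  let ζ : T → ℂ := fun x ↦ ⟨x.1 0, x.1 1⟩
  have hζc : Continuous ζ := by
    have h : ζ = fun x : T ↦ ((x.1 0 : ℝ) : ℂ) + ((x.1 1 : ℝ) : ℂ) * Complex.I := by
      funext x
      apply Complex.ext <;> simp [ζ]
    rw [h]
    fun_prop
  have hζ : ∀ x : T, ‖ζ x‖ ^ 2 + x.1 2 ^ 2 = 1 := fun x ↦ by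
    rw [norm_sq_eq]
    exact (hT _).1 x.2
  have hζ1 : ∀ x : T, ‖ζ x‖ ≤ 1 := fun x ↦ by
    nlinarith [hζ x, sq_nonneg (x.1 2), norm_nonneg (ζ x)]
  have hζ2 : ∀ x : T, x.1 2 ≠ 0 → ‖ζ x‖ < 1 := fun x hx ↦ by
    have := sq_pos_of_ne_zero hx
    nlinarith [hζ x, norm_nonneg (ζ x)]
  let u : T → ℂ := fun x ↦ if 0 ≤ x.1 2 then shrink (ζ x) else conj (shrink (ζ x))
  have u1 : ∀ x : T, 0 ≤ x.1 2 → u x = shrink (ζ x) := fun x hx ↦ if_pos hx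
  have u2 : ∀ x : T, x.1 2 < 0 → u x = conj (shrink (ζ x)) := fun x hx ↦ if_neg hx.not_ge
  have u3 : ∀ x : T, 0 ≤ x.1 2 → 0 ≤ (u x).im := fun x hx ↦ by
    rw [u1 x hx]
    exact shrink_im_nonneg (hζ1 x)
  have u4 : ∀ x : T, x.1 2 < 0 → (u x).im < 0 ∧ ‖u x‖ < 1 := fun x hx ↦ by
    have := hζ2 x hx.ne
    rw [u2 x hx, hci, hnc]
    exact ⟨neg_neg_of_pos (shrink_im_pos this), norm_shrink_lt this⟩
  have u5 : ∀ x : T, ‖u x‖ ≤ 1 := fun x ↦ by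
    rcases le_or_gt 0 (x.1 2) with hx | hx
    · rw [u1 x hx]
      exact norm_shrink_le (hζ1 x)
    · exact (u4 x hx).2.le
  have uinj : Function.Injective u := by
    have key : ∀ x y : T, ζ x = ζ y → 0 ≤ x.1 2 * y.1 2 → x = y := by
      intro x y hxy hs
      have h0 : x.1 0 = y.1 0 := congrArg Complex.re hxy
      have h1 : x.1 1 = y.1 1 := congrArg Complex.im hxy
      have hx := hζ x
      rw [hxy, ← hζ y] at hx
      have h5 : x.1 2 ^ 2 = y.1 2 ^ 2 := by linarith
      have h2 : x.1 2 = y.1 2 := by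
        rcases sq_eq_sq_iff_eq_or_eq_neg.1 h5 with h | h
        · exact h
        · rw [h] at hs ⊢
          nlinarith
      ext i
      fin_cases i
      · exact h0
      · exact h1
      · exact h2
    intro x y hxy
    rcases le_or_gt 0 (x.1 2) with hx | hx <;> rcases le_or_gt 0 (y.1 2) with hy | hy
    · rw [u1 x hx, u1 y hy] at hxy
      refine key x y ?_ (mul_nonneg hx hy)
      rw [← stretch_shrink (ζ x), hxy, stretch_shrink]
    · have := u3 x hx
      rw [hxy] at this
      linarith [(u4 y hy).1]
    · have := u3 y hy
      rw [← hxy] at this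
      linarith [(u4 x hx).1]
    · rw [u2 x hx, u2 y hy] at hxy
      refine key x y ?_ (mul_nonneg_of_nonpos_of_nonpos hx.le hy.le)
      rw [← stretch_shrink (ζ x), ← hcc (shrink (ζ x)), hxy, hcc, stretch_shrink]
  -- the image of `u` is the disk without the open lower semicircle, where `q` is bijective
  have usurj : ∀ z : ℂ, (‖z‖ ≤ 1 ∧ 0 ≤ z.im) ∨ (‖z‖ < 1 ∧ z.im < 0) → ∃ x, u x = z := by
    have hex : ∀ w : ℂ, ‖w‖ ≤ 1 → ∀ ε : ℝ, ε ^ 2 = 1 → ∃ x : T, ζ x = w ∧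
        x.1 2 = ε * √(1 - ‖w‖ ^ 2) := by
      intro w hw ε hε
      have h5 : 0 ≤ 1 - ‖w‖ ^ 2 := by nlinarith [norm_nonneg w]
      refine ⟨⟨!₂[w.re, w.im, ε * √(1 - ‖w‖ ^ 2)], (hT _).2 ?_⟩, ?_, ?_⟩
      · rw [norm_sq_eq] at h5
        simp [mul_pow, hε, Real.sq_sqrt h5, norm_sq_eq]
      · apply Complex.ext <;> simp [ζ]
      · simp
    rintro z (⟨hz, hz'⟩ | ⟨hz, hz'⟩)
    · obtain ⟨x, hx1, hx2⟩ := hex (stretch z) (norm_stretch_le hz hz') 1 (by norm_num)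
      refine ⟨x, ?_⟩
      rw [u1 x (by rw [hx2]; positivity), hx1, shrink_stretch]
    · have hn : ‖stretch (conj z)‖ < 1 :=
        norm_stretch_lt (by rwa [hnc]) (by rw [hci]; linarith)
      obtain ⟨x, hx1, hx2⟩ := hex (stretch (conj z)) hn.le (-1) (by norm_num)
      refine ⟨x, ?_⟩
      have h5 : 0 < √(1 - ‖stretch (conj z)‖ ^ 2) :=
        Real.sqrt_pos.2 (by nlinarith [norm_nonneg (stretch (conj z))])
      rw [u2 x (by rw [hx2]; linarith), hx1, shrink_stretch, hcc]
  have hupper : ∀ t ∈ Icc (0 : ℝ) 1, q (turnPoint (t / 2)) = c t := fun t ht ↦ by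
    rw [h4 _ ⟨by linarith [ht.1], by linarith [ht.2]⟩, cat_of_le (by linarith [ht.2])]
    congr 1
    ring
  have hcirc : ∀ z : ℂ, ‖z‖ = 1 → 0 ≤ z.im → ∃ t ∈ Icc (0 : ℝ) 1, z = turnPoint (t / 2) := by
    intro z hz hz'
    obtain ⟨s, hs, rfl⟩ := exists_turnPoint_eq hz
    rcases le_or_gt s (1 / 2) with h | h
    · exact ⟨2 * s, ⟨by linarith [hs.1], by linarith⟩, by congr 1; ring⟩
    · linarith [turnPoint_im_neg ⟨h, hs.2⟩]
  have hcircU : ∀ x : T, ‖u x‖ = 1 → ∃ t ∈ Icc (0 : ℝ) 1, u x = turnPoint (t / 2) := by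
    intro x hx
    refine hcirc _ hx ?_
    rcases le_or_gt 0 (x.1 2) with h | h
    · exact u3 x h
    · linarith [(u4 x h).2]
  have hqU : ∀ z : ℂ, ‖z‖ < 1 → q z ∈ U := fun z hz ↦ h3 ▸ ⟨z, mem_ball_zero_iff.2 hz, rfl⟩
  have hbij : Function.Bijective (q ∘ u) := by
    constructor
    · intro x y hxy
      apply uinj
      simp only [Function.comp] at hxy
      rcases (u5 x).eq_or_lt with hx | hx <;> rcases (u5 y).eq_or_lt with hy | hy
      · obtain ⟨s, hs, hs'⟩ := hcircU x hx
        obtain ⟨t, ht, ht'⟩ := hcircU y hy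
        rw [hs', ht', hupper s hs, hupper t ht] at hxy
        rw [hs', ht', hc hs ht hxy]
      · obtain ⟨s, hs, hs'⟩ := hcircU x hx
        rw [hs', hupper s hs] at hxy
        exact (hU.le_bot ⟨hqU _ hy, s, hs, hxy⟩).elim
      · obtain ⟨s, hs, hs'⟩ := hcircU y hy
        rw [hs', hupper s hs] at hxy
        exact (hU.le_bot ⟨hqU _ hx, s, hs, hxy.symm⟩).elim
      · exact h2 (mem_ball_zero_iff.2 hx) (mem_ball_zero_iff.2 hy) hxy
    · intro x
      have hx : x ∈ U ∪ c '' Icc 0 1 := hX ▸ mem_univ x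
      rcases hx with hx | ⟨t, ht, rfl⟩
      · rw [← h3] at hx
        obtain ⟨z, hz, rfl⟩ := hx
        rw [mem_ball_zero_iff] at hz
        obtain ⟨y, hy⟩ := usurj z (by
          rcases le_or_gt 0 z.im with h | h
          · exact Or.inl ⟨hz.le, h⟩
          · exact Or.inr ⟨hz, h⟩)
        exact ⟨y, congrArg q hy⟩
      · obtain ⟨y, hy⟩ := usurj (turnPoint (t / 2)) (Or.inl ⟨(norm_turnPoint _).le,
          turnPoint_im_nonneg ⟨by linarith [ht.1], by linarith [ht.2]⟩⟩)
        exact ⟨y, (congrArg q hy).trans (hupper t ht)⟩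
  have hcont : Continuous (q ∘ u) := by
    have e : q ∘ u = fun x ↦ if 0 ≤ x.1 2 then q (shrink (ζ x)) else q (conj (shrink (ζ x))) := by
      funext x
      simp only [Function.comp, u]
      split_ifs <;> rfl
    rw [e]
    refine Continuous.if_le ?_ ?_ continuous_const (by fun_prop) fun x hx ↦ ?_
    · exact h1.comp_continuous (continuous_shrink.comp hζc) fun x ↦
        mem_closedBall_zero_iff.2 (norm_shrink_le (hζ1 x))
    · exact h1.comp_continuous (hconj.comp (continuous_shrink.comp hζc)) fun x ↦
        mem_closedBall_zero_iff.2 ((hnc _).trans_le (norm_shrink_le (hζ1 x)))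
    · have hn : ‖ζ x‖ = 1 := by
        have := hζ x
        rw [← hx] at this
        rw [← pow_eq_one_iff_of_nonneg (norm_nonneg _) two_ne_zero]
        linarith
      rcases le_total 0 (ζ x).im with h | h
      · rw [shrink_of_norm_eq_one hn h]
        obtain ⟨t, ht, e⟩ := hcirc _ hn h
        rw [e]
        simp only [conj]
        rw [← turnPoint_one_sub, hupper t ht,
          h4 _ ⟨by linarith [ht.2], by linarith [ht.1]⟩,
          cat_of_ge (by simp [rev]) (by linarith [ht.2]), rev]
        congr 1
        ring
      · have e : (shrink (ζ x)).im = 0 := by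
          simp only [shrink, chord_eq_of_norm_eq_one hn, abs_of_nonpos h]
          ring
        have e' : conj (shrink (ζ x)) = shrink (ζ x) := by
          rw [eq_ofReal_of_im e]
          exact Complex.conj_ofReal _
        rw [e']
  have : CompactSpace T := isCompact_iff_compactSpace.1 (isCompact_sphere _ _)
  exact ⟨(Continuous.homeoOfEquivCompactToT2 (f := Equiv.ofBijective _ hbij) hcont).symm⟩

end IsDisk

/-! ### Corners of disks -/

/-- Every point has arbitrarily small neighborhoods which the point does not disconnect. -/
def HasConnectedPuncturedNhds (X : Type*) [TopologicalSpace X] : Prop :=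
  ∀ x : X, ∀ N ∈ 𝓝 x, ∃ N' ∈ 𝓝 x, N' ⊆ N ∧ IsPreconnected (N' \ {x})

theorem exists_ball_near {X : Type*} [TopologicalSpace X] {q : ℂ → X}
    (h1 : ContinuousOn q (closedBall 0 1)) {w : ℂ} (hw : ‖w‖ ≤ 1) {N : Set X} (hN : N ∈ 𝓝 (q w))
    {δ : ℝ} (hδ : 0 < δ) : ∃ z : ℂ, ‖z‖ < 1 ∧ q z ∈ N ∧ ‖z - w‖ < δ := by
  have h := h1 w (mem_closedBall_zero_iff.2 hw) hN
  rw [Filter.mem_map, mem_nhdsWithin_iff] at h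
  obtain ⟨ε, hε, h⟩ := h
  have hcl : w ∈ closure (ball (0 : ℂ) 1) := by
    rw [closure_ball _ one_ne_zero]
    exact mem_closedBall_zero_iff.2 hw
  obtain ⟨z, hz, hz'⟩ := Metric.mem_closure_iff.1 hcl (min ε δ) (lt_min hε hδ)
  rw [dist_comm] at hz'
  refine ⟨z, mem_ball_zero_iff.1 hz, h ⟨hz'.trans_le (min_le_left _ _), ball_subset_closedBall hz⟩,
    ?_⟩
  rw [← dist_eq_norm]
  exact hz'.trans_le (min_le_right _ _)

/-- The corner between two adjacent sides of a disk which are glued to each other is not glued to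
any other corner: otherwise it would be a point which disconnects its neighborhoods. -/
theorem IsDisk.corner_notMem {X : Type*} [TopologicalSpace X] [T2Space X]
    (hX : HasConnectedPuncturedNhds X) {U : Set X} {p c : ℝ → X}
    (h : IsDisk U (cat p (cat c (rev c)))) (hpc : p 1 = c 0) (hc : InjOn c (Ioc 0 1))
    (hU : Disjoint U (p '' Icc 0 1 ∪ c '' Icc 0 1))
    (hcov : U ∪ (p '' Icc 0 1 ∪ c '' Icc 0 1) = univ)
    (hp : Disjoint (p '' Icc 0 1) (c '' Ioo 0 1)) : c 1 ∉ p '' Icc 0 1 := by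
  obtain ⟨q, h1, h2, h3, h4⟩ := h
  rintro ⟨t₀, ht₀, hpt⟩
  have hjoin : p 1 = cat c (rev c) 0 := by rw [cat_zero, hpc]
  have hbd : cat p (cat c (rev c)) '' Icc 0 1 = p '' Icc 0 1 ∪ c '' Icc 0 1 := by
    rw [image_cat hjoin, image_cat (by simp [rev]), image_rev, union_self]
  have hall : q '' closedBall 0 1 = univ := by rw [image_closedBall_eq h3 h4, hbd, hcov]
  have hqU : ∀ z : ℂ, ‖z‖ < 1 → q z ∈ U := fun z hz ↦ h3 ▸ ⟨z, mem_ball_zero_iff.2 hz, rfl⟩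
  have hqB : ∀ z : ℂ, ‖z‖ = 1 → q z ∈ p '' Icc 0 1 ∪ c '' Icc 0 1 := fun z hz ↦ by
    obtain ⟨s, hs, rfl⟩ := exists_turnPoint_eq hz
    rw [h4 s (Ico_subset_Icc_self hs), ← hbd]
    exact mem_image_of_mem _ (Ico_subset_Icc_self hs)
  have hqp : ∀ z : ℂ, ‖z‖ = 1 → 0 ≤ z.im → q z ∈ p '' Icc 0 1 := fun z hz hz' ↦ by
    obtain ⟨s, hs, rfl⟩ := exists_turnPoint_eq hz
    rcases le_or_gt s (1 / 2) with h | h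
    · rw [h4 s (Ico_subset_Icc_self hs), cat_of_le h]
      exact ⟨2 * s, ⟨by linarith [hs.1], by linarith⟩, rfl⟩
    · linarith [turnPoint_im_neg ⟨h, hs.2⟩]
  have hqc : ∀ z : ℂ, ‖z‖ = 1 → z.im < 0 → q z = c (2 * (Real.arccos |z.re| / Real.pi)) ∧
      2 * (Real.arccos |z.re| / Real.pi) ∈ Ioc (0 : ℝ) 1 := fun z hz hz' ↦ by
    have e : stretch (z.re : ℂ) = z := by
      apply Complex.ext
      · simp [stretch]
      · have : chord (z.re : ℂ) = chord z := by simp [chord]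
        simp only [stretch, this, chord_eq_of_norm_eq_one hz, abs_of_neg hz']
        simp
    have hre : z.re ∈ Ioo (-1 : ℝ) 1 := by
      rw [norm_eq_one_iff'] at hz
      rw [mem_Ioo, ← abs_lt, ← sq_lt_one_iff_abs_lt_one]
      nlinarith
    refine ⟨?_, two_mul_arccos_abs_mem hre⟩
    rw [← apply_stretch_of_cat_rev h4 hpc (Ioo_subset_Icc_self hre), e]
  let v : ℂ → ℝ := fun z ↦ ‖z + Complex.I‖
  have hvc : Continuous v := by fun_prop
  have hv : ∀ z : ℂ, ‖z‖ = 1 → v z ^ 2 = 2 + 2 * z.im := fun z hz ↦ by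
    rw [norm_eq_one_iff'] at hz
    simp only [v, norm_sq_eq]
    simp
    linarith
  have hv0 : ∀ z, 0 ≤ v z := fun z ↦ norm_nonneg _
  have hcomp : ∀ s : Set ℂ, IsClosed s → IsCompact (q '' (closedBall 0 1 ∩ s)) := fun s hs ↦
    ((isCompact_closedBall 0 1).inter_right hs).image_of_continuousOn (h1.mono inter_subset_left)
  let A := q '' (closedBall 0 1 ∩ {z | v z ≤ 1})
  let B := q '' (closedBall 0 1 ∩ {z | 1 ≤ v z})
  let C := q '' (closedBall 0 1 ∩ {z | v z = 1})
  have hA : IsClosed A := (hcomp _ (isClosed_le hvc continuous_const)).isClosed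
  have hB : IsClosed B := (hcomp _ (isClosed_le continuous_const hvc)).isClosed
  have hC : IsClosed C := (hcomp _ (isClosed_eq hvc continuous_const)).isClosed
  have hcU : ∀ t ∈ Icc (0 : ℝ) 1, c t ∉ U := fun t ht h ↦
    hU.le_bot ⟨h, Or.inr ⟨t, ht, rfl⟩⟩
  have hvim : ∀ z : ℂ, ‖z‖ = 1 → v z ≤ 1 → z.im ≤ -1 / 2 := fun z hz hz' ↦ by
    nlinarith [hv z hz, hv0 z]
  have hxC : c 1 ∉ C := by
    rintro ⟨z, ⟨hz, hz1⟩, hz'⟩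
    rcases (mem_closedBall_zero_iff.1 hz).eq_or_lt with hz | hz
    · obtain ⟨e, m⟩ := hqc z hz (by linarith [hvim z hz hz1.le])
      rw [e] at hz'
      have e1 := hc m ⟨one_pos, le_rfl⟩ hz'
      have e2 : Real.arccos |z.re| = Real.pi / 2 := by
        field_simp at e1
        linarith
      rw [Real.arccos_eq_pi_div_two, abs_eq_zero] at e2
      have e3 := hv z hz
      rw [hz1.out] at e3
      rw [norm_eq_one_iff', e2] at hz
      nlinarith
    · exact hcU 1 (by simp) (hz' ▸ hqU z hz)
  obtain ⟨N, hN, hNC, hNp⟩ := hX (c 1) Cᶜ (hC.isOpen_compl.mem_nhds hxC)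
  have hcover : N \ {c 1} ⊆ A ∪ B := by
    intro y _
    have hy : y ∈ q '' closedBall 0 1 := hall ▸ mem_univ y
    obtain ⟨z, hz, rfl⟩ := hy
    exact (le_total (v z) 1).imp (fun h ↦ ⟨z, ⟨hz, h⟩, rfl⟩) (fun h ↦ ⟨z, ⟨hz, h⟩, rfl⟩)
  have hNA : ((N \ {c 1}) ∩ A).Nonempty := by
    have e : q (-Complex.I) = c 1 := by
      have := (hqc (-Complex.I) (by simp) (by simp)).1
      rw [this]
      simp [Real.arccos_zero]
      congr 1
      field_simp
    obtain ⟨z, hz, hzN, hzd⟩ := exists_ball_near h1 (w := -Complex.I) (by simp)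
      (e ▸ hN : N ∈ 𝓝 (q (-Complex.I))) one_pos
    rw [sub_neg_eq_add] at hzd
    exact ⟨q z, ⟨hzN, fun h ↦ hcU 1 (by simp) (h ▸ hqU z hz)⟩,
      z, ⟨mem_closedBall_zero_iff.2 hz.le, hzd.le⟩, rfl⟩
  have hNB : ((N \ {c 1}) ∩ B).Nonempty := by
    have him := turnPoint_im_nonneg (s := t₀ / 2) ⟨by linarith [ht₀.1], by linarith [ht₀.2]⟩
    have e : q (turnPoint (t₀ / 2)) = c 1 := by
      rw [h4 _ ⟨by linarith [ht₀.1], by linarith [ht₀.2]⟩, cat_of_le (by linarith [ht₀.2]), ← hpt]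
      congr 1
      ring
    obtain ⟨z, hz, hzN, hzd⟩ := exists_ball_near h1 (norm_turnPoint (t₀ / 2)).le
      (e ▸ hN : N ∈ 𝓝 (q (turnPoint (t₀ / 2)))) (show (0 : ℝ) < 1 / 4 by norm_num)
    have hv1 : 5 / 4 ≤ v (turnPoint (t₀ / 2)) := by
      nlinarith [hv _ (norm_turnPoint (t₀ / 2)), hv0 (turnPoint (t₀ / 2))]
    have hv2 : v (turnPoint (t₀ / 2)) ≤ v z + ‖z - turnPoint (t₀ / 2)‖ := by
      have := norm_sub_le (z + Complex.I) (z - turnPoint (t₀ / 2))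
      rwa [show z + Complex.I - (z - turnPoint (t₀ / 2)) = turnPoint (t₀ / 2) + Complex.I by
        ring] at this
    exact ⟨q z, ⟨hzN, fun h ↦ hcU 1 (by simp) (h ▸ hqU z hz)⟩,
      z, ⟨mem_closedBall_zero_iff.2 hz.le, by rw [mem_ofPred_eq]; linarith⟩, rfl⟩
  obtain ⟨y, ⟨hyN, hyx⟩, ⟨z, ⟨hz, hzv⟩, hzy⟩, ⟨w, ⟨hw, hwv⟩, hwy⟩⟩ :=
    isPreconnected_closed_iff.1 hNp A B hA hB hcover hNA hNB
  have hzv' : v z ≠ 1 := fun h ↦ hNC hyN ⟨z, ⟨hz, h⟩, hzy⟩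
  have hwv' : v w ≠ 1 := fun h ↦ hNC hyN ⟨w, ⟨hw, h⟩, hwy⟩
  rw [mem_ofPred_eq] at hzv hwv
  have hvne : v z ≠ v w := fun h ↦ hzv' (le_antisymm hzv (h ▸ hwv))
  rw [mem_closedBall_zero_iff] at hz hw
  rw [← hwy] at hzy
  rcases hz.eq_or_lt with hz | hz <;> rcases hw.eq_or_lt with hw | hw
  · have hzim : z.im < 0 := by linarith [hvim z hz hzv]
    obtain ⟨e, m⟩ := hqc z hz hzim
    rcases lt_or_ge w.im 0 with hwim | hwim
    · obtain ⟨e', m'⟩ := hqc w hw hwim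
      rw [e, e'] at hzy
      have e1 := abs_eq_of_two_mul_arccos_abs_eq (re_mem_Icc hz.le) (re_mem_Icc hw.le)
        (hc m m' hzy)
      apply hvne
      rw [← sq_eq_sq₀ (hv0 _) (hv0 _), hv z hz, hv w hw]
      have e2 : z.re ^ 2 = w.re ^ 2 := (sq_eq_sq_iff_abs_eq_abs _ _).2 e1
      rw [norm_eq_one_iff'] at hz hw
      have e3 : (z.im - w.im) * (z.im + w.im) = 0 := by linarith
      rcases mul_eq_zero.1 e3 with h | h <;> linarith
    · rcases m.2.eq_or_lt with m1 | m1
      · rw [m1] at e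
        exact hyx (by rw [← hwy, ← hzy, e]; rfl)
      · exact hp.le_bot ⟨hqp w hw hwim, hzy ▸ e ▸ ⟨_, ⟨m.1, m1⟩, rfl⟩⟩
  · exact hU.le_bot ⟨hqU w hw, hzy ▸ hqB z hz⟩
  · exact hU.le_bot ⟨hqU z hz, hzy ▸ hqB w hw⟩
  · exact hvne (congrArg v (h2 (mem_ball_zero_iff.2 hz) (mem_ball_zero_iff.2 hw) hzy))

/-! ### Boundary words -/

/-- The concatenation of the paths along the nonempty list `d :: w` of darts. -/
noncomputable def wordPath {Δ X : Type*} (γ : Δ → ℝ → X) : Δ → List Δ → ℝ → X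
  | d, [] => γ d
  | d, e :: w => cat (γ d) (wordPath γ e w)

/-- The path `b` runs along the nonempty list `w` of darts, up to reparametrization. -/
def IsPathAlong {Δ X : Type*} (γ : Δ → ℝ → X) : List Δ → (ℝ → X) → Prop
  | [], _ => False
  | d :: w, b => Reparam (wordPath γ d w) b

namespace IsPathAlong

variable {Δ X : Type*} {γ : Δ → ℝ → X} {u v w : List Δ} {b b' c : ℝ → X}

theorem exists_of_ne_nil (hw : w ≠ []) : ∃ b, IsPathAlong γ w b := by
  obtain ⟨d, w, rfl⟩ := List.exists_cons_of_ne_nil hw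
  exact ⟨_, .refl _⟩

theorem singleton (d : Δ) : IsPathAlong γ [d] (γ d) := Reparam.refl _

theorem congr (h : IsPathAlong γ w b) (h' : Reparam b b') : IsPathAlong γ w b' := by
  cases w with
  | nil => exact h.elim
  | cons d w => exact Reparam.trans h h'

theorem reparam (h : IsPathAlong γ w b) (h' : IsPathAlong γ w b') : Reparam b b' := by
  cases w with
  | nil => exact h.elim
  | cons d w => exact (Reparam.symm h).trans h'

theorem append (h : IsPathAlong γ u b) (h' : IsPathAlong γ v c) :
    IsPathAlong γ (u ++ v) (cat b c) := by
  cases v with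
  | nil => exact h'.elim
  | cons e v =>
    cases u with
    | nil => exact h.elim
    | cons d u =>
      have key : ∀ u d, Reparam (wordPath γ d (u ++ e :: v))
          (cat (wordPath γ d u) (wordPath γ e v)) := by
        intro u
        induction u with
        | nil => exact fun d ↦ .refl _
        | cons d' u ih =>
          exact fun d ↦ ((Reparam.refl _).cat (ih d')).trans (Reparam.cat_assoc _ _ _)
      exact (key u d).trans (Reparam.cat h h')

theorem endpoints {V : Type*} {src tgt : Δ → V} {pt : V → X} (h0 : ∀ d, γ d 0 = pt (src d))
    (h1 : ∀ d, γ d 1 = pt (tgt d)) (h : IsPathAlong γ w b) {x y : V}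
    (hw : IsWalk src tgt x w y) : b 0 = pt x ∧ b 1 = pt y ∧
      b '' Icc 0 1 = ⋃ d ∈ w, γ d '' Icc 0 1 := by
  induction w generalizing x b with
  | nil => exact h.elim
  | cons d w ih =>
    obtain ⟨rfl, hw⟩ := hw
    cases w with
    | nil =>
      have h' : Reparam (γ d) b := h
      rw [h'.apply_zero, h'.apply_one, h'.image_eq, h0, h1]
      simp [show tgt d = y from hw]
    | cons e w =>
      have h' : Reparam (cat (γ d) (wordPath γ e w)) b := h
      obtain ⟨e0, e1, e2⟩ := ih (b := wordPath γ e w) (Reparam.refl _) hw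
      have hj : γ d 1 = wordPath γ e w 0 := by rw [e0, h1]
      rw [h'.apply_zero, h'.apply_one, h'.image_eq, image_cat hj, cat_zero, cat_one, e1, e2, h0]
      simp

end IsPathAlong

/-! ### Spaces glued from disks -/

/-- A space `X` which is glued from disks as prescribed by `P`: the images of the vertices, of the
open sides and of the open polygons are disjoint and cover `X`. -/
structure GluedSpace {Δ F V : Type*} (P : PolygonGluing Δ F V) (X : Type*)
    [TopologicalSpace X] where
  pt : V → X
  /-- The sides, as functions on the unit interval. -/
  path : Δ → ℝ → X
  /-- The open polygons. -/
  cell : F → Set X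
  path_zero : ∀ d, path d 0 = pt (P.src d)
  path_one : ∀ d, path d 1 = pt (P.tgt d)
  path_opp : ∀ d, path (P.opp d) = rev (path d)
  injOn_path : ∀ d, InjOn (path d) (Icc 0 1)
  pt_notMem : ∀ v d, pt v ∉ path d '' Ioo 0 1
  disjoint_path : ∀ d e, e ≠ d → e ≠ P.opp d → Disjoint (path d '' Ioo 0 1) (path e '' Ioo 0 1)
  disjoint_cell : ∀ f g, f ≠ g → Disjoint (cell f) (cell g)
  pt_notMem_cell : ∀ v f, pt v ∉ cell f
  disjoint_cell_path : ∀ f d, Disjoint (cell f) (path d '' Ioo 0 1)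
  two_le : ∀ f, 2 ≤ (P.bd f).length
  exists_isDisk : ∀ f, ∃ b, IsPathAlong path (P.bd f) b ∧ IsDisk (cell f) b
  cover : (⋃ f, cell f) ∪ (⋃ d, path d '' Icc 0 1) = univ

namespace GluedSpace

variable {Δ F V : Type*} {P : PolygonGluing Δ F V} {X : Type*} [TopologicalSpace X]
  (K : GluedSpace P X)

/-- `K.DiskAlong U w`: there is a disk in `X` with interior `U` and boundary word `w`. -/
def DiskAlong (U : Set X) (w : List Δ) : Prop := ∃ b, IsPathAlong K.path w b ∧ IsDisk U b

/-- The union of the sides in a word. -/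
def carrier (w : List Δ) : Set X := ⋃ d ∈ w, K.path d '' Icc 0 1

theorem path_mem_Icc (d : Δ) : K.path d '' Icc 0 1 =
    insert (K.pt (P.src d)) (insert (K.pt (P.tgt d)) (K.path d '' Ioo 0 1)) := by
  have : Icc (0 : ℝ) 1 = insert 0 (insert 1 (Ioo 0 1)) := by
    ext t
    constructor
    · rintro ⟨h0, h1⟩
      rcases h0.eq_or_lt with rfl | h0
      · exact Or.inl rfl
      rcases h1.eq_or_lt with rfl | h1
      · exact Or.inr (Or.inl rfl)
      · exact Or.inr (Or.inr ⟨h0, h1⟩)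
    · rintro (rfl | rfl | h)
      · simp
      · simp
      · exact Ioo_subset_Icc_self h
  rw [this, image_insert_eq, image_insert_eq, K.path_zero, K.path_one]

theorem image_path_opp (d : Δ) : K.path (P.opp d) '' Ioo 0 1 = K.path d '' Ioo 0 1 := by
  rw [K.path_opp]
  ext x
  constructor
  · rintro ⟨t, ht, rfl⟩
    exact ⟨1 - t, ⟨by linarith [ht.2], by linarith [ht.1]⟩, rfl⟩
  · rintro ⟨t, ht, rfl⟩
    exact ⟨1 - t, ⟨by linarith [ht.2], by linarith [ht.1]⟩, by simp [rev]⟩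

theorem image_path_opp_Icc (d : Δ) : K.path (P.opp d) '' Icc 0 1 = K.path d '' Icc 0 1 := by
  rw [K.path_opp, image_rev]

variable {K} {U : Set X} {u v w : List Δ} {b : ℝ → X}

theorem endpoints {x y : V} (hb : IsPathAlong K.path w b) (hw : IsWalk P.src P.tgt x w y) :
    b 0 = K.pt x ∧ b 1 = K.pt y ∧ b '' Icc 0 1 = K.carrier w :=
  hb.endpoints K.path_zero K.path_one hw

theorem carrier_append : K.carrier (u ++ v) = K.carrier u ∪ K.carrier v := by
  ext x
  simp only [carrier, List.mem_append, mem_iUnion, mem_union]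
  constructor
  · rintro ⟨d, hd | hd, h⟩
    · exact Or.inl ⟨d, hd, h⟩
    · exact Or.inr ⟨d, hd, h⟩
  · rintro (⟨d, hd, h⟩ | ⟨d, hd, h⟩)
    · exact ⟨d, Or.inl hd, h⟩
    · exact ⟨d, Or.inr hd, h⟩

theorem mem_carrier_of_isWalk {x y : V} (hw : IsWalk P.src P.tgt x w y) (hne : w ≠ []) :
    K.pt x ∈ K.carrier w ∧ K.pt y ∈ K.carrier w := by
  obtain ⟨b, hb⟩ := IsPathAlong.exists_of_ne_nil (γ := K.path) hne
  obtain ⟨h0, h1, h2⟩ := endpoints hb hw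
  rw [← h2, ← h0, ← h1]
  exact ⟨⟨0, by simp, rfl⟩, ⟨1, by simp, rfl⟩⟩

theorem disjoint_path_Icc {d e : Δ} (h1 : e ≠ d) (h2 : e ≠ P.opp d) :
    Disjoint (K.path d '' Ioo 0 1) (K.path e '' Icc 0 1) := by
  rw [K.path_mem_Icc, disjoint_insert_right, disjoint_insert_right]
  exact ⟨K.pt_notMem _ _, K.pt_notMem _ _, K.disjoint_path _ _ h1 h2⟩

theorem disjoint_path_carrier {d : Δ} (h1 : d ∉ w) (h2 : P.opp d ∉ w) :
    Disjoint (K.path d '' Ioo 0 1) (K.carrier w) := by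
  simp only [carrier, disjoint_iUnion_right]
  exact fun e he ↦ disjoint_path_Icc (fun h ↦ h1 (h ▸ he)) (fun h ↦ h2 (h ▸ he))

theorem disjoint_cell_carrier {f : F} : Disjoint (K.cell f) (K.carrier w) := by
  simp only [carrier, disjoint_iUnion_right]
  intro e he
  rw [K.path_mem_Icc, disjoint_insert_right, disjoint_insert_right]
  exact ⟨K.pt_notMem_cell _ _, K.pt_notMem_cell _ _, K.disjoint_cell_path _ _⟩

namespace DiskAlong

theorem isDisk (h : K.DiskAlong U w) (hb : IsPathAlong K.path w b) : IsDisk U b := by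
  obtain ⟨b', hb', h⟩ := h
  exact h.reparam (hb'.reparam hb)

theorem rotate {x : V} (h : K.DiskAlong U (u ++ v)) (hw : IsWalk P.src P.tgt x (u ++ v) x) :
    K.DiskAlong U (v ++ u) := by
  rcases eq_or_ne u [] with rfl | hu
  · simpa using h
  rcases eq_or_ne v [] with rfl | hv
  · simpa using h
  obtain ⟨b, hb⟩ := IsPathAlong.exists_of_ne_nil (γ := K.path) hu
  obtain ⟨c, hc⟩ := IsPathAlong.exists_of_ne_nil (γ := K.path) hv
  obtain ⟨y, h1, h2⟩ := isWalk_append.1 hw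
  refine ⟨cat c b, hc.append hb, (h.isDisk (hb.append hc)).rotate ?_⟩
  rw [(endpoints hb h1).2.1, (endpoints hc h2).1]

end DiskAlong

theorem isWalk_rotate {x : V} (hw : IsWalk P.src P.tgt x (u ++ v) x) :
    ∃ y, IsWalk P.src P.tgt y (v ++ u) y := by
  obtain ⟨y, h1, h2⟩ := isWalk_append.1 hw
  exact ⟨y, isWalk_append.2 ⟨x, h2, h1⟩⟩

/-- The polygons of a glued space are merged to a single disk. -/
theorem diskAlong_of_merged [T2Space X] {f₀ : F} {M : Set F} {R : Set Δ}
    (h : P.Merged f₀ M w R) : 2 ≤ w.length ∧ (∀ x ∈ R, K.pt (P.src x) ∈ K.carrier w) ∧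
      K.DiskAlong ((⋃ f ∈ M, K.cell f) ∪ ⋃ x ∈ R, K.path x '' Ioo 0 1) w := by
  induction h with
  | base => exact ⟨K.two_le _, fun x hx ↦ hx.elim, by simpa [DiskAlong] using K.exists_isDisk _⟩
  | @step M w₁ w₂ r d f R h hf hr ih =>
    obtain ⟨hlen, hpt, hdisk⟩ := ih
    have hrlen : 2 ≤ (P.opp d :: r).length := hr.perm.length_eq ▸ K.two_le f
    have hrne : r ≠ [] := by
      rintro rfl
      simp at hrlen
    have hwne : w₂ ++ w₁ ≠ [] := by
      intro h0
      simp only [List.append_eq_nil_iff] at h0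
      simp [h0.1, h0.2] at hlen
    have hwalk := PolygonGluing.isWalk_of_isRotated hr
    obtain ⟨hr1, hr2⟩ := mem_carrier_of_isWalk (K := K) hwalk hrne
    refine ⟨?_, ?_, ?_⟩
    · have h1 : 0 < (w₂ ++ w₁).length := List.length_pos_iff.2 hwne
      have h2 : 0 < r.length := List.length_pos_iff.2 hrne
      simp only [List.length_append] at h1 ⊢
      omega
    · have hmono : ∀ v, K.pt v ∈ K.carrier (w₁ ++ d :: w₂) → K.pt v ∈ K.carrier (w₁ ++ r ++ w₂) := by
        intro v hv
        rw [show d :: w₂ = [d] ++ w₂ from rfl, carrier_append, carrier_append] at hv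
        rw [carrier_append, carrier_append]
        rcases hv with hv | hv | hv
        · exact Or.inl (Or.inl hv)
        · have hv' : K.pt v ∈ K.path d '' Icc 0 1 := by simpa [carrier] using hv
          rw [K.path_mem_Icc] at hv'
          rcases hv' with h' | h' | h'
          · exact Or.inl (Or.inr (h' ▸ hr1))
          · exact Or.inl (Or.inr (h' ▸ hr2))
          · exact (K.pt_notMem _ _ h').elim
        · exact Or.inr hv
      have hsub : K.carrier r ⊆ K.carrier (w₁ ++ r ++ w₂) := by
        rw [carrier_append, carrier_append]
        exact fun x hx ↦ Or.inl (Or.inr hx)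
      rintro x (rfl | rfl | hx)
      · exact hsub hr1
      · rw [P.src_opp]
        exact hsub hr2
      · exact hmono _ (hpt x hx)
    · obtain ⟨x, hx⟩ := h.exists_isWalk
      rw [show w₁ ++ d :: w₂ = (w₁ ++ [d]) ++ w₂ by simp] at hx hdisk
      have hdisk' := hdisk.rotate hx
      obtain ⟨y, hy⟩ := isWalk_rotate hx
      rw [← List.append_assoc] at hdisk' hy
      obtain ⟨z, hz1, hz2⟩ := isWalk_append.1 hy
      obtain ⟨p, hp⟩ := IsPathAlong.exists_of_ne_nil (γ := K.path) hwne
      obtain ⟨ρ, hρ⟩ := IsPathAlong.exists_of_ne_nil (γ := K.path) hrne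
      have hU := hdisk'.isDisk (hp.append (.singleton d))
      obtain ⟨n, hn⟩ := hr.symm
      have hface : K.DiskAlong (K.cell f) (P.opp d :: r) := by
        obtain ⟨x', hx'⟩ := P.isWalk_bd f
        rw [← hn, List.rotate_eq_drop_append_take_mod]
        have hdb : K.DiskAlong (K.cell f) (P.bd f) := K.exists_isDisk f
        rw [← List.take_append_drop (n % (P.bd f).length) (P.bd f)] at hx' hdb
        exact hdb.rotate hx'
      have hU' := hface.isDisk ((IsPathAlong.singleton (P.opp d)).append hρ)
      rw [K.path_opp] at hU'
      have hpd : p 1 = K.path d 0 := by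
        rw [(endpoints hp hz1).2.1, K.path_zero, hz2.1]
      have hdR : d ∉ R ∧ P.opp d ∉ R := by
        have h1 := (h.mem_iff (x := d)).1 (by simp)
        refine ⟨h1.2, fun h2 ↦ h1.2 ?_⟩
        simpa [P.opp_opp] using h.opp_mem h2
      have hm := hU.merge hU' hpd ((K.injOn_path d).mono Ioo_subset_Icc_self) ?_ ?_
        (K.disjoint_cell_path f d)
      · have hD : K.DiskAlong ((⋃ g ∈ insert f M, K.cell g) ∪
            ⋃ x ∈ insert d (insert (P.opp d) R), K.path x '' Ioo 0 1) (w₂ ++ w₁ ++ r) := by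
          refine ⟨_, hp.append hρ, ?_⟩
          convert! hm using 1
          simp only [biUnion_insert, K.image_path_opp]
          ext x
          simp only [mem_union]
          tauto
        rw [List.append_assoc] at hD
        refine hD.rotate (x := P.tgt d) ?_
        have hz : z = P.src d := hz2.1.symm
        have hy' : y = P.tgt d := (hz2.2 : P.tgt d = y).symm
        rw [← List.append_assoc, isWalk_append]
        exact ⟨P.src d, by rwa [hz, hy'] at hz1, hwalk⟩
      · simp only [disjoint_union_left, disjoint_iUnion_left]
        exact ⟨fun g hg ↦ K.disjoint_cell _ _ fun h' ↦ hf (h' ▸ hg),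
          fun x _ ↦ (K.disjoint_cell_path f x).symm⟩
      · simp only [disjoint_union_left, disjoint_iUnion_left]
        refine ⟨fun g _ ↦ K.disjoint_cell_path g d, fun x hx ↦ K.disjoint_path _ _ ?_ ?_⟩
        · exact fun h' ↦ hdR.1 (h' ▸ hx)
        · exact fun h' ↦ hdR.2 (by rw [h', P.opp_opp]; exact hx)

/-- A disk whose boundary word folds up is glued to a sphere. -/
theorem isTwoSphere_of_folds [T2Space X] (hX : HasConnectedPuncturedNhds X) (hw : P.Folds w)
    (hne : w ≠ []) (hn : w.Nodup) {x : V} (hwalk : IsWalk P.src P.tgt x w x)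
    (hD : K.DiskAlong U w) (hU : Disjoint U (K.carrier w)) (hcov : U ∪ K.carrier w = univ) :
    IsTwoSphere X := by
  induction hw generalizing U with
  | nil => exact (hne rfl).elim
  | @step u v d hw ih =>
    have hsplit : u ++ d :: P.opp d :: v = (u ++ [d, P.opp d]) ++ v := by simp
    have hcd : K.carrier [d, P.opp d] = K.path d '' Icc 0 1 := by
      simp [carrier, K.image_path_opp_Icc]
    have hcar : K.carrier (u ++ d :: P.opp d :: v) =
        K.carrier (u ++ v) ∪ K.path d '' Icc 0 1 := by
      rw [hsplit, carrier_append, carrier_append, hcd, carrier_append, union_assoc, union_assoc,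
        union_comm (K.carrier v)]
    have hwalk' := hwalk
    rw [hsplit] at hwalk' hD
    have hD' := hD.rotate hwalk'
    obtain ⟨y, hy⟩ := isWalk_rotate hwalk'
    have hdd : IsPathAlong K.path [d, P.opp d] (cat (K.path d) (rev (K.path d))) := by
      rw [← K.path_opp]
      exact (IsPathAlong.singleton d).append (.singleton (P.opp d))
    rw [hcar] at hU hcov
    by_cases huv : v ++ u = []
    · rw [← List.append_assoc, huv, List.nil_append] at hD'
      have huv' : u ++ v = [] := by simpa [and_comm] using huv
      have hc0 : K.carrier (u ++ v) = ∅ := by simp [huv', carrier]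
      rw [hc0, empty_union] at hU hcov
      exact (hD'.isDisk hdd).nonempty_homeomorph_sphere (K.injOn_path d) hU hcov
    · rw [← List.append_assoc] at hD' hy
      obtain ⟨z, hz1, hz2⟩ := isWalk_append.1 hy
      obtain ⟨p, hp⟩ := IsPathAlong.exists_of_ne_nil (γ := K.path) huv
      obtain ⟨-, hp1, hpim⟩ := endpoints hp hz1
      have hcomm : K.carrier (v ++ u) = K.carrier (u ++ v) := by
        rw [carrier_append, carrier_append, union_comm]
      rw [hcomm] at hpim
      have hzd : z = P.src d := hz2.1.symm
      have hpd : p 1 = K.path d 0 := by rw [hp1, K.path_zero, hzd]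
      have hinj : InjOn (K.path d) (Ioc 0 1) := (K.injOn_path d).mono Ioc_subset_Icc_self
      have hdisk := hD'.isDisk (hp.append hdd)
      have hduv : d ∉ u ++ v ∧ P.opp d ∉ u ++ v := by
        rw [List.nodup_append, List.nodup_cons, List.nodup_cons] at hn
        simp only [List.mem_cons, not_or, List.mem_append] at hn ⊢
        exact ⟨⟨fun h ↦ hn.2.2 d h d (Or.inl rfl) rfl, hn.2.1.1.2⟩,
          fun h ↦ hn.2.2 _ h _ (Or.inr (Or.inl rfl)) rfl, hn.2.1.2.1⟩
      have hdis := disjoint_path_carrier (K := K) hduv.1 hduv.2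
      have hcorner : K.path d 1 ∉ K.carrier (u ++ v) := by
        rw [← hpim] at hdis hU hcov ⊢
        exact hdisk.corner_notMem hX hpd hinj hU hcov hdis.symm
      have hIoc : K.path d '' Ioc 0 1 = insert (K.path d 1) (K.path d '' Ioo 0 1) := by
        rw [← Ioo_insert_right one_pos, image_insert_eq]
      have hsub : K.path d '' Ioc 0 1 ⊆ K.path d '' Icc 0 1 := image_mono Ioc_subset_Icc_self
      have hfold := hdisk.fold hpd hinj (hU.mono_right (hsub.trans subset_union_right))
      have hyz : y = z := by
        have : P.tgt (P.opp d) = y := hz2.2.2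
        rw [← this, P.tgt_opp, hzd]
      subst hyz
      have hD2 : K.DiskAlong (U ∪ K.path d '' Ioc 0 1) (v ++ u) := ⟨p, hp, hfold⟩
      obtain ⟨y', hy'⟩ := isWalk_append.1 hwalk
      have hwalk2 : IsWalk P.src P.tgt x (u ++ v) x := by
        have h2 := hy'.2.2.2
        rw [P.tgt_opp, hy'.2.1] at h2
        exact isWalk_append.2 ⟨_, hy'.1, h2⟩
      refine ih ?_ ?_ hwalk2 (hD2.rotate hz1) ?_ ?_
      · rw [Ne, List.append_eq_nil_iff]
        rw [List.append_eq_nil_iff] at huv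
        exact fun h ↦ huv h.symm
      · exact hn.sublist (List.Sublist.append_left
          ((List.sublist_cons_self _ _).trans (List.sublist_cons_self _ _)) _)
      · rw [disjoint_union_left, hIoc, disjoint_insert_left]
        exact ⟨hU.mono_right subset_union_left, hcorner, hdis⟩
      · rw [eq_univ_iff_forall] at hcov ⊢
        intro s
        rcases hcov s with h | h | h
        · exact Or.inl (Or.inl h)
        · exact Or.inr h
        · rw [K.path_mem_Icc, ← K.path_one] at h
          rcases h with h | h
          · refine Or.inr ?_
            rw [h, ← K.path_zero, ← hpd, ← hpim]
            exact ⟨1, by simp, rfl⟩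
          · exact Or.inl (Or.inr (hIoc ▸ h))

/-- A glued space whose merged boundary word folds up is a sphere. -/
theorem isTwoSphere [T2Space X] (K : GluedSpace P X) (hX : HasConnectedPuncturedNhds X) {f₀ : F}
    {R : Set Δ} (h : P.Merged f₀ univ w R) (hw : P.Folds w) : IsTwoSphere X := by
  obtain ⟨hlen, hpt, hD⟩ := diskAlong_of_merged (K := K) h
  obtain ⟨x, hx⟩ := h.exists_isWalk
  have hR : ∀ d, d ∈ w ∨ d ∈ R := fun d ↦ by
    by_cases hd : d ∈ R
    · exact Or.inr hd
    · exact Or.inl (h.mem_iff.2 ⟨trivial, hd⟩)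
  refine isTwoSphere_of_folds hX hw ?_ h.nodup hx hD ?_ ?_
  · rintro rfl
    simp at hlen
  · simp only [disjoint_union_left, disjoint_iUnion_left]
    refine ⟨fun f _ ↦ disjoint_cell_carrier, fun d hd ↦ disjoint_path_carrier ?_ ?_⟩
    · exact fun h' ↦ (h.mem_iff.1 h').2 hd
    · exact fun h' ↦ (h.mem_iff.1 h').2 (h.opp_mem hd)
  · rw [eq_univ_iff_forall]
    intro s
    have hs : s ∈ (⋃ f, K.cell f) ∪ (⋃ d, K.path d '' Icc 0 1) := K.cover ▸ mem_univ s
    rcases hs with hs | hs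
    · exact Or.inl (Or.inl (by simpa using hs))
    · rw [mem_iUnion] at hs
      obtain ⟨d, hd⟩ := hs
      rcases hR d with hdw | hdR
      · exact Or.inr (mem_iUnion₂.2 ⟨d, hdw, hd⟩)
      · rw [K.path_mem_Icc] at hd
        rcases hd with hd | hd | hd
        · exact Or.inr (hd ▸ hpt d hdR)
        · refine Or.inr (hd ▸ ?_)
          rw [← P.src_opp]
          exact hpt _ (h.opp_mem hdR)
        · exact Or.inl (Or.inr (mem_iUnion₂.2 ⟨d, hdR, hd⟩))

end GluedSpace

/-! ### Lifting maps to the circle -/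

/-- A map from a convex set to the circle lifts to the line. -/
theorem exists_lift_of_convex {E : Type*} [NormedAddCommGroup E] [NormedSpace ℝ E] {C : Set E}
    (hC : Convex ℝ C) {p : ℝ} [Fact (0 < p)] {ψ : E → AddCircle p} (hψ : ContinuousOn ψ C) :
    ∃ θ : E → ℝ, ContinuousOn θ C ∧ ∀ x ∈ C, (θ x : AddCircle p) = ψ x := by
  classical
  rcases C.eq_empty_or_nonempty with rfl | ⟨x₀, hx₀⟩
  · exact ⟨fun _ ↦ 0, continuousOn_empty _, fun x hx ↦ hx.elim⟩
  have cov := AddCircle.isCoveringMap_coe p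
  have hmem : ∀ y : unitInterval × C, x₀ + (y.1 : ℝ) • ((y.2 : E) - x₀) ∈ C := fun y ↦
    hC.add_smul_sub_mem hx₀ y.2.2 y.1.2
  let H : C(unitInterval × C, AddCircle p) :=
    ⟨fun y ↦ ψ (x₀ + (y.1 : ℝ) • ((y.2 : E) - x₀)), hψ.comp_continuous (by fun_prop) hmem⟩
  obtain ⟨t₀, ht₀⟩ := QuotientAddGroup.mk_surjective (ψ x₀)
  have H0 : ∀ a, H (0, a) = ((ContinuousMap.const C t₀ a : ℝ) : AddCircle p) := fun a ↦ by
    simp only [H, ContinuousMap.coe_mk, ContinuousMap.const_apply]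
    simp only [Set.Icc.coe_zero, zero_smul, add_zero]
    exact ht₀.symm
  let L := cov.liftHomotopy H (ContinuousMap.const C t₀) H0
  have hL : ∀ y, ((L y : ℝ) : AddCircle p) = H y := fun y ↦
    congrFun (cov.liftHomotopy_lifts H (ContinuousMap.const C t₀) H0) y
  refine ⟨fun x ↦ if hx : x ∈ C then L (1, ⟨x, hx⟩) else 0, ?_, fun x hx ↦ ?_⟩
  · rw [continuousOn_iff_continuous_domRestrict]
    have : C.domRestrict (fun x ↦ if hx : x ∈ C then L (1, ⟨x, hx⟩) else 0) = fun x : C ↦ L (1, x) := by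
      funext x
      simp
    rw [this]
    fun_prop
  · simp only [dif_pos hx, hL]
    simp [H]

/-! ### Local structure of surfaces -/

/-- The Euclidean plane. -/
abbrev Plane := EuclideanSpace ℝ (Fin 2)

theorem one_lt_rank_plane : 1 < Module.rank ℝ Plane := by
  rw [← Module.finrank_eq_rank, finrank_euclideanSpace_fin]
  norm_num

theorem isPreconnected_ball_diff_singleton (a : Plane) (r : ℝ) :
    IsPreconnected (ball a r \ {a}) := by
  have himg : ball a r \ {a} =
      (fun x : Plane × ℝ ↦ a + x.2 • x.1) '' (sphere 0 1 ×ˢ Ioo 0 r) := by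
    ext y
    constructor
    · rintro ⟨hy, hya⟩
      have hne : y - a ≠ 0 := sub_ne_zero.2 hya
      have hn : 0 < ‖y - a‖ := norm_pos_iff.2 hne
      refine ⟨(‖y - a‖⁻¹ • (y - a), ‖y - a‖), ⟨?_, hn, by rwa [← dist_eq_norm]⟩, ?_⟩
      · rw [mem_sphere_zero_iff_norm]
        exact norm_smul_inv_norm hne
      · simp [smul_smul, mul_inv_cancel₀ hn.ne']
    · rintro ⟨⟨u, s⟩, ⟨hu, hs⟩, rfl⟩
      rw [mem_sphere_zero_iff_norm] at hu
      have : ‖s • u‖ = s := by rw [norm_smul, hu, mul_one, Real.norm_of_nonneg hs.1.le]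
      refine ⟨?_, ?_⟩
      · rw [mem_ball, dist_eq_norm, add_sub_cancel_left, this]
        exact hs.2
      · intro h
        have h' : s • u = 0 := by simpa using h
        rw [h', norm_zero] at this
        exact hs.1.ne this
  rw [himg]
  exact ((isPreconnected_sphere one_lt_rank_plane 0 1).prod isPreconnected_Ioo).image _
    (by fun_prop)

section surface

variable {S : Type*} [TopologicalSpace S] [ChartedSpace Plane S]

theorem exists_ball_chart (x : S) {N : Set S} (hN : N ∈ 𝓝 x) : ∃ r > 0,
    ball (chartAt Plane x x) r ⊆ (chartAt Plane x).target ∩ (chartAt Plane x).symm ⁻¹' N := by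
  refine Metric.mem_nhds_iff.1 (Filter.inter_mem ?_ ?_)
  · exact (chartAt Plane x).open_target.mem_nhds ((chartAt Plane x).map_source (mem_chart_source _ x))
  · refine ((chartAt Plane x).continuousAt_symm
      ((chartAt Plane x).map_source (mem_chart_source _ x))).preimage_mem_nhds ?_
    rwa [(chartAt Plane x).left_inv (mem_chart_source _ x)]

variable (S) in
theorem hasConnectedPuncturedNhds_of_chartedSpace : HasConnectedPuncturedNhds S := by
  intro x N hN
  obtain ⟨r, hr, hsub⟩ := exists_ball_chart x hN
  let φ := chartAt Plane x
  have hx : x ∈ φ.source := mem_chart_source _ x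
  have hbt : ball (φ x) r ⊆ φ.target := fun y hy ↦ (hsub hy).1
  refine ⟨φ.symm '' ball (φ x) r, ?_, ?_, ?_⟩
  · exact (φ.symm.isOpen_image_of_subset_source isOpen_ball hbt).mem_nhds
      ⟨φ x, mem_ball_self hr, φ.left_inv hx⟩
  · rintro _ ⟨y, hy, rfl⟩
    exact (hsub hy).2
  · have h : φ.symm '' ball (φ x) r \ {x} = φ.symm '' (ball (φ x) r \ {φ x}) := by
      have : φ.symm '' {φ x} = {x} := by rw [image_singleton, φ.left_inv hx]
      conv_lhs => rw [← this]
      refine (InjOn.image_sdiff_subset (φ.symm.injOn.mono hbt) ?_).symm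
      exact singleton_subset_iff.2 (mem_ball_self hr)
    rw [h]
    exact (isPreconnected_ball_diff_singleton _ _).image _
      (φ.continuousOn_symm.mono fun y hy ↦ hbt hy.1)

/-- Around every point of a surface there are a continuous angular coordinate and arbitrarily small
loops on which this coordinate runs once through all angles. -/
theorem exists_angle (x : S) : ∃ W ∈ 𝓝 x, ∃ ψ : S → Real.Angle, ContinuousOn ψ (W \ {x}) ∧
    ∀ N ∈ 𝓝 x, ∃ κ : ℝ → S, Continuous κ ∧ (∀ t, κ t ∈ N \ {x}) ∧
      κ (2 * Real.pi) = κ 0 ∧ ∀ t, ψ (κ t) = t := by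
  let φ := chartAt Plane x
  have hx : x ∈ φ.source := mem_chart_source _ x
  let ζ : Plane → ℂ := fun y ↦ ((y 0 : ℝ) : ℂ) + ((y 1 : ℝ) : ℂ) * Complex.I
  have hζc : Continuous ζ := by fun_prop
  have hζ0 : ∀ y, ζ y = 0 → y = 0 := by
    intro y hy
    have h0 : y 0 = 0 := by simpa [ζ] using congrArg Complex.re hy
    have h1 : y 1 = 0 := by simpa [ζ] using congrArg Complex.im hy
    ext i
    fin_cases i
    · exact h0
    · exact h1
  refine ⟨φ.source, φ.open_source.mem_nhds hx,
    fun y ↦ ((ζ (φ y - φ x)).arg : Real.Angle), ?_, fun N hN ↦ ?_⟩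
  · intro y hy
    have hne : ζ (φ y - φ x) ≠ 0 := fun h ↦ hy.2
      (φ.injOn hy.1 hx (sub_eq_zero.1 (hζ0 _ h)))
    have h1 : ContinuousWithinAt (fun y ↦ ζ (φ y - φ x)) (φ.source \ {x}) y :=
      (hζc.continuousAt.comp_continuousWithinAt
        (((φ.continuousOn y hy.1).mono sdiff_subset).sub continuousWithinAt_const))
    exact ContinuousAt.comp_continuousWithinAt (f := fun y ↦ ζ (φ y - φ x))
      (g := ((↑) ∘ Complex.arg : ℂ → Real.Angle)) (Complex.continuousAt_arg_coe_angle hne) h1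
  · obtain ⟨r, hr, hsub⟩ := exists_ball_chart x hN
    let u : ℝ → Plane := fun t ↦ (r / 2) • !₂[Real.cos t, Real.sin t]
    have hu : ∀ t, ‖u t‖ = r / 2 := by
      intro t
      have h : ‖(!₂[Real.cos t, Real.sin t] : Plane)‖ = 1 := by
        rw [← pow_eq_one_iff_of_nonneg (norm_nonneg _) two_ne_zero, EuclideanSpace.real_norm_sq_eq,
          Fin.sum_univ_two]
        simp
      simp only [u]
      rw [norm_smul, h, mul_one, Real.norm_of_nonneg (by positivity)]
    have huc : Continuous u := by
      have h : Continuous fun t ↦ (!₂[Real.cos t, Real.sin t] : Plane) := by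
        refine (PiLp.continuous_toLp 2 _).comp (continuous_pi fun i ↦ ?_)
        fin_cases i
        · exact Real.continuous_cos
        · exact Real.continuous_sin
      exact h.const_smul (r / 2)
    have hball : ∀ t, φ x + u t ∈ ball (φ x) r := fun t ↦ by
      rw [mem_ball, dist_eq_norm, add_sub_cancel_left, hu]
      linarith
    have hφ : ∀ t, φ (φ.symm (φ x + u t)) = φ x + u t := fun t ↦ φ.right_inv (hsub (hball t)).1
    refine ⟨fun t ↦ φ.symm (φ x + u t), ?_, fun t ↦ ⟨(hsub (hball t)).2, fun h ↦ ?_⟩, ?_, fun t ↦ ?_⟩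
    · exact φ.continuousOn_symm.comp_continuous (by fun_prop) fun t ↦ (hsub (hball t)).1
    · have h1 := hφ t
      have h' : φ.symm (φ x + u t) = x := h
      rw [h'] at h1
      have h2 : u t = 0 := by simpa using h1.symm
      have h3 := hu t
      rw [h2, norm_zero] at h3
      linarith
    · simp [u]
    · have h1 : ζ (φ (φ.symm (φ x + u t)) - φ x) =
          ((r / 2 : ℝ) : ℂ) * ((Real.Angle.cos t : ℝ) + (Real.Angle.sin t : ℝ) * Complex.I) := by
        rw [hφ, add_sub_cancel_left]
        simp [ζ, u]
        ring
      simp only [h1]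
      exact Complex.arg_mul_cos_add_sin_mul_I_coe_angle (by positivity) t

end surface

/-- A loop on which an angular coordinate runs once through all angles does not factor through
a convex set. -/
theorem not_exists_convex_factor {S : Type*} [TopologicalSpace S] {E : Type*}
    [NormedAddCommGroup E] [NormedSpace ℝ E] {W : Set S}
    {ψ : S → Real.Angle} (hψ : ContinuousOn ψ W) {κ : ℝ → S} (hκ : Continuous κ)
    (hper : κ (2 * Real.pi) = κ 0) (hκψ : ∀ t, ψ (κ t) = t) {C : Set E} (hC : Convex ℝ C)
    {j : E → S} (hj : ContinuousOn j C) (hjW : MapsTo j C W) {k : S → E}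
    (hk : ContinuousOn k (range κ)) (hkC : ∀ t, k (κ t) ∈ C) (hjk : ∀ t, j (k (κ t)) = κ t) :
    False := by
  have : Fact (0 < 2 * Real.pi) := ⟨Real.two_pi_pos⟩
  obtain ⟨θ, hθ, hθψ⟩ := exists_lift_of_convex (p := 2 * Real.pi) (ψ := ψ ∘ j) hC (hψ.comp hj hjW)
  let δ : ℝ → ℝ := fun t ↦ (θ (k (κ t)) - t) / (2 * Real.pi)
  have hδc : Continuous δ := by
    have h1 : Continuous fun t ↦ k (κ t) := hk.comp_continuous hκ fun t ↦ ⟨t, rfl⟩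
    have h2 : Continuous fun t ↦ θ (k (κ t)) := hθ.comp_continuous h1 hkC
    exact (h2.sub continuous_id).div_const _
  have hδ : ∀ t, ∃ n : ℤ, δ t = n := fun t ↦ by
    have h1 : ((θ (k (κ t)) : ℝ) : Real.Angle) = (t : Real.Angle) := by
      rw [← hκψ t]
      conv_rhs => rw [← hjk t]
      exact hθψ _ (hkC t)
    obtain ⟨n, hn⟩ := Real.Angle.angle_eq_iff_two_pi_dvd_sub.1 h1
    refine ⟨n, ?_⟩
    simp only [δ, hn]
    field_simp
  have hconst : δ (2 * Real.pi) = δ 0 := by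
    choose n hn using hδ
    have hnc : Continuous n := by
      refine Int.isClosedEmbedding_coe_real.isInducing.continuous_iff.2 ?_
      exact hδc.congr hn
    rw [hn, hn, PreconnectedSpace.constant inferInstance hnc]
  simp only [δ, hper] at hconst
  have hpi := Real.two_pi_pos
  rw [div_left_inj' hpi.ne'] at hconst
  linarith

/-! ### Cells and polygon charts -/

section cells

variable {S : Type*} [TopologicalSpace S] [CWComplex (univ : Set S)]

/-- The point of `S` which is the vertex `v`. -/
def vertexPt (v : Vertex S) : S := RelCWComplex.map 0 v ![]

theorem openCell_vertex (v : Vertex S) : RelCWComplex.openCell 0 v = {vertexPt v} :=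
  RelCWComplex.openCell_zero_eq_singleton

theorem vertexPt_injective : Function.Injective (vertexPt : Vertex S → S) :=
  RelCWComplex.injective_map_zero _

theorem disjoint_edge_edge {e e' : Edge S} (h : e ≠ e') :
    Disjoint (RelCWComplex.openCell 1 e) (RelCWComplex.openCell 1 e') :=
  RelCWComplex.disjoint_openCell_of_ne (by simpa using h)

theorem disjoint_face_face {f f' : Face S} (h : f ≠ f') :
    Disjoint (RelCWComplex.openCell 2 f) (RelCWComplex.openCell 2 f') :=
  RelCWComplex.disjoint_openCell_of_ne (by simpa using h)

theorem disjoint_face_edge (f : Face S) (e : Edge S) :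
    Disjoint (RelCWComplex.openCell 2 f) (RelCWComplex.openCell 1 e) :=
  RelCWComplex.disjoint_openCell_of_ne fun h ↦ by simpa using congrArg Sigma.fst h

theorem vertexPt_notMem_edge (v : Vertex S) (e : Edge S) :
    vertexPt v ∉ RelCWComplex.openCell 1 e := fun h ↦ by
  have h1 : Disjoint (RelCWComplex.openCell 0 v) (RelCWComplex.openCell 1 e) :=
    RelCWComplex.disjoint_openCell_of_ne fun h ↦ by simpa using congrArg Sigma.fst h
  rw [openCell_vertex] at h1
  exact h1.le_bot ⟨rfl, h⟩

theorem vertexPt_notMem_face (v : Vertex S) (f : Face S) :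
    vertexPt v ∉ RelCWComplex.openCell 2 f := fun h ↦ by
  have h1 : Disjoint (RelCWComplex.openCell 0 v) (RelCWComplex.openCell 2 f) :=
    RelCWComplex.disjoint_openCell_of_ne fun h ↦ by simpa using congrArg Sigma.fst h
  rw [openCell_vertex] at h1
  exact h1.le_bot ⟨rfl, h⟩

theorem IsPolygonalSubdivision.exists_cell (hP : IsPolygonalSubdivision S) (x : S) :
    (∃ v : Vertex S, x = vertexPt v) ∨ (∃ e : Edge S, x ∈ RelCWComplex.openCell 1 e) ∨
      ∃ f : Face S, x ∈ RelCWComplex.openCell 2 f := by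
  have hx : x ∈ ⋃ (n : ℕ) (j : RelCWComplex.cell (univ : Set S) n), RelCWComplex.openCell n j := by
    rw [CWComplex.iUnion_openCell_eq_complex]
    trivial
  simp only [mem_iUnion] at hx
  obtain ⟨n, j, hj⟩ := hx
  match n, j, hj with
  | 0, j, hj =>
    rw [openCell_vertex] at hj
    exact Or.inl ⟨j, hj⟩
  | 1, j, hj => exact Or.inr (Or.inl ⟨j, hj⟩)
  | 2, j, hj => exact Or.inr (Or.inr ⟨j, hj⟩)
  | n + 3, j, hj => exact ((hP.dim_le_two (n + 3) (by omega)).false j).elim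

theorem finite_cell (hP : IsPolygonalSubdivision S) (k : ℕ) :
    Finite (RelCWComplex.cell (univ : Set S) k) := by
  have := hP.finite
  exact Finite.of_injective (fun j ↦ (⟨k, j⟩ : Σ k, RelCWComplex.cell (univ : Set S) k))
    sigma_mk_injective

theorem closedCell_edge_subset (e : Edge S) :
    RelCWComplex.closedCell 1 e ⊆ RelCWComplex.openCell 1 e ∪ range vertexPt := by
  rw [← RelCWComplex.cellFrontier_union_openCell_eq_closedCell]
  obtain ⟨x, y, h⟩ := CWComplex.exists_cellFrontier_one_eq e
  rw [h, RelCWComplex.closedCell_zero_eq_singleton, RelCWComplex.closedCell_zero_eq_singleton]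
  rintro z ((rfl | rfl) | h)
  · exact Or.inr ⟨x, rfl⟩
  · exact Or.inr ⟨y, rfl⟩
  · exact Or.inl h

end cells

theorem turnPoint_injOn_Icc {a b : ℝ} (h : b - a < 1) : InjOn turnPoint (Icc a b) := by
  have key : ∀ s t : ℝ, s ≤ t → t - s < 1 → turnPoint s = turnPoint t → s = t := by
    intro s t hst hlt he
    have h1 : turnPoint (t - s) * turnPoint s = turnPoint s := by
      rw [← turnPoint_add, sub_add_cancel, he]
    have h2 : turnPoint s ≠ 0 := fun h0 ↦ by simpa [h0] using norm_turnPoint s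
    have h3 : turnPoint (t - s) = turnPoint 0 := by
      rw [turnPoint_zero]
      exact mul_right_cancel₀ h2 (by rw [h1, one_mul])
    have := turnPoint_injOn ⟨sub_nonneg.2 hst, hlt⟩ ⟨le_rfl, one_pos⟩ h3
    linarith
  intro s hs t ht he
  rcases le_total s t with hst | hst
  · exact key s t hst (by linarith [hs.1, ht.2]) he
  · exact (key t s hst (by linarith [hs.2, ht.1]) he.symm).symm

theorem circlePoint_eq (m : ℕ) (t : ℝ) : circlePoint m t = turnPoint (t / m) := by
  rw [circlePoint, turnPoint]
  congr 3
  rw [mul_div_assoc]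

theorem val_finRotate {m : ℕ} (i : Fin m) :
    (finRotate m i : ℕ) = if (i : ℕ) + 1 = m then 0 else (i : ℕ) + 1 := by
  cases m with
  | zero => exact i.elim0
  | succ n =>
    rw [finRotate_apply, Fin.val_add_one]
    simp only [Fin.ext_iff, Fin.val_last, Nat.add_right_cancel_iff]

theorem finRotate_ne {m : ℕ} (hm : 2 ≤ m) (i : Fin m) : finRotate m i ≠ i := by
  intro h
  have := congrArg Fin.val h
  rw [val_finRotate] at this
  split_ifs at this <;> omega

namespace PolygonChart

variable {S : Type*} [TopologicalSpace S] [CWComplex (univ : Set S)] {f : Face S}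
  (ch : PolygonChart f)

theorem m_pos : (0 : ℝ) < ch.m := by
  have := ch.two_le
  exact_mod_cast (by omega : 0 < ch.m)

/-- The side `i` of the polygon as a path, from `vertex i` to `vertex (i + 1)`. -/
noncomputable def sidePath (i : Fin ch.m) (t : ℝ) : S := ch.toFun (turnPoint (((i : ℕ) + t) / ch.m))

theorem turnPoint_mem (s : ℝ) : turnPoint s ∈ closedBall (0 : ℂ) 1 := by simp

theorem continuous_toFun_turnPoint : Continuous fun s ↦ ch.toFun (turnPoint s) :=
  ch.continuousOn.comp_continuous continuous_turnPoint turnPoint_mem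

theorem continuous_sidePath (i : Fin ch.m) : Continuous (ch.sidePath i) :=
  ch.continuous_toFun_turnPoint.comp (by fun_prop)

theorem toFun_turnPoint_inj {s t : ℝ} (hs : s ∈ Ico (0 : ℝ) 1) (ht : t ∈ Ico (0 : ℝ) 1)
    (h : ch.toFun (turnPoint s) = ch.toFun (turnPoint t)) : s = t :=
  turnPoint_injOn hs ht (ch.injOn (turnPoint_mem s) (turnPoint_mem t) h)

theorem div_m_mem {i : Fin ch.m} {t : ℝ} (ht : t ∈ Ico (0 : ℝ) 1) :
    ((i : ℕ) + t) / (ch.m : ℝ) ∈ Ico (0 : ℝ) 1 := by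
  have h0 := ht.1
  refine ⟨by positivity, ?_⟩
  rw [div_lt_one ch.m_pos]
  have : ((i : ℕ) : ℝ) + 1 ≤ ch.m := by exact_mod_cast i.2
  linarith [ht.2]

/-- The positions on the boundary of a polygon are determined by the side and the parameter. -/
theorem sidePath_inj {i j : Fin ch.m} {s t : ℝ} (hs : s ∈ Ico (0 : ℝ) 1) (ht : t ∈ Ico (0 : ℝ) 1)
    (h : ch.sidePath i s = ch.sidePath j t) : i = j ∧ s = t := by
  have h1 := ch.toFun_turnPoint_inj (ch.div_m_mem hs) (ch.div_m_mem ht) h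
  rw [div_left_inj' ch.m_pos.ne'] at h1
  have h2 : (i : ℕ) = j := by
    have h3 : ((i : ℕ) : ℝ) < (j : ℕ) + 1 := by linarith [hs.1, ht.2]
    have h4 : ((j : ℕ) : ℝ) < (i : ℕ) + 1 := by linarith [hs.2, ht.1]
    have h5 : (i : ℕ) < j + 1 := by exact_mod_cast h3
    have h6 : (j : ℕ) < i + 1 := by exact_mod_cast h4
    omega
  refine ⟨Fin.ext h2, ?_⟩
  rw [h2] at h1
  linarith

theorem injOn_sidePath (i : Fin ch.m) : InjOn (ch.sidePath i) (Icc 0 1) := by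
  intro s hs t ht h
  have hm : (2 : ℝ) ≤ ch.m := by exact_mod_cast ch.two_le
  have h1 := ch.injOn (turnPoint_mem _) (turnPoint_mem _) h
  have h2 : ∀ t ∈ Icc (0 : ℝ) 1,
      ((i : ℕ) + t) / (ch.m : ℝ) ∈ Icc ((i : ℕ) / (ch.m : ℝ)) (((i : ℕ) + 1) / ch.m) :=
    fun t ht ↦ ⟨by gcongr; linarith [ht.1], by gcongr; exact ht.2⟩
  have h3 := turnPoint_injOn_Icc (a := (i : ℕ) / (ch.m : ℝ)) (b := ((i : ℕ) + 1) / ch.m) (by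
    rw [← sub_div, div_lt_one ch.m_pos]
    linarith) (h2 s hs) (h2 t ht) h1
  rw [div_left_inj' ch.m_pos.ne'] at h3
  linarith

theorem sidePath_zero (i : Fin ch.m) : ch.sidePath i 0 = vertexPt (ch.vertex i) := by
  have h := ch.map_vertex i
  rw [openCell_vertex, circlePoint_eq] at h
  rw [sidePath, add_zero]
  exact h

theorem sidePath_one (i : Fin ch.m) :
    ch.sidePath i 1 = vertexPt (ch.vertex (finRotate _ i)) := by
  rw [← sidePath_zero, sidePath, sidePath, val_finRotate]
  split_ifs with h
  · have : ((i : ℕ) : ℝ) + 1 = ch.m := by exact_mod_cast h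
    rw [this, div_self ch.m_pos.ne', turnPoint_one]
    simp
  · push_cast
    rw [add_zero]

theorem image_sidePath (i : Fin ch.m) :
    ch.sidePath i '' Ioo 0 1 = RelCWComplex.openCell 1 (ch.side i) := by
  rw [← ch.map_side i, ← image_comp]
  ext x
  constructor
  · rintro ⟨t, ht, rfl⟩
    exact ⟨(i : ℕ) + t, ⟨by linarith [ht.1], by linarith [ht.2]⟩, by
      rw [Function.comp_apply, circlePoint_eq]; rfl⟩
  · rintro ⟨t, ht, rfl⟩
    refine ⟨t - (i : ℕ), ⟨by linarith [ht.1], by linarith [ht.2]⟩, ?_⟩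
    rw [Function.comp_apply, circlePoint_eq, sidePath, add_sub_cancel]

theorem vertex_injective : Function.Injective ch.vertex := by
  intro i j h
  exact (ch.sidePath_inj (s := 0) (t := 0) (by simp) (by simp)
    (by rw [sidePath_zero, sidePath_zero, h])).1

theorem side_injective : Function.Injective ch.side := by
  intro i j h
  have h1 : ch.sidePath i (1 / 2) ∈ RelCWComplex.openCell 1 (ch.side j) := by
    rw [← h, ← image_sidePath]
    exact ⟨1 / 2, by norm_num, rfl⟩
  rw [← image_sidePath] at h1
  obtain ⟨t, ht, h2⟩ := h1
  exact (ch.sidePath_inj (by norm_num) ⟨ht.1.le, ht.2⟩ h2.symm).1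

theorem vertex_finRotate_ne (i : Fin ch.m) : ch.vertex (finRotate _ i) ≠ ch.vertex i :=
  fun h ↦ finRotate_ne ch.two_le i (ch.vertex_injective h)

theorem exists_sidePath_eq {z : ℂ} (hz : ‖z‖ = 1) :
    ∃ i, ∃ t ∈ Ico (0 : ℝ) 1, ch.toFun z = ch.sidePath i t := by
  obtain ⟨s, hs, rfl⟩ := exists_turnPoint_eq hz
  have hms : 0 ≤ ch.m * s := mul_nonneg ch.m_pos.le hs.1
  have h1 : ⌊(ch.m : ℝ) * s⌋₊ < ch.m := by
    rw [Nat.floor_lt hms]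
    nlinarith [ch.m_pos, hs.2]
  refine ⟨⟨_, h1⟩, ch.m * s - ⌊(ch.m : ℝ) * s⌋₊, ⟨?_, ?_⟩, ?_⟩
  · linarith [Nat.floor_le hms]
  · linarith [Nat.lt_floor_add_one ((ch.m : ℝ) * s)]
  · rw [sidePath, add_sub_cancel, mul_div_cancel_left₀ _ ch.m_pos.ne']

variable [T2Space S]

theorem image_closedBall : ch.toFun '' closedBall 0 1 = RelCWComplex.closedCell 2 f := by
  rw [← RelCWComplex.closure_openCell_eq_closedCell, ← ch.image_ball]
  apply subset_antisymm
  · rw [← closure_ball (0 : ℂ) one_ne_zero]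
    refine ContinuousOn.image_closure ?_
    rw [closure_ball (0 : ℂ) one_ne_zero]
    exact ch.continuousOn
  · refine closure_minimal (image_mono ball_subset_closedBall) ?_
    exact ((isCompact_closedBall _ _).image_of_continuousOn ch.continuousOn).isClosed

theorem closedCell_side (i : Fin ch.m) :
    RelCWComplex.closedCell 1 (ch.side i) = ch.sidePath i '' Icc 0 1 := by
  rw [← RelCWComplex.closure_openCell_eq_closedCell, ← image_sidePath]
  apply subset_antisymm
  · exact closure_minimal (image_mono Ioo_subset_Icc_self)
      (isCompact_Icc.image (ch.continuous_sidePath i)).isClosed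
  · rw [← closure_Ioo (zero_ne_one' ℝ)]
    exact image_closure_subset_closure_image (ch.continuous_sidePath i)

theorem sidePath_mem (i : Fin ch.m) (t : ℝ) : ch.sidePath i t ∈ RelCWComplex.closedCell 2 f := by
  rw [← ch.image_closedBall]
  exact ⟨_, turnPoint_mem _, rfl⟩

/-- A closed polygon consists of its interior, its open sides and its vertices. -/
theorem mem_closedCell {x : S} (hx : x ∈ RelCWComplex.closedCell 2 f) :
    x ∈ RelCWComplex.openCell 2 f ∨ (∃ i, x ∈ RelCWComplex.openCell 1 (ch.side i)) ∨
      ∃ i, x = vertexPt (ch.vertex i) := by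
  rw [← ch.image_closedBall] at hx
  obtain ⟨z, hz, rfl⟩ := hx
  rcases (mem_closedBall_zero_iff.1 hz).lt_or_eq with h | h
  · rw [← ch.image_ball]
    exact Or.inl ⟨z, mem_ball_zero_iff.2 h, rfl⟩
  · obtain ⟨i, t, ht, h⟩ := ch.exists_sidePath_eq h
    right
    rcases ht.1.eq_or_lt with rfl | h0
    · exact Or.inr ⟨i, by rw [h, sidePath_zero]⟩
    · exact Or.inl ⟨i, by rw [h, ← image_sidePath]; exact ⟨t, ⟨h0, ht.2⟩, rfl⟩⟩

theorem vertices_eq : Face.vertices f = range ch.vertex := by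
  ext v
  simp only [Face.vertices, openCell_vertex, singleton_subset_iff, mem_ofPred_eq, mem_range]
  constructor
  · intro h
    rcases ch.mem_closedCell h with h | ⟨i, h⟩ | ⟨i, h⟩
    · exact (vertexPt_notMem_face _ _ h).elim
    · exact (vertexPt_notMem_edge _ _ h).elim
    · exact ⟨i, (vertexPt_injective h).symm⟩
  · rintro ⟨i, rfl⟩
    rw [← sidePath_zero]
    exact ch.sidePath_mem _ _

theorem side_of_mem {e : Edge S} {x : S} (hx : x ∈ RelCWComplex.closedCell 2 f)
    (he : x ∈ RelCWComplex.openCell 1 e) : ∃ i, ch.side i = e := by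
  rcases ch.mem_closedCell hx with h | ⟨i, h⟩ | ⟨i, rfl⟩
  · exact ((disjoint_face_edge f e).le_bot ⟨h, he⟩).elim
  · exact ⟨i, by_contra fun hne ↦ (disjoint_edge_edge hne).le_bot ⟨h, he⟩⟩
  · exact (vertexPt_notMem_edge _ _ he).elim

theorem edges_eq : Face.edges f = range ch.side := by
  ext e
  simp only [Face.edges, mem_ofPred_eq, mem_range]
  constructor
  · intro h
    obtain ⟨x, hx⟩ := RelCWComplex.openCell_nonempty 1 e
    exact ch.side_of_mem (h hx) hx
  · rintro ⟨i, rfl⟩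
    rw [← image_sidePath]
    rintro _ ⟨t, -, rfl⟩
    exact ch.sidePath_mem _ _

theorem edge_vertices_side (i : Fin ch.m) :
    Edge.vertices (ch.side i) = {ch.vertex i, ch.vertex (finRotate _ i)} := by
  ext v
  simp only [Edge.vertices, openCell_vertex, singleton_subset_iff, mem_ofPred_eq, closedCell_side,
    mem_insert_iff, mem_singleton_iff]
  constructor
  · rintro ⟨t, ht, h⟩
    rcases ht.1.eq_or_lt with rfl | h0
    · exact Or.inl (vertexPt_injective (by rw [← h, sidePath_zero]))
    rcases ht.2.eq_or_lt with rfl | h1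
    · exact Or.inr (vertexPt_injective (by rw [← h, sidePath_one]))
    · refine (vertexPt_notMem_edge v (ch.side i) ?_).elim
      rw [← h, ← image_sidePath]
      exact ⟨t, ⟨h0, h1⟩, rfl⟩
  · rintro (rfl | rfl)
    · exact ⟨0, by simp, ch.sidePath_zero i⟩
    · exact ⟨1, by simp, ch.sidePath_one i⟩

end PolygonChart

/-! ### Every edge lies in exactly two faces -/

/-- A point of a surface has no neighbourhood which embeds into a set `Q` in a normed space such
that connected subsets of the punctured balls in `Q` are contained in convex ones. -/
theorem not_exists_convex_chart {S : Type*} [TopologicalSpace S] [ChartedSpace Plane S]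
    {E : Type*} [NormedAddCommGroup E] [NormedSpace ℝ E] {x : S} {U : Set S} (hU : U ∈ 𝓝 x)
    {k : S → E} (hk : ContinuousOn k U) {j : E → S} {Q : Set E} (hj : ContinuousOn j Q)
    (hkQ : MapsTo k U Q) (hjk : ∀ y ∈ U, j (k y) = y) (hx : ∀ z ∈ Q, j z = x → z = k x)
    (H : ∀ r > 0, ∀ T ⊆ (Q ∩ ball (k x) r) \ {k x}, IsPreconnected T →
      ∃ C, Convex ℝ C ∧ T ⊆ C ∧ C ⊆ (Q ∩ ball (k x) r) \ {k x}) : False := by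
  have hxU : x ∈ U := mem_of_mem_nhds hU
  obtain ⟨W, hW, ψ, hψ, hloop⟩ := exists_angle x
  obtain ⟨r, hr, hrW⟩ : ∃ r > 0, ball (k x) r ∩ Q ⊆ j ⁻¹' W := by
    refine Metric.mem_nhdsWithin_iff.1 (hj (k x) (hkQ hxU) ?_)
    rwa [hjk x hxU]
  have hN : U ∩ k ⁻¹' ball (k x) r ∈ 𝓝 x := Filter.inter_mem hU
    ((hk.continuousAt hU).preimage_mem_nhds (ball_mem_nhds _ hr))
  obtain ⟨κ, hκ, hκN, hper, hκψ⟩ := hloop _ hN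
  have hkr : ContinuousOn k (range κ) := hk.mono (range_subset_iff.2 fun t ↦ (hκN t).1.1)
  have hkκ : Continuous fun t ↦ k (κ t) := hkr.comp_continuous hκ fun t ↦ ⟨t, rfl⟩
  obtain ⟨C, hC, hTC, hCQ⟩ := H r hr (range fun t ↦ k (κ t)) (by
    rintro _ ⟨t, rfl⟩
    refine ⟨⟨hkQ (hκN t).1.1, (hκN t).1.2⟩, fun h ↦ (hκN t).2 ?_⟩
    have h' : k (κ t) = k x := h
    rw [mem_singleton_iff, ← hjk _ (hκN t).1.1, h', hjk x hxU]) (isPreconnected_range hkκ)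
  refine not_exists_convex_factor hψ hκ hper hκψ hC (hj.mono fun z hz ↦ (hCQ hz).1.1) ?_ hkr
    (fun t ↦ hTC ⟨t, rfl⟩) (fun t ↦ hjk _ (hκN t).1.1)
  exact fun z hz ↦ ⟨hrW ⟨(hCQ hz).1.2, (hCQ hz).1.1⟩, fun h ↦ (hCQ hz).2 (hx z (hCQ hz).1.1 h)⟩

section

variable {S : Type*} [TopologicalSpace S] [T2Space S] [CWComplex (univ : Set S)]

/-- The open edge `e` together with the open faces around it is open. -/
theorem isOpen_edge_union (hP : IsPolygonalSubdivision S)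
    (c : ∀ f : Face S, PolygonChart f) (e : Edge S) :
    IsOpen (RelCWComplex.openCell 1 e ∪
      ⋃ (f : Face S) (_ : ∃ i, (c f).side i = e), RelCWComplex.openCell 2 f) := by
  have := finite_cell hP 0
  have := finite_cell hP 1
  have := finite_cell hP 2
  have h : (RelCWComplex.openCell 1 e ∪
      ⋃ (f : Face S) (_ : ∃ i, (c f).side i = e), RelCWComplex.openCell 2 f)ᶜ =
      range (vertexPt : Vertex S → S) ∪
        ((⋃ e' : {e' : Edge S // e' ≠ e}, RelCWComplex.closedCell 1 e'.1) ∪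
        ⋃ f : {f : Face S // ¬ ∃ i, (c f).side i = e}, RelCWComplex.closedCell 2 f.1) := by
    ext x
    simp only [mem_compl_iff, mem_union, mem_iUnion, not_or, not_exists, Subtype.exists, mem_range]
    constructor
    · rintro ⟨h1, h2⟩
      rcases hP.exists_cell x with ⟨v, rfl⟩ | ⟨e', h⟩ | ⟨f, h⟩
      · exact Or.inl ⟨v, rfl⟩
      · exact Or.inr (Or.inl ⟨e', fun he ↦ h1 (he ▸ h),
          RelCWComplex.openCell_subset_closedCell _ _ h⟩)
      · exact Or.inr (Or.inr ⟨f, fun i hi ↦ h2 f ⟨i, hi⟩ h,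
          RelCWComplex.openCell_subset_closedCell _ _ h⟩)
    · rintro (⟨v, rfl⟩ | ⟨e', he', h⟩ | ⟨f, hf, h⟩)
      · exact ⟨vertexPt_notMem_edge _ _, fun f _ ↦ vertexPt_notMem_face _ _⟩
      · rcases closedCell_edge_subset _ h with h | ⟨v, rfl⟩
        · exact ⟨fun h1 ↦ (disjoint_edge_edge he').le_bot ⟨h, h1⟩,
            fun f _ hf ↦ (disjoint_face_edge f e').le_bot ⟨hf, h⟩⟩
        · exact ⟨vertexPt_notMem_edge _ _, fun f _ ↦ vertexPt_notMem_face _ _⟩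
      · rcases (c f).mem_closedCell h with h | ⟨i, h⟩ | ⟨i, rfl⟩
        · refine ⟨fun h1 ↦ (disjoint_face_edge f e).le_bot ⟨h, h1⟩, ?_⟩
          rintro g ⟨i, hi⟩ hg
          have : f ≠ g := by
            rintro rfl
            exact hf i hi
          exact (disjoint_face_face this).le_bot ⟨h, hg⟩
        · exact ⟨fun h1 ↦ (disjoint_edge_edge (hf i)).le_bot ⟨h, h1⟩,
            fun g _ hg ↦ (disjoint_face_edge g _).le_bot ⟨hg, h⟩⟩
        · exact ⟨vertexPt_notMem_edge _ _, fun f _ ↦ vertexPt_notMem_face _ _⟩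
  rw [← isClosed_compl_iff, h]
  refine (finite_range _).isClosed.union (IsClosed.union ?_ ?_)
  · exact isClosed_iUnion_of_finite fun _ ↦ RelCWComplex.isClosed_closedCell
  · exact isClosed_iUnion_of_finite fun _ ↦ RelCWComplex.isClosed_closedCell

variable [ChartedSpace Plane S]

/-- An edge which is not a side of any face would be open, and a surface has no open set homeomorphic
to an interval. -/
theorem exists_side_eq (hP : IsPolygonalSubdivision S) (c : ∀ f : Face S, PolygonChart f)
    (e : Edge S) : ∃ f i, (c f).side i = e := by
  by_contra! hno
  have hopen := isOpen_edge_union hP c e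
  have h0 : ⋃ (f : Face S) (_ : ∃ i, (c f).side i = e), RelCWComplex.openCell 2 f = ∅ := by
    simp only [iUnion_eq_empty]
    rintro f ⟨i, hi⟩
    exact (hno f i hi).elim
  rw [h0, union_empty] at hopen
  obtain ⟨x, hx⟩ := RelCWComplex.openCell_nonempty 1 e
  let φ := RelCWComplex.map (C := (univ : Set S)) 1 e
  have htar : φ.target = RelCWComplex.openCell 1 e := by
    rw [← φ.image_source_eq_target, RelCWComplex.source_eq]
    rfl
  have hsymm : ContinuousOn φ.symm (RelCWComplex.openCell 1 e) := by
    rw [← htar]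
    exact RelCWComplex.continuousOn_symm 1 e
  have hconst : ∀ v : Fin 1 → ℝ, (fun _ ↦ v 0) = v := fun v ↦ by
    ext i
    fin_cases i
    rfl
  have hball : ∀ z : ℝ, z ∈ ball (0 : ℝ) 1 → (fun _ : Fin 1 ↦ z) ∈ ball (0 : Fin 1 → ℝ) 1 := by
    intro z hz
    rw [mem_ball_zero_iff] at hz ⊢
    rwa [pi_norm_const]
  refine not_exists_convex_chart (x := x) (U := RelCWComplex.openCell 1 e) (hopen.mem_nhds hx)
    (k := fun y ↦ φ.symm y 0) (j := fun z ↦ φ fun _ ↦ z) (Q := ball (0 : ℝ) 1) ?_ ?_ ?_ ?_ ?_ ?_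
  · exact (continuous_apply 0).comp_continuousOn hsymm
  · refine (RelCWComplex.continuousOn 1 e).comp (by fun_prop) fun z hz ↦ ?_
    exact ball_subset_closedBall (hball z hz)
  · intro y hy
    have h1 : φ.symm y ∈ ball (0 : Fin 1 → ℝ) 1 := by
      rw [← RelCWComplex.source_eq (C := (univ : Set S)) 1 e]
      exact φ.map_target (htar.symm ▸ hy)
    rw [← hconst (φ.symm y), mem_ball_zero_iff, pi_norm_const] at h1
    exact mem_ball_zero_iff.2 h1
  · intro y hy
    simp only [hconst]
    exact φ.right_inv (htar.symm ▸ hy)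
  · rintro z hz rfl
    have h1 : (fun _ : Fin 1 ↦ z) ∈ φ.source := by
      rw [RelCWComplex.source_eq]
      exact hball z hz
    simp only [φ.left_inv h1]
  · exact fun r hr T hT hpre ↦ ⟨T, Real.convex_iff_isPreconnected.2 hpre, subset_rfl, hT⟩

/-- If an edge were a side of a single face, this open face together with the open edge would be
open. The chart of the face embeds it into the closed disk, where a point of the edge goes to an
extreme point, so that balls in the closed disk about it remain convex when it is removed. -/
theorem exists_other_face (hP : IsPolygonalSubdivision S) (c : ∀ f : Face S, PolygonChart f)
    (f : Face S) (i : Fin (c f).m) : ∃ g, g ≠ f ∧ ∃ j, (c g).side j = (c f).side i := by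
  by_contra! hno
  have hopen := isOpen_edge_union hP c ((c f).side i)
  have h0 : ⋃ (g : Face S) (_ : ∃ j, (c g).side j = (c f).side i), RelCWComplex.openCell 2 g =
      RelCWComplex.openCell 2 f := by
    apply subset_antisymm
    · refine iUnion₂_subset ?_
      rintro g ⟨j, hj⟩
      have : g = f := by_contra fun hne ↦ hno g hne j hj
      rw [this]
    · exact subset_iUnion₂_of_subset f ⟨i, rfl⟩ subset_rfl
  rw [h0] at hopen
  have hinv : LeftInvOn (Function.invFunOn (c f).toFun (closedBall 0 1)) (c f).toFun
      (closedBall 0 1) := (c f).injOn.leftInvOn_invFunOn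
  have hmem : (c f).sidePath i (1 / 2) ∈ RelCWComplex.openCell 1 ((c f).side i) := by
    rw [← PolygonChart.image_sidePath]
    exact ⟨1 / 2, by norm_num, rfl⟩
  have hsub : RelCWComplex.openCell 1 ((c f).side i) ∪ RelCWComplex.openCell 2 f ⊆
      (c f).toFun '' closedBall 0 1 := by
    rw [PolygonChart.image_closedBall]
    refine union_subset ?_ (RelCWComplex.openCell_subset_closedCell _ _)
    rw [← PolygonChart.image_sidePath]
    rintro _ ⟨t, -, rfl⟩
    exact (c f).sidePath_mem _ _
  have hkx : Function.invFunOn (c f).toFun (closedBall 0 1) ((c f).sidePath i (1 / 2)) =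
      turnPoint ((i + 1 / 2) / (c f).m) := hinv (PolygonChart.turnPoint_mem _)
  refine not_exists_convex_chart (x := (c f).sidePath i (1 / 2)) (hopen.mem_nhds (Or.inl hmem))
    (k := Function.invFunOn (c f).toFun (closedBall 0 1)) (j := (c f).toFun) (Q := closedBall 0 1)
    ?_ (c f).continuousOn ?_ ?_ ?_ ?_
  · refine (continuousOn_image_of_comp (isCompact_closedBall _ _) (c f).continuousOn ?_).mono hsub
    exact continuousOn_id.congr hinv
  · intro y hy
    exact Function.invFunOn_mem (hsub hy)
  · intro y hy
    exact Function.invFunOn_eq (hsub hy)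
  · rintro z hz h
    rw [← h]
    exact (hinv hz).symm
  · intro r hr T hT _
    refine ⟨_, ?_, hT, subset_rfl⟩
    rw [hkx]
    set p := turnPoint ((i + 1 / 2) / (c f).m)
    have hp : p ∈ extremePoints ℝ (closedBall (0 : ℂ) 1) := by
      rw [StrictConvexSpace.extremePoints_closedBall_eq_sphere]
      simp [p]
    refine (((convex_closedBall _ _).inter (convex_ball _ _)).mem_extremePoints_iff_convex_sdiff.1
      ?_).2
    exact inter_extremePoints_subset_extremePoints_of_subset inter_subset_left
      ⟨⟨hp.1, mem_ball_self hr⟩, hp⟩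

end

/-! ### The gluing pattern of a polygonal subdivision -/

/-- A coherent orientation of the faces of a polygonal subdivision. -/
structure OrientedSubdivision (S : Type*) [TopologicalSpace S] [CWComplex (univ : Set S)] where
  isPolygonal : IsPolygonalSubdivision S
  chart : ∀ f : Face S, PolygonChart f
  coherent : ∀ f g : Face S, f ≠ g → ∀ (i : Fin (chart f).m) (j : Fin (chart g).m),
    (chart f).side i = (chart g).side j →
      (chart f).vertex i = (chart g).vertex (finRotate _ j) ∧
      (chart f).vertex (finRotate _ i) = (chart g).vertex j

namespace OrientedSubdivision

section combinatorics

variable {S : Type*} [TopologicalSpace S] [CWComplex (univ : Set S)] (O : OrientedSubdivision S)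

/-- The darts: the sides of the faces. -/
abbrev Dart := Σ f : Face S, Fin (O.chart f).m

variable {O}

/-- The edge underlying a dart. -/
def edge (d : O.Dart) : Edge S := (O.chart d.1).side d.2

/-- The source of a dart, for the orientation of its face. -/
def src (d : O.Dart) : Vertex S := (O.chart d.1).vertex d.2

/-- The target of a dart, for the orientation of its face. -/
def tgt (d : O.Dart) : Vertex S := (O.chart d.1).vertex (finRotate _ d.2)

theorem src_ne_tgt (d : O.Dart) : src d ≠ tgt d := ((O.chart d.1).vertex_finRotate_ne d.2).symm

theorem eq_of_edge_eq {d e : O.Dart} (h : edge d = edge e) (h' : d.1 = e.1) : d = e := by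
  obtain ⟨f, i⟩ := d
  obtain ⟨g, j⟩ := e
  obtain rfl : f = g := h'
  have hij : i = j := (O.chart f).side_injective h
  rw [hij]

theorem src_eq_tgt {d e : O.Dart} (hne : d ≠ e) (h : edge d = edge e) : src d = tgt e :=
  (O.coherent d.1 e.1 (fun h' ↦ hne (eq_of_edge_eq h h')) d.2 e.2 h).1

/-- Coherence of the orientations implies that an edge lies in at most two faces. -/
theorem eq_or_eq {d e d' : O.Dart} (hne : d ≠ e) (h : edge d = edge e) (h' : edge d' = edge d) :
    d' = d ∨ d' = e := by
  by_contra! hd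
  exact src_ne_tgt d <| (src_eq_tgt hd.1.symm h'.symm).trans <|
    (src_eq_tgt hd.2.symm (h.symm.trans h'.symm)).symm.trans
      (src_eq_tgt hne.symm h.symm)

variable (O) in
/-- The side of number `k` modulo the number of sides. -/
def dart (f : Face S) (k : ℕ) : O.Dart :=
  ⟨f, ⟨k % (O.chart f).m, Nat.mod_lt _ (lt_of_lt_of_le two_pos (O.chart f).two_le)⟩⟩

theorem dart_of_lt {f : Face S} {k : ℕ} (hk : k < (O.chart f).m) : O.dart f k = ⟨f, ⟨k, hk⟩⟩ := by
  simp [dart, Nat.mod_eq_of_lt hk]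

theorem dart_m (f : Face S) : O.dart f (O.chart f).m = O.dart f 0 := by
  simp [dart]

theorem finRotate_dart (f : Face S) (k : ℕ) :
    finRotate (O.chart f).m (O.dart f k).2 = (O.dart f (k + 1)).2 := by
  have hpos := lt_of_lt_of_le two_pos (O.chart f).two_le
  have h : finRotate (O.chart f).m ⟨k % (O.chart f).m, Nat.mod_lt _ hpos⟩ =
      ⟨(k + 1) % (O.chart f).m, Nat.mod_lt _ hpos⟩ := by
    apply Fin.ext
    rw [val_finRotate]
    simp only
    have hm : 1 % (O.chart f).m = 1 := Nat.mod_eq_of_lt (O.chart f).two_le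
    have hlt := Nat.mod_lt k hpos
    rw [Nat.add_mod k 1, hm]
    split_ifs with h
    · rw [h, Nat.mod_self]
    · exact (Nat.mod_eq_of_lt (by omega)).symm
  exact h

theorem tgt_dart {f : Face S} {k : ℕ} : tgt (O.dart f k) = src (O.dart f (k + 1)) :=
  congrArg (O.chart f).vertex (finRotate_dart f k)

theorem isWalk_dart (f : Face S) (k : ℕ) :
    IsWalk src tgt (src (O.dart f 0)) ((List.range k).map (O.dart f)) (src (O.dart f k)) := by
  induction k with
  | zero => rfl
  | succ k ih =>
    rw [List.range_succ, List.map_append, isWalk_append]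
    exact ⟨_, ih, rfl, tgt_dart⟩

variable (O) in
/-- The darts of a face in cyclic order. -/
def boundary (f : Face S) : List O.Dart := (List.range (O.chart f).m).map (O.dart f)

theorem boundary_eq (f : Face S) :
    O.boundary f = (List.finRange (O.chart f).m).map fun i ↦ (⟨f, i⟩ : O.Dart) := by
  rw [boundary, ← List.map_coe_finRange_eq_range, List.map_map]
  refine List.map_congr_left fun i _ ↦ ?_
  exact dart_of_lt i.2

theorem mem_boundary (d : O.Dart) (f : Face S) : d ∈ O.boundary f ↔ d.1 = f := by
  rw [boundary_eq]
  constructor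
  · intro h
    obtain ⟨i, -, rfl⟩ := List.mem_map.1 h
    rfl
  · rintro rfl
    exact List.mem_map.2 ⟨d.2, List.mem_finRange _, rfl⟩

theorem nodup_boundary (f : Face S) : (O.boundary f).Nodup := by
  rw [boundary_eq]
  exact (List.nodup_finRange _).map (sigma_mk_injective (β := fun f ↦ Fin (O.chart f).m))

theorem sidePath_endpoints (d : O.Dart) : (O.chart d.1).sidePath d.2 0 = vertexPt (src d) ∧
    (O.chart d.1).sidePath d.2 1 = vertexPt (tgt d) :=
  ⟨(O.chart d.1).sidePath_zero d.2, (O.chart d.1).sidePath_one d.2⟩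

end combinatorics

section support

variable {S : Type*} [TopologicalSpace S] [T2Space S] [CWComplex (univ : Set S)]

/-- The union of the closed faces in a set of faces. -/
def support (M : Set (Face S)) : Set S := ⋃ f ∈ M, RelCWComplex.closedCell 2 f

theorem isClosed_support (O : OrientedSubdivision S) (M : Set (Face S)) :
    IsClosed (support M) := by
  have := finite_cell O.isPolygonal 2
  exact M.toFinite.isClosed_biUnion fun _ _ ↦ RelCWComplex.isClosed_closedCell

/-- A vertex of a face in `N` is an accumulation point of the open faces in `N`. -/
theorem not_disjoint_support {M N : Set (Face S)} {x : S} {U : Set S} (hU : U ∈ 𝓝 x)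
    (hx : x ∈ support N) (hv : x ∈ range (vertexPt : Vertex S → S))
    (h : U \ {x} ⊆ support M) : (U \ {x} ∩ (support M ∩ support N)).Nonempty := by
  simp only [support, mem_iUnion] at hx
  obtain ⟨f, hf, hxf⟩ := hx
  rw [← RelCWComplex.closure_openCell_eq_closedCell] at hxf
  obtain ⟨y, hyU, hy⟩ := mem_closure_iff_nhds.1 hxf U hU
  have hyx : y ∉ ({x} : Set S) := by
    rintro rfl
    obtain ⟨v, rfl⟩ := hv
    exact vertexPt_notMem_face _ _ hy
  exact ⟨y, ⟨hyU, hyx⟩, h ⟨hyU, hyx⟩,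
    mem_biUnion hf (RelCWComplex.openCell_subset_closedCell _ _ hy)⟩

end support

variable {S : Type*} [TopologicalSpace S] [T2Space S] [CWComplex (univ : Set S)]
  [ChartedSpace Plane S] {O : OrientedSubdivision S}

theorem exists_opp (d : O.Dart) : ∃ e : O.Dart, e ≠ d ∧ edge e = edge d := by
  obtain ⟨g, hg, j, h⟩ := exists_other_face O.isPolygonal O.chart d.1 d.2
  exact ⟨⟨g, j⟩, fun h ↦ hg (congrArg Sigma.fst h), h⟩

/-- The other dart on the same edge. -/
noncomputable def opp (d : O.Dart) : O.Dart := (exists_opp d).choose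

theorem opp_ne (d : O.Dart) : opp d ≠ d := (exists_opp d).choose_spec.1

theorem edge_opp (d : O.Dart) : edge (opp d) = edge d := (exists_opp d).choose_spec.2

theorem edge_eq_iff {d e : O.Dart} : edge e = edge d ↔ e = d ∨ e = opp d := by
  constructor
  · exact eq_or_eq (opp_ne d).symm (edge_opp d).symm
  · rintro (rfl | rfl)
    · rfl
    · exact edge_opp d

theorem opp_opp (d : O.Dart) : opp (opp d) = d :=
  (edge_eq_iff.1 ((edge_opp _).trans (edge_opp d))).resolve_right (opp_ne _)

theorem src_opp (d : O.Dart) : src (opp d) = tgt d := src_eq_tgt (opp_ne d) (edge_opp d)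

variable (O) in
/-- The gluing pattern of the faces. -/
noncomputable def gluing : PolygonGluing O.Dart (Face S) (Vertex S) where
  opp := opp
  face := Sigma.fst
  src := src
  tgt := tgt
  bd := O.boundary
  opp_opp := opp_opp
  opp_ne := opp_ne
  mem_bd := mem_boundary
  nodup_bd := nodup_boundary
  src_opp := src_opp
  isWalk_bd f := by
    have h := isWalk_dart (O := O) f (O.chart f).m
    rw [dart_m] at h
    exact ⟨_, h⟩

variable (O) in
theorem exists_dart (e : Edge S) : ∃ d : O.Dart, edge d = e := by
  obtain ⟨f, i, h⟩ := exists_side_eq O.isPolygonal O.chart e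
  exact ⟨⟨f, i⟩, h⟩

variable (O) in
/-- A chosen dart on every edge. -/
noncomputable def edgeDart (e : Edge S) : O.Dart := (O.exists_dart e).choose

theorem edge_edgeDart (e : Edge S) : edge (O.edgeDart e) = e := (O.exists_dart e).choose_spec

theorem edgeDart_eq (d : O.Dart) : O.edgeDart (edge d) = d ∨ O.edgeDart (edge d) = opp d :=
  edge_eq_iff.1 (edge_edgeDart (edge d))

open Classical in
/-- A parametrization of the edges such that opposite darts have reverse parametrizations. -/
noncomputable def path (d : O.Dart) : ℝ → S :=
  if O.edgeDart (edge d) = d then (O.chart d.1).sidePath d.2 else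
    rev ((O.chart (opp d).1).sidePath (opp d).2)

theorem path_of_eq {d : O.Dart} (h : O.edgeDart (edge d) = d) :
    path d = (O.chart d.1).sidePath d.2 := if_pos h

theorem path_opp (d : O.Dart) : path (opp d) = rev (path d) := by
  unfold path
  rw [edge_opp, opp_opp]
  rcases edgeDart_eq d with h | h
  · rw [h, if_neg (opp_ne d).symm, if_pos rfl]
  · rw [h, if_pos rfl, if_neg (opp_ne d)]
    funext t
    simp [rev]

theorem path_of_ne {d : O.Dart} (h : O.edgeDart (edge d) ≠ d) :
    path d = rev ((O.chart (opp d).1).sidePath (opp d).2) := if_neg h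

theorem tgt_opp (d : O.Dart) : tgt (opp d) = src d := O.gluing.tgt_opp d

theorem path_endpoints (d : O.Dart) :
    path d 0 = vertexPt (src d) ∧ path d 1 = vertexPt (tgt d) := by
  by_cases h : O.edgeDart (edge d) = d
  · rw [path_of_eq h]
    exact sidePath_endpoints d
  · rw [path_of_ne h]
    obtain ⟨h0, h1⟩ := sidePath_endpoints (opp d)
    rw [src_opp] at h0
    rw [tgt_opp] at h1
    simp [rev, h0, h1]

theorem continuous_path (d : O.Dart) : Continuous (path d) := by
  by_cases h : O.edgeDart (edge d) = d
  · rw [path_of_eq h]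
    exact PolygonChart.continuous_sidePath _ _
  · rw [path_of_ne h]
    exact (PolygonChart.continuous_sidePath _ _).comp (by fun_prop)

theorem injOn_path (d : O.Dart) : InjOn (path d) (Icc 0 1) := by
  by_cases h : O.edgeDart (edge d) = d
  · rw [path_of_eq h]
    exact PolygonChart.injOn_sidePath _ _
  · rw [path_of_ne h]
    intro s hs t ht he
    have := PolygonChart.injOn_sidePath _ _ (⟨by linarith [hs.2], by linarith [hs.1]⟩ :
      1 - s ∈ Icc (0 : ℝ) 1) ⟨by linarith [ht.2], by linarith [ht.1]⟩ he
    linarith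

theorem image_path (d : O.Dart) : path d '' Ioo 0 1 = RelCWComplex.openCell 1 (edge d) := by
  by_cases h : O.edgeDart (edge d) = d
  · rw [path_of_eq h]
    exact PolygonChart.image_sidePath _ _
  · rw [path_of_ne h, ← edge_opp, edge, ← PolygonChart.image_sidePath]
    ext x
    constructor
    · rintro ⟨t, ht, rfl⟩
      exact ⟨1 - t, ⟨by linarith [ht.2], by linarith [ht.1]⟩, rfl⟩
    · rintro ⟨t, ht, rfl⟩
      exact ⟨1 - t, ⟨by linarith [ht.2], by linarith [ht.1]⟩, by simp [rev]⟩

theorem image_path_Icc (d : O.Dart) :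
    path d '' Icc 0 1 = RelCWComplex.closedCell 1 (edge d) := by
  rw [← RelCWComplex.closure_openCell_eq_closedCell, ← image_path]
  apply subset_antisymm
  · rw [← closure_Ioo (zero_ne_one' ℝ)]
    exact image_closure_subset_closure_image (continuous_path d)
  · exact closure_minimal (image_mono Ioo_subset_Icc_self)
      (isCompact_Icc.image (continuous_path d)).isClosed

theorem reparam_path (d : O.Dart) : Reparam (path d) ((O.chart d.1).sidePath d.2) := by
  refine Reparam.of_injOn (continuous_path d).continuousOn
    (PolygonChart.continuous_sidePath _ _).continuousOn (injOn_path d)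
    (PolygonChart.injOn_sidePath _ _) ?_ ?_ ?_
  · rw [image_path_Icc]
    exact (PolygonChart.closedCell_side _ _).symm
  · rw [(path_endpoints d).1, (sidePath_endpoints d).1]
  · rw [(path_endpoints d).2, (sidePath_endpoints d).2]

theorem reparam_dart (f : Face S) {k : ℕ} (hk : k < (O.chart f).m) :
    Reparam (path (O.dart f k))
      fun t ↦ (O.chart f).toFun (turnPoint ((k + t) / (O.chart f).m)) := by
  have h := reparam_path (O.dart f k)
  rw [dart_of_lt hk] at h ⊢
  exact h

/-- The boundary loop of a polygon runs along its boundary word. -/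
theorem isPathAlong_boundary (f : Face S) :
    IsPathAlong path (O.boundary f) fun s ↦ (O.chart f).toFun (turnPoint s) := by
  have key : ∀ k : ℕ, k < (O.chart f).m →
      IsPathAlong path ((List.range (k + 1)).map (O.dart f)) fun s ↦
        (O.chart f).toFun (turnPoint (s * (k + 1) / (O.chart f).m)) := by
    intro k
    induction k with
    | zero =>
      intro hk
      refine (IsPathAlong.singleton (O.dart f 0)).congr ((reparam_dart f hk).trans ?_)
      exact Reparam.of_eqOn fun t _ ↦ by simp
    | succ k ih =>
      intro hk
      rw [List.range_succ, List.map_append]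
      refine ((ih (by omega)).append
        ((IsPathAlong.singleton (O.dart f (k + 1))).congr (reparam_dart f hk))).congr ?_
      have h := reparam_cat_of_lt (fun s ↦ (O.chart f).toFun (turnPoint (s / (O.chart f).m)))
        (p := 0) (q := k + 1) (r := k + 2) (by positivity) (by linarith)
      refine (Reparam.trans ?_ h.symm).trans ?_
      · refine (Reparam.of_eqOn fun t _ ↦ ?_).cat (Reparam.of_eqOn fun t _ ↦ ?_)
        · simp
        · push_cast
          ring_nf
      · refine Reparam.of_eqOn fun t _ ↦ ?_
        push_cast
        ring_nf
  have hm := (O.chart f).two_le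
  have h := key ((O.chart f).m - 1) (by omega)
  rw [Nat.sub_add_cancel (by omega)] at h
  refine h.congr (Reparam.of_eqOn fun s _ ↦ ?_)
  have h1 : ((((O.chart f).m - 1 : ℕ) : ℝ) + 1) = (O.chart f).m := by
    exact_mod_cast Nat.sub_add_cancel (by omega : 1 ≤ (O.chart f).m)
  rw [h1, mul_div_cancel_right₀ _ (O.chart f).m_pos.ne']

/-- Every vertex lies on a face, since a surface has no isolated points. -/
theorem iUnion_closedCell (O : OrientedSubdivision S) :
    ⋃ f : Face S, RelCWComplex.closedCell 2 f = univ := by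
  have := finite_cell O.isPolygonal 0
  have := finite_cell O.isPolygonal 2
  by_contra hne
  obtain ⟨x, hx⟩ := (ne_univ_iff_exists_notMem _).1 hne
  have hclosed : IsClosed (⋃ f : Face S, RelCWComplex.closedCell 2 f) :=
    isClosed_iUnion_of_finite fun _ ↦ RelCWComplex.isClosed_closedCell
  have hsub : (⋃ f : Face S, RelCWComplex.closedCell 2 f)ᶜ ⊆ range (vertexPt : Vertex S → S) := by
    intro y hy
    rcases O.isPolygonal.exists_cell y with ⟨v, rfl⟩ | ⟨e, h⟩ | ⟨f, h⟩
    · exact ⟨v, rfl⟩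
    · obtain ⟨d, rfl⟩ := O.exists_dart e
      refine (hy (mem_iUnion.2 ⟨d.1, ?_⟩)).elim
      rw [edge, ← PolygonChart.image_sidePath] at h
      obtain ⟨t, -, rfl⟩ := h
      exact PolygonChart.sidePath_mem _ _ _
    · exact (hy (mem_iUnion.2 ⟨f, RelCWComplex.openCell_subset_closedCell _ _ h⟩)).elim
  have hfin : ((⋃ f : Face S, RelCWComplex.closedCell 2 f)ᶜ \ {x}).Finite :=
    ((finite_range _).subset hsub).subset sdiff_subset
  have hnhds : (⋃ f : Face S, RelCWComplex.closedCell 2 f)ᶜ ∩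
      ((⋃ f : Face S, RelCWComplex.closedCell 2 f)ᶜ \ {x})ᶜ ∈ 𝓝 x :=
    Filter.inter_mem (hclosed.isOpen_compl.mem_nhds hx)
      (hfin.isClosed.isOpen_compl.mem_nhds fun h ↦ h.2 rfl)
  obtain ⟨W, hW, ψ, hψ, hloop⟩ := exists_angle x
  obtain ⟨κ, -, hκ, -⟩ := hloop _ hnhds
  exact (hκ 0).1.2 ⟨(hκ 0).1.1, (hκ 0).2⟩

theorem disjoint_openCell_path (f : Face S) (d : O.Dart) :
    Disjoint (RelCWComplex.openCell 2 f) (path d '' Ioo 0 1) := by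
  rw [image_path]
  exact disjoint_face_edge _ _

variable (O) in
/-- A surface with an oriented polygonal subdivision is glued from its faces. -/
noncomputable def gluedSpace : GluedSpace O.gluing S where
  pt := vertexPt
  path := path
  cell f := RelCWComplex.openCell 2 f
  path_zero d := (path_endpoints d).1
  path_one d := (path_endpoints d).2
  path_opp := path_opp
  injOn_path := injOn_path
  pt_notMem v d := by
    rw [image_path]
    exact vertexPt_notMem_edge _ _
  disjoint_path d e h1 h2 := by
    rw [image_path, image_path]
    exact disjoint_edge_edge fun h ↦ (edge_eq_iff.1 h.symm).elim h1 h2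
  disjoint_cell f g h := disjoint_face_face h
  pt_notMem_cell := vertexPt_notMem_face
  disjoint_cell_path := disjoint_openCell_path
  two_le f := by
    have : (O.gluing.bd f).length = (O.chart f).m := by simp [gluing, boundary]
    rw [this]
    exact (O.chart f).two_le
  exists_isDisk f := ⟨_, isPathAlong_boundary f, (O.chart f).toFun, (O.chart f).continuousOn,
    (O.chart f).injOn.mono ball_subset_closedBall, (O.chart f).image_ball, fun _ _ ↦ rfl⟩
  cover := by
    refine eq_univ_of_forall fun x ↦ ?_
    obtain ⟨f, hf⟩ := mem_iUnion.1 (O.iUnion_closedCell.ge (mem_univ x))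
    rcases (O.chart f).mem_closedCell hf with h | ⟨i, h⟩ | ⟨i, rfl⟩
    · exact Or.inl (mem_iUnion.2 ⟨f, h⟩)
    · refine Or.inr (mem_iUnion.2 ⟨⟨f, i⟩, ?_⟩)
      rw [image_path_Icc]
      exact RelCWComplex.openCell_subset_closedCell _ _ h
    · exact Or.inr (mem_iUnion.2 ⟨⟨f, i⟩, 0, by simp, (path_endpoints _).1⟩)

variable (O) in
/-- The dual graph of a polygonal subdivision of a connected surface is connected. -/
theorem exists_crossing_dart [ConnectedSpace S] (M : Set (Face S)) (hM : M.Nonempty)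
    (hM' : M ≠ univ) : ∃ d : O.Dart, d.1 ∈ M ∧ (opp d).1 ∉ M := by
  have := finite_cell O.isPolygonal 0
  by_contra! hno
  have hcov : support M ∪ support Mᶜ = univ := by
    refine eq_univ_of_forall fun x ↦ ?_
    obtain ⟨f, hf⟩ := mem_iUnion.1 (O.iUnion_closedCell.ge (mem_univ x))
    by_cases hfM : f ∈ M
    · exact Or.inl (mem_biUnion hfM hf)
    · exact Or.inr (mem_biUnion hfM hf)
  -- faces of both kinds meet at vertices only
  have hint : support M ∩ support Mᶜ ⊆ range (vertexPt : Vertex S → S) := by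
    rintro x ⟨h1, h2⟩
    simp only [support, mem_iUnion] at h1 h2
    obtain ⟨f, hf, hxf⟩ := h1
    obtain ⟨g, hg, hxg⟩ := h2
    rcases (O.chart f).mem_closedCell hxf with h | ⟨i, h⟩ | ⟨i, rfl⟩
    · rcases (O.chart g).mem_closedCell hxg with h' | ⟨j, h'⟩ | ⟨j, rfl⟩
      · refine ((disjoint_face_face (?_ : f ≠ g)).le_bot ⟨h, h'⟩).elim
        rintro rfl
        exact hg hf
      · exact ((disjoint_face_edge _ _).le_bot ⟨h, h'⟩).elim
      · exact ⟨_, rfl⟩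
    · obtain ⟨j, hj⟩ := (O.chart g).side_of_mem hxg h
      have hne : (⟨g, j⟩ : O.Dart) ≠ ⟨f, i⟩ := fun h ↦ by
        have h' : g = f := congrArg Sigma.fst h
        exact hg (h' ▸ hf)
      have : (⟨g, j⟩ : O.Dart) = opp ⟨f, i⟩ :=
        (edge_eq_iff (d := ⟨f, i⟩) (e := ⟨g, j⟩)).1 hj |>.resolve_left hne
      have h3 := hno ⟨f, i⟩ hf
      rw [← this] at h3
      exact (hg h3).elim
    · exact ⟨_, rfl⟩
  have hne : ∀ N : Set (Face S), N.Nonempty → (univ ∩ support N).Nonempty := by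
    rintro N ⟨f, hf⟩
    obtain ⟨x, hx⟩ := RelCWComplex.closedCell_nonempty 2 f
    exact ⟨x, trivial, mem_biUnion hf hx⟩
  obtain ⟨x, -, hx⟩ := isPreconnected_closed_iff.1 (isPreconnected_univ (α := S)) _ _
    (isClosed_support O M) (isClosed_support O Mᶜ) hcov.ge (hne _ hM)
    (hne _ (nonempty_compl.2 hM'))
  have hfin : (range (vertexPt : Vertex S → S) \ {x}).Finite := (finite_range _).subset sdiff_subset
  obtain ⟨U, hU, hUsub, hUc⟩ := hasConnectedPuncturedNhds_of_chartedSpace S x _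
    (hfin.isClosed.isOpen_compl.mem_nhds fun h ↦ h.2 rfl)
  have hempty : ¬ (U \ {x} ∩ (support M ∩ support Mᶜ)).Nonempty := by
    rintro ⟨y, hy, hy'⟩
    exact hUsub hy.1 ⟨hint hy', hy.2⟩
  have hcase : U \ {x} ⊆ support M ∨ U \ {x} ⊆ support Mᶜ := by
    by_contra! h
    obtain ⟨⟨y, hy, hyM⟩, z, hz, hzM⟩ := And.intro (not_subset.1 h.1) (not_subset.1 h.2)
    have hcovU : ∀ y, y ∈ support M ∨ y ∈ support Mᶜ := fun y ↦ hcov.ge (mem_univ y)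
    exact hempty (isPreconnected_closed_iff.1 hUc _ _ (isClosed_support O M)
      (isClosed_support O Mᶜ) (fun y _ ↦ hcovU y) ⟨z, hz, (hcovU z).resolve_right hzM⟩
      ⟨y, hy, (hcovU y).resolve_left hyM⟩)
  rcases hcase with h | h
  · exact hempty (not_disjoint_support hU hx.2 (hint hx) h)
  · refine hempty ?_
    rw [inter_comm (support M)]
    exact not_disjoint_support hU hx.1 (hint hx) h

end OrientedSubdivision

/-! ### Integral cocycles on the sphere -/

/-- Functions on finitely many closed sets which agree on the overlaps are glued. -/
theorem exists_glue {ι X Y : Type*} [TopologicalSpace X] [TopologicalSpace Y] [Nonempty Y]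
    [Finite ι] {K : ι → Set X} (hK : ∀ i, IsClosed (K i)) {h : ι → X → Y}
    (hc : ∀ i, ContinuousOn (h i) (K i))
    (hcompat : ∀ i j x, x ∈ K i → x ∈ K j → h i x = h j x) :
    ∃ H : X → Y, ContinuousOn H (⋃ i, K i) ∧ ∀ i, EqOn H (h i) (K i) := by
  classical
  let H : X → Y := fun x ↦ if hx : ∃ i, x ∈ K i then h hx.choose x else Classical.arbitrary Y
  have hH : ∀ i, EqOn H (h i) (K i) := fun i x hx ↦ by
    have hex : ∃ i, x ∈ K i := ⟨i, hx⟩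
    simp only [H, dif_pos hex]
    exact hcompat _ _ _ hex.choose_spec hx
  exact ⟨H, (locallyFinite_of_finite K).continuousOn_iUnion hK fun i ↦ (hc i).congr (hH i), hH⟩

theorem eq_of_isPreconnected_of_int {X : Type*} [TopologicalSpace X] {s : Set X}
    (hs : IsPreconnected s) {f : X → ℝ} (hf : ContinuousOn f s) (h : ∀ x ∈ s, ∃ n : ℤ, f x = n)
    {x y : X} (hx : x ∈ s) (hy : y ∈ s) : f x = f y := by
  choose! n hn using h
  have hnc : ContinuousOn n s := by
    rw [Int.isClosedEmbedding_coe_real.isInducing.continuousOn_iff]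
    exact hf.congr fun x hx ↦ (hn x hx).symm
  rw [hn x hx, hn y hy, hs.constant hnc hx hy]

theorem coe_addCircle_eq_iff {a b : ℝ} :
    (a : AddCircle (1 : ℝ)) = b ↔ ∃ n : ℤ, a - b = n := by
  rw [← sub_eq_zero, ← AddCircle.coe_sub, AddCircle.coe_eq_zero_iff]
  simp only [zsmul_eq_mul, mul_one, eq_comm]

/-- A map from the sphere to the circle lifts to the line. -/
theorem IsTwoSphere.exists_lift {X : Type*} [TopologicalSpace X] (hX : IsTwoSphere X)
    {Θ : X → AddCircle (1 : ℝ)} (hΘ : Continuous Θ) :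
    ∃ θ : X → ℝ, Continuous θ ∧ ∀ x, (θ x : AddCircle (1 : ℝ)) = Θ x := by
  classical
  obtain ⟨Φ⟩ := hX
  -- the two hemispheres as images of the disk
  let q : ℝ → Plane → EuclideanSpace ℝ (Fin 3) := fun ε z ↦ !₂[z 0, z 1, ε * √(1 - ‖z‖ ^ 2)]
  have hq : ∀ ε : ℝ, ε ^ 2 = 1 → ∀ z ∈ closedBall (0 : Plane) 1, ‖q ε z‖ = 1 := by
    intro ε hε z hz
    rw [mem_closedBall_zero_iff] at hz
    have h1 : 0 ≤ 1 - ‖z‖ ^ 2 := by nlinarith [norm_nonneg z]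
    rw [← pow_eq_one_iff_of_nonneg (norm_nonneg _) two_ne_zero, EuclideanSpace.real_norm_sq_eq,
      Fin.sum_univ_three]
    simp only [q, Matrix.cons_val_zero, Matrix.cons_val_one, Matrix.cons_val]
    rw [mul_pow, hε, Real.sq_sqrt h1, EuclideanSpace.real_norm_sq_eq, Fin.sum_univ_two]
    ring
  have hqc : ∀ ε, Continuous (q ε) := by
    intro ε
    refine (PiLp.continuous_toLp 2 _).comp (continuous_pi fun i ↦ ?_)
    fin_cases i
    · simp only [Fin.zero_eta, Matrix.cons_val_zero]; fun_prop
    · simp only [Fin.mk_one, Matrix.cons_val_one, Matrix.cons_val_zero]; fun_prop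
    · simp only [Fin.reduceFinMk, Matrix.cons_val]; fun_prop
  let Q : ℝ → Plane → X := fun ε z ↦
    if h : ‖q ε z‖ = 1 then Φ.symm ⟨q ε z, mem_sphere_zero_iff_norm.2 h⟩ else
      Φ.symm ⟨EuclideanSpace.single 0 1, by simp⟩
  have hQc : ∀ ε : ℝ, ε ^ 2 = 1 → ContinuousOn (Q ε) (closedBall 0 1) := by
    intro ε hε
    rw [continuousOn_iff_continuous_domRestrict]
    have : (closedBall (0 : Plane) 1).domRestrict (Q ε) = fun z : closedBall (0 : Plane) 1 ↦
        Φ.symm ⟨q ε z, mem_sphere_zero_iff_norm.2 (hq ε hε z z.2)⟩ := by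
      funext z
      simp only [Set.domRestrict_apply, Q, dif_pos (hq ε hε z z.2)]
    rw [this]
    exact Φ.symm.continuous.comp (((hqc ε).comp continuous_subtype_val).subtype_mk _)
  have : Fact ((0 : ℝ) < 1) := ⟨one_pos⟩
  have hlift : ∀ ε : ℝ, ε ^ 2 = 1 → ∃ θ : Plane → ℝ, ContinuousOn θ (closedBall 0 1) ∧
      ∀ z ∈ closedBall (0 : Plane) 1, (θ z : AddCircle (1 : ℝ)) = Θ (Q ε z) := fun ε hε ↦
    exists_lift_of_convex (convex_closedBall _ _) (hΘ.comp_continuousOn (hQc ε hε))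
  obtain ⟨θ₁, hθ₁, hl₁⟩ := hlift 1 (by norm_num)
  obtain ⟨θ₂, hθ₂, hl₂⟩ := hlift (-1) (by norm_num)
  -- on the equator the two lifts differ by an integer constant
  have heq : ∀ z ∈ sphere (0 : Plane) 1, Q 1 z = Q (-1) z := by
    intro z hz
    have hz' : ‖z‖ = 1 := mem_sphere_zero_iff_norm.1 hz
    have : q 1 z = q (-1) z := by simp [q, hz']
    simp only [Q, this]
  have hint : ∀ z ∈ sphere (0 : Plane) 1, ∃ n : ℤ, θ₁ z - θ₂ z = n := by
    intro z hz
    rw [← coe_addCircle_eq_iff, hl₁ z (sphere_subset_closedBall hz),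
      hl₂ z (sphere_subset_closedBall hz), heq z hz]
  have hz₀ : EuclideanSpace.single 0 1 ∈ sphere (0 : Plane) 1 := by simp
  obtain ⟨N, hN⟩ := hint _ hz₀
  have hconst : ∀ z ∈ sphere (0 : Plane) 1, θ₁ z - θ₂ z = N := fun z hz ↦ by
    rw [← hN]
    exact eq_of_isPreconnected_of_int (isPreconnected_sphere one_lt_rank_plane 0 1)
      ((hθ₁.sub hθ₂).mono sphere_subset_closedBall) hint hz hz₀
  let pr : X → Plane := fun x ↦ !₂[(Φ x).1 0, (Φ x).1 1]
  have hsq : ∀ x, ‖pr x‖ ^ 2 + (Φ x).1 2 ^ 2 = 1 := fun x ↦ by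
    have h := mem_sphere_zero_iff_norm.1 (Φ x).2
    rw [← pow_eq_one_iff_of_nonneg (norm_nonneg _) two_ne_zero, EuclideanSpace.real_norm_sq_eq,
      Fin.sum_univ_three] at h
    rw [EuclideanSpace.real_norm_sq_eq, Fin.sum_univ_two]
    exact h
  have hpr : ∀ x, pr x ∈ closedBall (0 : Plane) 1 := fun x ↦ by
    rw [mem_closedBall_zero_iff]
    nlinarith [hsq x, sq_nonneg ((Φ x).1 2), norm_nonneg (pr x)]
  have hcoord : ∀ i, Continuous fun x ↦ (Φ x).1 i := fun i ↦
    (by fun_prop : Continuous fun y : EuclideanSpace ℝ (Fin 3) ↦ y i).comp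
      (continuous_subtype_val.comp Φ.continuous)
  have hprc : Continuous pr := by
    refine (PiLp.continuous_toLp 2 _).comp (continuous_pi fun i ↦ ?_)
    fin_cases i
    · exact hcoord 0
    · exact hcoord 1
  have hQ : ∀ ε : ℝ, ε ^ 2 = 1 → ∀ x, 0 ≤ ε * (Φ x).1 2 → Q ε (pr x) = x := by
    intro ε hε x hx
    have h1 : q ε (pr x) = (Φ x).1 := by
      have h2 : √(1 - ‖pr x‖ ^ 2) = ε * (Φ x).1 2 := by
        have h3 : 1 - ‖pr x‖ ^ 2 = (ε * (Φ x).1 2) ^ 2 := by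
          rw [mul_pow, hε]
          linarith [hsq x]
        rw [h3, Real.sqrt_sq hx]
      ext i
      fin_cases i
      · simp [q, pr]
      · simp [q, pr]
      · simp only [q, h2]
        simp only [Fin.reduceFinMk, Matrix.cons_val]
        rw [← mul_assoc, ← sq, hε, one_mul]
    have h2 : ‖q ε (pr x)‖ = 1 := hq ε hε _ (hpr x)
    simp only [Q, dif_pos h2, h1, Subtype.coe_eta, Homeomorph.symm_apply_apply]
  refine ⟨fun x ↦ if 0 ≤ (Φ x).1 2 then θ₁ (pr x) else θ₂ (pr x) + N, ?_, fun x ↦ ?_⟩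
  · refine Continuous.if_le (hθ₁.comp_continuous hprc hpr)
      ((hθ₂.comp_continuous hprc hpr).add continuous_const) continuous_const (hcoord 2) ?_
    intro x hx
    have : pr x ∈ sphere (0 : Plane) 1 := by
      rw [mem_sphere_zero_iff_norm, ← pow_eq_one_iff_of_nonneg (norm_nonneg _) two_ne_zero,
        ← hsq x, ← hx]
      ring
    linarith [hconst _ this]
  · by_cases hx : 0 ≤ (Φ x).1 2
    · simp only [if_pos hx]
      rw [hl₁ _ (hpr x), hQ 1 (by norm_num) x (by linarith)]
    · simp only [if_neg hx]
      have h1 : ((θ₂ (pr x) + N : ℝ) : AddCircle (1 : ℝ)) = (θ₂ (pr x) : ℝ) :=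
        coe_addCircle_eq_iff.2 ⟨N, by ring⟩
      rw [h1, hl₂ _ (hpr x), hQ (-1) (by norm_num) x (by linarith)]

namespace OrientedSubdivision

section

variable {S : Type*} [TopologicalSpace S] [CWComplex (univ : Set S)] {O : OrientedSubdivision S}

/-- A function on darts with trivial holonomy around a face is a coboundary on this face. -/
theorem exists_potential_on_face {G : Type*} [Group G] (g : O.Dart → G) (f : Face S)
    (h : hol g (O.boundary f) = 1) :
    ∃ p : Vertex S → G, ∀ d : O.Dart, d.1 = f → g d = (p (src d))⁻¹ * p (tgt d) := by
  let s : ℕ → G := fun k ↦ hol g ((List.range k).map (O.dart f))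
  let p : Vertex S → G := Function.extend (O.chart f).vertex (fun i ↦ s i) 1
  have hp : ∀ k ≤ (O.chart f).m, p (src (O.dart f k)) = s k := by
    have hlt : ∀ k < (O.chart f).m, p (src (O.dart f k)) = s k := fun k hk ↦ by
      rw [dart_of_lt hk]
      exact (O.chart f).vertex_injective.extend_apply _ _ _
    intro k hk
    rcases hk.lt_or_eq with hk | rfl
    · exact hlt k hk
    · rw [dart_m, hlt 0 (lt_of_lt_of_le two_pos (O.chart f).two_le)]
      exact h.symm
  refine ⟨p, ?_⟩
  intro d hdf
  obtain ⟨f', i⟩ := d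
  obtain rfl : f = f' := hdf.symm
  have hd : O.dart f i = ⟨f, i⟩ := dart_of_lt i.2
  have hs : s (i + 1) = s i * g (O.dart f i) := by
    simp [s, List.range_succ]
  have h1 := hp i i.2.le
  have h2 := hp (i + 1) i.2
  rw [← tgt_dart] at h2
  rw [hd] at h1 h2 hs
  rw [h1, h2, hs, inv_mul_cancel_left]

end

variable {S : Type*} [TopologicalSpace S] [T2Space S] [CWComplex (univ : Set S)]
  [ChartedSpace Plane S] {O : OrientedSubdivision S}

/-- Two paths meet only in endpoints, unless they run along the same edge. -/
theorem path_eq_cases {d e : O.Dart} {t u : ℝ} (ht : t ∈ Icc (0 : ℝ) 1) (hu : u ∈ Icc (0 : ℝ) 1)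
    (h : path d t = path e u) : (e = d ∧ u = t) ∨ (e = opp d ∧ u = 1 - t) ∨
      ((t = 0 ∨ t = 1) ∧ (u = 0 ∨ u = 1)) := by
  by_cases hed : edge e = edge d
  · rcases edge_eq_iff.1 hed with rfl | rfl
    · exact Or.inl ⟨rfl, injOn_path e hu ht h.symm⟩
    · rw [path_opp] at h
      have := injOn_path d ht ⟨by linarith [hu.2], by linarith [hu.1]⟩ h
      exact Or.inr (Or.inl ⟨rfl, by linarith⟩)
  have key : ∀ {d e : O.Dart} {t u : ℝ}, edge e ≠ edge d → t ∈ Icc (0 : ℝ) 1 →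
      u ∈ Icc (0 : ℝ) 1 → path d t = path e u → t = 0 ∨ t = 1 := by
    intro d e t u hed ht hu h
    by_contra! hno
    have h1 : path d t ∈ RelCWComplex.openCell 1 (edge d) := by
      rw [← image_path]
      exact ⟨t, ⟨lt_of_le_of_ne ht.1 hno.1.symm, lt_of_le_of_ne ht.2 hno.2⟩, rfl⟩
    have h2 : path e u ∈ RelCWComplex.closedCell 1 (edge e) := by
      rw [← image_path_Icc]
      exact ⟨u, hu, rfl⟩
    rcases closedCell_edge_subset _ h2 with h3 | ⟨v, h3⟩
    · exact (disjoint_edge_edge hed).le_bot ⟨h3, h ▸ h1⟩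
    · exact vertexPt_notMem_edge v (edge d) (by rw [h3, ← h]; exact h1)
  exact Or.inr (Or.inr ⟨key hed ht hu h, key (Ne.symm hed) hu ht h.symm⟩)

/-- The two sides of an edge lie in different faces, as the closed faces are embedded. -/
theorem face_opp_ne (d : O.Dart) : (opp d).1 ≠ d.1 := fun h ↦
  opp_ne d (eq_of_edge_eq (edge_opp d) h)

/-- A closed face is the union of the open face and the paths around it. -/
theorem exists_path_eq {f : Face S} {x : S} (hx : x ∈ RelCWComplex.closedCell 2 f)
    (h : x ∉ RelCWComplex.openCell 2 f) :
    ∃ d : O.Dart, d.1 = f ∧ ∃ t ∈ Icc (0 : ℝ) 1, path d t = x := by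
  rcases (O.chart f).mem_closedCell hx with h' | ⟨i, h'⟩ | ⟨i, rfl⟩
  · exact (h h').elim
  · have h1 := RelCWComplex.openCell_subset_closedCell _ _ h'
    have h2 := image_path_Icc (⟨f, i⟩ : O.Dart)
    rw [edge] at h2
    rw [← h2] at h1
    exact ⟨⟨f, i⟩, rfl, h1⟩
  · exact ⟨⟨f, i⟩, rfl, 0, by simp, (path_endpoints _).1⟩

/-- A real function which is prescribed along the boundary of a face, increasing linearly along
each side. -/
theorem exists_continuous_on_face [CompactSpace S] (f : Face S) (p : Vertex S → ℝ) :
    ∃ Θ : S → ℝ, Continuous Θ ∧ ∀ d : O.Dart, d.1 = f → ∀ t ∈ Icc (0 : ℝ) 1,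
      Θ (path d t) = p (src d) + (p (tgt d) - p (src d)) * t := by
  let K : Fin (O.chart f).m → Set S := fun i ↦ path (⟨f, i⟩ : O.Dart) '' Icc 0 1
  let h : Fin (O.chart f).m → S → ℝ := fun i x ↦ p (src (⟨f, i⟩ : O.Dart)) +
    (p (tgt (⟨f, i⟩ : O.Dart)) - p (src (⟨f, i⟩ : O.Dart))) *
      Function.invFunOn (path (⟨f, i⟩ : O.Dart)) (Icc 0 1) x
  have hval : ∀ i, ∀ t ∈ Icc (0 : ℝ) 1, h i (path (⟨f, i⟩ : O.Dart) t) =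
      p (src (⟨f, i⟩ : O.Dart)) +
        (p (tgt (⟨f, i⟩ : O.Dart)) - p (src (⟨f, i⟩ : O.Dart))) * t := fun i t ht ↦ by
    have : Function.invFunOn (path (⟨f, i⟩ : O.Dart)) (Icc 0 1) (path ⟨f, i⟩ t) = t :=
      (injOn_path _).leftInvOn_invFunOn ht
    simp only [h, this]
  have hend : ∀ i, ∀ t : ℝ, (t = 0 ∨ t = 1) → ∃ v, path (⟨f, i⟩ : O.Dart) t = vertexPt v ∧
      h i (path (⟨f, i⟩ : O.Dart) t) = p v := by
    rintro i t (rfl | rfl)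
    · exact ⟨_, (path_endpoints _).1, by rw [hval i 0 (by simp)]; ring⟩
    · exact ⟨_, (path_endpoints _).2, by rw [hval i 1 (by simp)]; ring⟩
  have hKc : ∀ i, IsClosed (K i) := fun i ↦ (isCompact_Icc.image (continuous_path _)).isClosed
  obtain ⟨H, hHc, hH⟩ := exists_glue (K := K) (h := h) hKc (fun i ↦ by
    refine continuousOn_image_of_comp isCompact_Icc (continuous_path _).continuousOn ?_
    refine ContinuousOn.congr (f := fun t ↦ p (src (⟨f, i⟩ : O.Dart)) +
        (p (tgt (⟨f, i⟩ : O.Dart)) - p (src (⟨f, i⟩ : O.Dart))) * t) (by fun_prop) ?_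
    exact fun t ht ↦ hval i t ht) (by
    rintro i j _ ⟨t, ht, rfl⟩ ⟨u, hu, hut⟩
    rcases path_eq_cases ht hu hut.symm with ⟨he, -⟩ | ⟨he, -⟩ | ⟨ht', hu'⟩
    · have : j = i := by simpa using he
      rw [this]
    · exact (face_opp_ne (⟨f, i⟩ : O.Dart)
        (congrArg Sigma.fst he.symm : (opp (⟨f, i⟩ : O.Dart)).1 = f)).elim
    · obtain ⟨v, hv, hv'⟩ := hend i t ht'
      obtain ⟨w, hw, hw'⟩ := hend j u hu'
      rw [hut, hv] at hw
      rw [hv', ← hut, hw', vertexPt_injective hw])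
  obtain ⟨Θ, hΘ⟩ := ContinuousMap.exists_restrict_eq (isClosed_iUnion_of_finite hKc)
    ⟨_, continuousOn_iff_continuous_domRestrict.1 hHc⟩
  refine ⟨Θ, Θ.continuous, ?_⟩
  intro d hdf t ht
  obtain ⟨f', i⟩ := d
  obtain rfl : f = f' := hdf.symm
  have hm : path (⟨f, i⟩ : O.Dart) t ∈ K i := ⟨t, ht, rfl⟩
  have h1 := DFunLike.congr_fun hΘ ⟨_, mem_iUnion.2 ⟨i, hm⟩⟩
  exact h1.trans ((hH i hm).trans (hval i t ht))

/-- An integral cocycle is the increment along the darts of a map to the circle. -/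
theorem exists_circle_map [CompactSpace S] (n : O.Dart → ℤ) (hn : ∀ d, n (opp d) = -n d)
    (p : Face S → Vertex S → ℤ) (hp : ∀ d, n d = p d.1 (tgt d) - p d.1 (src d)) :
    ∃ Θ : S → AddCircle (1 : ℝ), Continuous Θ ∧ ∀ d : O.Dart, ∀ t ∈ Icc (0 : ℝ) 1,
      Θ (path d t) = ((n d * t : ℝ) : AddCircle (1 : ℝ)) := by
  have := finite_cell O.isPolygonal 2
  choose θ hθc hθ using fun f ↦ exists_continuous_on_face (O := O) f fun v ↦ (p f v : ℝ)
  have hθ' : ∀ d : O.Dart, ∀ t ∈ Icc (0 : ℝ) 1,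
      (θ d.1 (path d t) : AddCircle (1 : ℝ)) = ((n d * t : ℝ) : AddCircle (1 : ℝ)) := by
    intro d t ht
    rw [hθ d.1 d rfl t ht, coe_addCircle_eq_iff]
    exact ⟨p d.1 (src d), by rw [hp d]; push_cast; ring⟩
  have hwd : ∀ d e : O.Dart, ∀ t ∈ Icc (0 : ℝ) 1, ∀ u ∈ Icc (0 : ℝ) 1, path d t = path e u →
      ((n d * t : ℝ) : AddCircle (1 : ℝ)) = ((n e * u : ℝ) : AddCircle (1 : ℝ)) := by
    intro d e t ht u hu h
    rw [coe_addCircle_eq_iff]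
    rcases path_eq_cases ht hu h with ⟨rfl, rfl⟩ | ⟨rfl, rfl⟩ | ⟨rfl | rfl, rfl | rfl⟩
    · exact ⟨0, by simp⟩
    · exact ⟨n d, by rw [hn]; push_cast; ring⟩
    · exact ⟨0, by simp⟩
    · exact ⟨-n e, by push_cast; ring⟩
    · exact ⟨n d, by ring⟩
    · exact ⟨n d - n e, by push_cast; ring⟩
  have hcl : ∀ f : Face S, IsClosed (RelCWComplex.closedCell 2 f) := fun _ ↦
    RelCWComplex.isClosed_closedCell
  obtain ⟨Θ, hΘc, hΘ⟩ := exists_glue (Y := AddCircle (1 : ℝ)) hcl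
    (h := fun f x ↦ (θ f x : AddCircle (1 : ℝ)))
    (fun f ↦ ((AddCircle.continuous_mk' (1 : ℝ)).comp (hθc f)).continuousOn) (by
    intro f g x hf hg
    by_cases hfg : f = g
    · rw [hfg]
    by_cases hxf : x ∈ RelCWComplex.openCell 2 f
    · exfalso
      by_cases hxg : x ∈ RelCWComplex.openCell 2 g
      · exact (disjoint_face_face hfg).le_bot ⟨hxf, hxg⟩
      · rcases (O.chart g).mem_closedCell hg with h' | ⟨i, h'⟩ | ⟨i, rfl⟩
        · exact hxg h'
        · exact (disjoint_face_edge _ _).le_bot ⟨hxf, h'⟩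
        · exact vertexPt_notMem_face _ _ hxf
    by_cases hxg : x ∈ RelCWComplex.openCell 2 g
    · exfalso
      rcases (O.chart f).mem_closedCell hf with h' | ⟨i, h'⟩ | ⟨i, rfl⟩
      · exact hxf h'
      · exact (disjoint_face_edge _ _).le_bot ⟨hxg, h'⟩
      · exact vertexPt_notMem_face _ _ hxg
    obtain ⟨d, rfl, t, ht, rfl⟩ := exists_path_eq (O := O) hf hxf
    obtain ⟨e, rfl, u, hu, hut⟩ := exists_path_eq (O := O) hg hxg
    rw [hθ' d t ht, ← hut, hθ' e u hu, hwd d e t ht u hu hut.symm])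
  rw [iUnion_closedCell O, continuousOn_univ] at hΘc
  refine ⟨Θ, hΘc, fun d t ht ↦ ?_⟩
  rw [← hθ' d t ht]
  refine hΘ d.1 ?_
  have h1 : path d t ∈ RelCWComplex.closedCell 1 (edge d) := by
    rw [← image_path_Icc]
    exact ⟨t, ht, rfl⟩
  rw [edge, PolygonChart.closedCell_side] at h1
  obtain ⟨u, -, hu⟩ := h1
  rw [← hu]
  exact PolygonChart.sidePath_mem _ _ _

/-- The first integral cohomology of the sphere vanishes. -/
theorem exists_potential_of_isTwoSphere [CompactSpace S] (hS : IsTwoSphere S)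
    (g : O.Dart → Multiplicative ℤ) (hg : ∀ d, g (opp d) = (g d)⁻¹)
    (hflat : ∀ f, hol g (O.boundary f) = 1) :
    ∃ φ : Vertex S → Multiplicative ℤ, ∀ d : O.Dart, g d = (φ (src d))⁻¹ * φ (tgt d) := by
  choose p hp using fun f ↦ exists_potential_on_face g f (hflat f)
  obtain ⟨Θ, hΘc, hΘ⟩ := exists_circle_map (fun d ↦ (g d).toAdd) (fun d ↦ by rw [hg]; rfl)
    (fun f v ↦ (p f v).toAdd) (fun d ↦ by
      rw [hp d.1 d rfl, toAdd_mul, toAdd_inv]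
      ring)
  obtain ⟨θ, hθc, hθ⟩ := hS.exists_lift hΘc
  have hinc : ∀ d : O.Dart, θ (vertexPt (tgt d)) = θ (vertexPt (src d)) + (g d).toAdd := by
    intro d
    have := eq_of_isPreconnected_of_int (isPreconnected_Icc (a := (0 : ℝ)) (b := 1))
      (f := fun t ↦ θ (path d t) - (g d).toAdd * t)
      ((hθc.comp (continuous_path d)).sub (by fun_prop)).continuousOn
      (fun t ht ↦ by rw [← coe_addCircle_eq_iff, hθ, hΘ d t ht])
      (x := 0) (y := 1) (by simp) (by simp)
    simp only [path_endpoints] at this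
    linarith
  have hvert : ∀ d : O.Dart, ∃ k : ℤ, θ (vertexPt (src d)) = k := by
    intro d
    have h := hΘ d 0 (by simp)
    rw [← hθ, coe_addCircle_eq_iff, (path_endpoints d).1] at h
    simpa using h
  refine ⟨fun v ↦ Multiplicative.ofAdd ⌊θ (vertexPt v)⌋, fun d ↦ ?_⟩
  obtain ⟨k, hk⟩ := hvert d
  have h1 := hinc d
  rw [hk] at h1
  apply Multiplicative.toAdd.injective
  rw [toAdd_mul, toAdd_inv, toAdd_ofAdd, toAdd_ofAdd, h1, hk]
  rw [← Int.cast_add, Int.floor_intCast, Int.floor_intCast]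
  ring

end OrientedSubdivision

open scoped LinearAlgebra.Projectivization

/-! ### Points on lines and general position -/

section linear

variable {D : Type*} [DivisionRing D] {E : Type*} [AddCommGroup E] [Module D E]

theorem eq_of_rep_eq_smul {r q : ℙ D E} {y : D} (h : r.rep = y • q.rep) : r = q := by
  rw [← r.mk_rep, ← q.mk_rep, Projectivization.mk_eq_mk_iff']
  exact ⟨y, h.symm⟩

/-- A point of the line through `p` and `q`, different from both, in coordinates. -/
theorem exists_rep_eq {p q r : ℙ D E} (hrp : r ≠ p) (hrq : r ≠ q) (hpq : p ≠ q)
    (h : Projectivization.Dependent ![r, p, q]) :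
    ∃ c g : Dˣ, r.rep = (c : D) • (p.rep - (g : D) • q.rep) := by
  have hli : LinearIndependent D ![p.rep, q.rep] := by
    have := Projectivization.independent_iff.1
      ((Projectivization.independent_pair_iff_ne p q).2 hpq)
    convert this using 1
    ext i
    fin_cases i <;> rfl
  have hcons : Projectivization.rep ∘ ![r, p, q] = Fin.cons r.rep ![p.rep, q.rep] := by
    funext i
    fin_cases i <;> rfl
  rw [Projectivization.dependent_iff, hcons, linearIndependent_finCons] at h
  have hmem : r.rep ∈ Submodule.span D {p.rep, q.rep} := by
    by_contra hno
    refine h ⟨hli, ?_⟩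
    rwa [Matrix.range_cons, Matrix.range_cons, Matrix.range_empty, union_empty, singleton_union]
  obtain ⟨x, y, hxy⟩ := Submodule.mem_span_pair.1 hmem
  have hx : x ≠ 0 := by
    rintro rfl
    exact hrq (eq_of_rep_eq_smul (y := y) (by rw [← hxy, zero_smul, zero_add]))
  have hy : y ≠ 0 := by
    rintro rfl
    exact hrp (eq_of_rep_eq_smul (y := x) (by rw [← hxy, zero_smul, add_zero]))
  refine ⟨Units.mk0 x hx, Units.mk0 (-(x⁻¹ * y)) (neg_ne_zero.2 (mul_ne_zero (inv_ne_zero hx) hy)),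
    ?_⟩
  rw [Units.val_mk0, Units.val_mk0, neg_smul, sub_neg_eq_add, smul_add, smul_smul,
    mul_inv_cancel_left₀ hx, hxy]

/-- The converse of `exists_rep_eq`. -/
theorem ne_and_dependent_of_rep_eq {x y : E} (hx : x ≠ 0) (hy : y ≠ 0)
    (hxy : LinearIndependent D ![x, y]) {r : ℙ D E} {c g : Dˣ}
    (hr : r.rep = (c : D) • (x - (g : D) • y)) :
    (r ≠ .mk D x hx ∧ r ≠ .mk D y hy ∧ Projectivization.mk D x hx ≠ .mk D y hy) ∧
      Projectivization.Dependent ![r, .mk D x hx, .mk D y hy] := by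
  obtain ⟨u, hu⟩ := Projectivization.exists_smul_eq_mk_rep D x hx
  obtain ⟨v, hv⟩ := Projectivization.exists_smul_eq_mk_rep D y hy
  have hxy' := LinearIndependent.pair_iff.1 hxy
  refine ⟨⟨?_, ?_, ?_⟩, ?_⟩
  · rintro rfl
    rw [hr, Units.smul_def] at hu
    have h := (hxy' (c - u) (-(c * g)) (by
      rw [sub_smul, hu, neg_smul, smul_sub, smul_smul]
      abel)).2
    exact (c * g).ne_zero (by rw [Units.val_mul]; exact neg_eq_zero.1 h)
  · rintro rfl
    rw [hr, Units.smul_def] at hv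
    have h := (hxy' c (-(c * g) - v) (by
      rw [sub_smul, hv, neg_smul, smul_sub, smul_smul]
      abel)).1
    exact c.ne_zero h
  · rw [Ne, Projectivization.mk_eq_mk_iff']
    rintro ⟨a, ha⟩
    exact one_ne_zero (hxy' 1 (-a) (by rw [one_smul, neg_smul, ha, add_neg_cancel])).1
  · rw [Projectivization.dependent_iff]
    have hcons : Projectivization.rep ∘ ![r, .mk D x hx, .mk D y hy] =
        Fin.cons r.rep ![(Projectivization.mk D x hx).rep, (Projectivization.mk D y hy).rep] := by
      funext i
      fin_cases i <;> rfl
    rw [hcons, linearIndependent_finCons, Matrix.range_cons, Matrix.range_cons, Matrix.range_empty,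
      union_empty, singleton_union]
    rintro ⟨-, h⟩
    refine h (Submodule.mem_span_pair.2 ⟨c * (↑u⁻¹ : D), -(c * g * (↑v⁻¹ : D)), ?_⟩)
    rw [← hu, ← hv, Units.smul_def, Units.smul_def, smul_smul, neg_smul, smul_smul, mul_assoc,
      Units.inv_mul, mul_one, mul_assoc _ (↑v⁻¹ : D), Units.inv_mul, mul_one, hr, smul_sub,
      smul_smul, sub_eq_add_neg]

/-- Reversing an edge inverts its ratio. -/
theorem eq_inv_of_rep_eq {x y r : E} (hxy : LinearIndependent D ![x, y]) {c g c' g' : Dˣ}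
    (h : r = (c : D) • (x - (g : D) • y)) (h' : r = (c' : D) • (y - (g' : D) • x)) :
    g' = g⁻¹ := by
  have h1 := LinearIndependent.pair_iff.1 hxy (c + c' * g') (-(c * g) - c') (by
    have : (c : D) • (x - (g : D) • y) - (c' : D) • (y - (g' : D) • x) = 0 := by
      rw [← h, ← h', sub_self]
    rw [← this, smul_sub, smul_sub, smul_smul, smul_smul, add_smul, sub_smul, neg_smul]
    abel)
  have h2 : (c' : D) = -(c * g) := (sub_eq_zero.1 h1.2).symm
  have h3 : (c : D) * (g * g') = c * 1 := by
    have := h1.1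
    rw [h2, neg_mul, mul_assoc, ← sub_eq_add_neg, sub_eq_zero] at this
    rw [mul_one]
    exact this.symm
  have h4 : g * g' = 1 := Units.ext (mul_left_cancel₀ c.ne_zero h3)
  exact eq_inv_of_mul_eq_one_right h4

/-- Over an infinite division ring there are arbitrarily large finite families of vectors in
general position. -/
theorem exists_general_position [Infinite D] [FiniteDimensional D E] (V : Type*) [Finite V] :
    ∃ a : V → E, ∀ s : Finset V, s.card ≤ Module.finrank D E →
      LinearIndepOn D a (s : Set V) := by
  classical
  have := Fintype.ofFinite V
  have key : ∀ T : Finset V, ∃ a : V → E, ∀ s ⊆ T, s.card ≤ Module.finrank D E →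
      LinearIndepOn D a (s : Set V) := by
    intro T
    induction T using Finset.induction with
    | empty =>
      refine ⟨0, fun s hs _ ↦ ?_⟩
      rw [Finset.subset_empty.1 hs, Finset.coe_empty]
      exact linearIndepOn_empty _ _
    | insert v T hv ih =>
      obtain ⟨a, ha⟩ := ih
      let spans : Finset (Submodule D E) :=
        ((T.powerset.filter fun s ↦ s.card < Module.finrank D E).image
          fun s : Finset V ↦ Submodule.span D (a '' (s : Set V)))
      have htop : ⊤ ∉ spans := by
        simp only [spans, Finset.mem_image, Finset.mem_filter, not_exists, not_and, and_imp]
        intro s _ hcard htop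
        have h1 := finrank_span_finset_le_card (R := D) (s.image a)
        rw [Set.finrank, Finset.coe_image, htop, finrank_top] at h1
        have h2 := Finset.card_image_le (s := s) (f := a)
        omega
      obtain ⟨x, hx⟩ := (ne_univ_iff_exists_notMem _).1
        (Subspace.biUnion_ne_univ_of_top_notMem htop)
      have hcongr : ∀ s : Finset V, v ∉ s → EqOn (Function.update a v x) a s := fun s hs y hy ↦
        Function.update_of_ne (fun h ↦ hs (by rw [← h]; exact hy)) _ _
      refine ⟨Function.update a v x, fun s hs hcard ↦ ?_⟩
      by_cases hvs : v ∈ s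
      · have hT : s.erase v ⊆ T := fun y hy ↦
          Finset.mem_of_mem_insert_of_ne (hs (Finset.mem_of_mem_erase hy)) (Finset.ne_of_mem_erase hy)
        have hc : (s.erase v).card < Module.finrank D E :=
          lt_of_lt_of_le (Finset.card_erase_lt_of_mem hvs) hcard
        have he := hcongr (s.erase v) (Finset.notMem_erase v s)
        rw [← Finset.insert_erase hvs, Finset.coe_insert]
        refine LinearIndepOn.insert ((ha _ hT hc.le).congr he.symm) ?_
        rw [he.image_eq, Function.update_self]
        intro hmem
        refine hx (mem_biUnion (x := Submodule.span D (a '' (s.erase v : Finset V))) ?_ hmem)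
        exact Finset.mem_coe.2 (Finset.mem_image.2
          ⟨s.erase v, Finset.mem_filter.2 ⟨Finset.mem_powerset.2 hT, hc⟩, rfl⟩)
      · refine (ha s (fun y hy ↦ ?_) hcard).congr (hcongr s hvs).symm
        exact Finset.mem_of_mem_insert_of_ne (hs hy) fun h ↦ hvs (h ▸ hy)
  obtain ⟨a, ha⟩ := key Finset.univ
  exact ⟨a, fun s hs ↦ ha s (Finset.subset_univ s) hs⟩

end linear

namespace OrientedSubdivision

/-! ### The Menelaus condition as a holonomy condition -/

section menelaus

variable {S : Type*} [TopologicalSpace S] [CWComplex (univ : Set S)] {O : OrientedSubdivision S}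
  {D : Type*} [DivisionRing D] {E : Type*} [AddCommGroup E] [Module D E]

/-- The algebraic theorem of Menelaus for polygons. -/
theorem linearIndependent_sides_iff {f : Face S} {a : Vertex S → E}
    (ha : LinearIndependent D fun i ↦ a ((O.chart f).vertex i)) (g : O.Dart → Dˣ) :
    LinearIndependent D (fun i ↦ a (src (⟨f, i⟩ : O.Dart)) -
      (g ⟨f, i⟩ : D) • a (tgt (⟨f, i⟩ : O.Dart))) ↔ hol g (O.boundary f) ≠ 1 := by
  have hpos : 0 < (O.chart f).m := lt_of_lt_of_le two_pos (O.chart f).two_le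
  have hsum : ∀ c : Fin (O.chart f).m → D, ∑ i, c i • (a (src (⟨f, i⟩ : O.Dart)) -
      (g ⟨f, i⟩ : D) • a (tgt (⟨f, i⟩ : O.Dart))) =
      ∑ i, (c (finRotate _ i) - c i * g ⟨f, i⟩) • a ((O.chart f).vertex (finRotate _ i)) := by
    intro c
    simp only [smul_sub, sub_smul, Finset.sum_sub_distrib, smul_smul]
    rw [Equiv.sum_comp (finRotate (O.chart f).m) fun i ↦ c i • a ((O.chart f).vertex i)]
    rfl
  constructor
  · intro hli hhol
    obtain ⟨p, hp⟩ := exists_potential_on_face g f hhol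
    have h := Fintype.linearIndependent_iff.1 hli
      (fun i ↦ (p ((O.chart f).vertex i) : D)) (by
      rw [hsum]
      refine Finset.sum_eq_zero fun i _ ↦ ?_
      rw [hp ⟨f, i⟩ rfl, ← Units.val_mul]
      have : p ((O.chart f).vertex i) * ((p (src (⟨f, i⟩ : O.Dart)))⁻¹ *
          p (tgt (⟨f, i⟩ : O.Dart))) = p ((O.chart f).vertex (finRotate _ i)) :=
        mul_inv_cancel_left _ _
      rw [this, sub_self, zero_smul]) ⟨0, hpos⟩
    exact (p _).ne_zero h
  · intro hhol
    rw [Fintype.linearIndependent_iff]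
    intro c hc
    rw [hsum] at hc
    have hrot := Fintype.linearIndependent_iff.1
      (ha.comp (finRotate (O.chart f).m) (finRotate (O.chart f).m).injective) _ hc
    -- the coefficients are multiplied by `g` along each side
    have hC : ∀ k : ℕ, c (O.dart f k).2 = c (O.dart f 0).2 *
        (hol g ((List.range k).map (O.dart f)) : Dˣ) := by
      intro k
      induction k with
      | zero => simp
      | succ k ih =>
        have h := sub_eq_zero.1 (hrot (O.dart f k).2)
        rw [finRotate_dart] at h
        rw [h, ih, List.range_succ, List.map_append, hol_append, Units.val_mul, mul_assoc]
        simp only [List.map_cons, List.map_nil, hol_cons, hol_nil, mul_one]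
        rfl
    have h0 : c (O.dart f 0).2 = 0 := by
      by_contra hne
      have h := hC (O.chart f).m
      have hm : (O.dart f (O.chart f).m).2 = (O.dart f 0).2 := Fin.ext (by simp [dart])
      rw [hm] at h
      refine hhol (Units.ext (mul_left_cancel₀ hne ?_))
      rw [Units.val_one, mul_one]
      exact h.symm
    intro i
    have h := hC i
    rw [h0, zero_mul] at h
    have hi : (O.dart f i).2 = i := by
      apply Fin.ext
      exact Nat.mod_eq_of_lt i.2
    rw [← h, hi]

end menelaus

variable {S : Type*} [TopologicalSpace S] [T2Space S] [CWComplex (univ : Set S)]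
  {O : OrientedSubdivision S} {D : Type*} [DivisionRing D] {n : ℕ}

theorem linearIndependent_vertex {E : Type*} [AddCommGroup E] [Module D E] {f : Face S}
    {a : Vertex S → E} (ha : LinearIndependent D fun v : Face.vertices f ↦ a v) :
    LinearIndependent D fun i ↦ a ((O.chart f).vertex i) := by
  have h := (O.chart f).vertices_eq
  exact ha.comp (fun i ↦ (⟨(O.chart f).vertex i, h ▸ mem_range_self i⟩ : Face.vertices f))
    fun i j hij ↦ (O.chart f).vertex_injective (congrArg Subtype.val hij)

theorem linearIndependent_endpoints {E : Type*} [AddCommGroup E] [Module D E]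
    {a : Vertex S → E}
    (ha : ∀ f : Face S, LinearIndependent D fun v : Face.vertices f ↦ a v) (d : O.Dart) :
    LinearIndependent D ![a (src d), a (tgt d)] := by
  have h := (linearIndependent_vertex (O := O) (ha d.1)).comp ![d.2, finRotate _ d.2] (by
    have := finRotate_ne (O.chart d.1).two_le d.2
    intro i j hij
    fin_cases i <;> fin_cases j
    · rfl
    · exact (this hij.symm).elim
    · exact (this hij).elim
    · rfl)
  convert h using 1
  funext i
  fin_cases i <;> rfl

/-- The Menelaus condition at a face says that the product of the ratios of its sides is one. -/
theorem menelaus_iff {B : Edge S → ProjSpace D n} {f : Face S} {a : Vertex S → Fin (n + 1) → D}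
    (ha : LinearIndependent D fun v : Face.vertices f ↦ a v) {g : O.Dart → Dˣ}
    (hB : ∀ d : O.Dart, ∃ c : Dˣ,
      (B (edge d)).rep = (c : D) • (a (src d) - (g d : D) • a (tgt d))) :
    Menelaus B f ↔ hol g (O.boundary f) = 1 := by
  choose c hc using hB
  let e : Fin (O.chart f).m ≃ Face.edges f :=
    (Equiv.ofInjective _ (O.chart f).side_injective).trans
      (Equiv.setCongr (O.chart f).edges_eq.symm)
  have h := linearIndependent_sides_iff (linearIndependent_vertex (O := O) ha) g
  rw [Menelaus, Projectivization.dependent_iff, ← linearIndependent_equiv e]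
  have he : (Projectivization.rep ∘ fun e : Face.edges f ↦ B e) ∘ e =
      (fun i ↦ c ⟨f, i⟩) • fun i ↦ a (src (⟨f, i⟩ : O.Dart)) -
        (g ⟨f, i⟩ : D) • a (tgt (⟨f, i⟩ : O.Dart)) := by
    funext i
    exact hc ⟨f, i⟩
  rw [he, LinearIndependent.units_smul_iff, h, not_not]

theorem edge_vertices_eq (d : O.Dart) : Edge.vertices (edge d) = {src d, tgt d} :=
  (O.chart d.1).edge_vertices_side d.2

variable [ChartedSpace Plane S]

theorem exists_dart_of_mem {e : Edge S} {v w : Vertex S} (hv : v ∈ Edge.vertices e)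
    (hw : w ∈ Edge.vertices e) (hvw : v ≠ w) : ∃ d : O.Dart, edge d = e ∧ src d = v ∧ tgt d = w := by
  obtain ⟨d, rfl⟩ := O.exists_dart e
  rw [edge_vertices_eq] at hv hw
  rcases hv with rfl | rfl <;> rcases hw with rfl | rfl
  · exact (hvw rfl).elim
  · exact ⟨d, rfl, rfl, rfl⟩
  · exact ⟨opp d, edge_opp d, src_opp d, tgt_opp d⟩
  · exact (hvw rfl).elim

/-- The ratios of the sides in a realization. -/
theorem exists_ratio {A : Vertex S → ProjSpace D n} {B : Edge S → ProjSpace D n}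
    (h : IsRealization A B) : ∃ g : O.Dart → Dˣ, (∀ d, g (opp d) = (g d)⁻¹) ∧ ∀ d, ∃ c : Dˣ,
      (B (edge d)).rep = (c : D) • ((A (src d)).rep - (g d : D) • (A (tgt d)).rep) := by
  have hex : ∀ d : O.Dart, ∃ c g : Dˣ,
      (B (edge d)).rep = (c : D) • ((A (src d)).rep - (g : D) • (A (tgt d)).rep) := by
    intro d
    obtain ⟨⟨h1, h2, h3⟩, h4⟩ := h.edge (edge d) (src d) (tgt d)
      (by rw [edge_vertices_eq]; exact Or.inl rfl) (by rw [edge_vertices_eq]; exact Or.inr rfl)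
      (src_ne_tgt d)
    exact exists_rep_eq h1 h2 h3 h4
  choose c g hg using hex
  refine ⟨g, fun d ↦ ?_, fun d ↦ ⟨c d, hg d⟩⟩
  have h' := hg (opp d)
  rw [edge_opp, src_opp, tgt_opp] at h'
  refine eq_inv_of_rep_eq (linearIndependent_endpoints (a := fun v ↦ (A v).rep) (fun f ↦ ?_) d)
    (hg d) h'
  exact Projectivization.independent_iff.1 (h.face f)

theorem exists_ratio_of_menelaus {A : Vertex S → ProjSpace D n} {B : Edge S → ProjSpace D n}
    (h : IsRealization A B) : ∃ g : O.Dart → Dˣ, (∀ d, g (opp d) = (g d)⁻¹) ∧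
      ∀ f, Menelaus B f ↔ hol g (O.boundary f) = 1 := by
  obtain ⟨g, hg, hB⟩ := exists_ratio (O := O) h
  exact ⟨g, hg, fun f ↦ menelaus_iff (a := fun v ↦ (A v).rep)
    (Projectivization.independent_iff.1 (h.face f)) hB⟩

variable (O) in
/-- A realization with prescribed ratios of the sides. -/
theorem exists_realization [Infinite D]
    (hcard : ∀ f : Face S, (Face.vertices f).ncard ≤ n + 1) (g : O.Dart → Dˣ)
    (hg : ∀ d, g (opp d) = (g d)⁻¹) :
    ∃ (A : Vertex S → ProjSpace D n) (B : Edge S → ProjSpace D n), IsRealization A B ∧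
      ∀ f, Menelaus B f ↔ hol g (O.boundary f) = 1 := by
  have := finite_cell O.isPolygonal 0
  obtain ⟨a, ha⟩ := exists_general_position (D := D) (E := Fin (n + 1) → D) (Vertex S)
  have hface : ∀ f : Face S, LinearIndependent D fun v : Face.vertices f ↦ a v := by
    intro f
    have hf := (Face.vertices f).toFinite
    have h := ha hf.toFinset (by
      rw [← ncard_eq_toFinset_card _ hf, Module.finrank_fintype_fun_eq_card, Fintype.card_fin]
      exact hcard f)
    rw [Finite.coe_toFinset] at h
    exact h
  have hne : ∀ v, a v ≠ 0 := by
    intro v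
    have h := ha {v} (by simp)
    exact LinearIndependent.ne_zero (⟨v, by simp⟩ : (({v} : Finset (Vertex S)) : Set (Vertex S))) h
  have hpair := linearIndependent_endpoints (O := O) hface
  have hb : ∀ d : O.Dart, a (src d) - (g d : D) • a (tgt d) ≠ 0 := by
    intro d h
    have := (LinearIndependent.pair_iff.1 (hpair d) 1 (-(g d : D)) (by
      rw [one_smul, neg_smul, ← sub_eq_add_neg, h])).1
    exact one_ne_zero this
  let B : Edge S → ProjSpace D n := fun e ↦ .mk D _ (hb (O.edgeDart e))
  have hB' : ∀ d d' : O.Dart, d' = d ∨ d' = opp d → ∃ c : Dˣ,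
      (Projectivization.mk D _ (hb d')).rep =
        (c : D) • (a (src d) - (g d : D) • a (tgt d)) := by
    intro d d' h
    obtain ⟨u, hu⟩ := Projectivization.exists_smul_eq_mk_rep D _ (hb d')
    rw [Units.smul_def] at hu
    rcases h with rfl | rfl
    · exact ⟨u, hu.symm⟩
    · refine ⟨-(u * (g d)⁻¹), hu.symm.trans ?_⟩
      rw [src_opp, tgt_opp, hg, Units.val_neg, Units.val_mul, neg_smul, smul_sub, smul_sub,
        smul_smul, smul_smul, mul_assoc (u : D), Units.inv_mul, mul_one, neg_sub]
  have hB : ∀ d : O.Dart, ∃ c : Dˣ,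
      (B (edge d)).rep = (c : D) • (a (src d) - (g d : D) • a (tgt d)) := fun d ↦
    hB' d _ (edgeDart_eq d)
  refine ⟨fun v ↦ .mk D (a v) (hne v), B, ⟨fun e v w hv hw hvw ↦ ?_, fun f ↦ ?_⟩, fun f ↦
    menelaus_iff (hface f) hB⟩
  · obtain ⟨d, rfl, rfl, rfl⟩ := exists_dart_of_mem (O := O) hv hw hvw
    obtain ⟨c, hc⟩ := hB d
    exact ne_and_dependent_of_rep_eq _ _ (hpair d) hc
  · exact .mk _ (fun v : Face.vertices f ↦ hne v) (hface f)

end OrientedSubdivision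

/-! ### Validity and failure of the incidence theorem -/

theorem IsRealization.ncard_vertices_le {S : Type*} [TopologicalSpace S]
    [CWComplex (univ : Set S)] {D : Type*} [DivisionRing D] {n : ℕ} {A : Vertex S → ProjSpace D n}
    {B : Edge S → ProjSpace D n} (h : IsRealization A B) (f : Face S) :
    (Face.vertices f).ncard ≤ n + 1 := by
  have hli := Projectivization.independent_iff.1 (h.face f)
  have := hli.finite
  have := Fintype.ofFinite (Face.vertices f)
  have h1 := hli.fintype_card_le_finrank
  rwa [Module.finrank_fintype_fun_eq_card, Fintype.card_fin, ← Nat.card_eq_fintype_card] at h1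

namespace OrientedSubdivision

variable {S : Type*} [TopologicalSpace S] [T2Space S] [ConnectedSpace S]
  [CWComplex (univ : Set S)] [ChartedSpace Plane S]

theorem nonempty_face (O : OrientedSubdivision S) : Nonempty (Face S) := by
  obtain ⟨x⟩ := (inferInstance : Nonempty S)
  obtain ⟨f, -⟩ := mem_iUnion.1 (O.iUnion_closedCell.ge (mem_univ x))
  exact ⟨f⟩

/-- The faces can be merged into a single polygon. -/
theorem exists_merged (O : OrientedSubdivision S) (f₀ : Face S) :
    ∃ w R, O.gluing.Merged f₀ univ w R := by
  have := finite_cell O.isPolygonal 2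
  exact O.gluing.exists_merged_univ f₀ O.exists_crossing_dart

variable {D : Type*} [DivisionRing D] {n : ℕ}

/-- If the merged polygon does not fold up, ratios can be chosen whose holonomies are trivial around
all faces but `f₀`, and equal to the commutator of two noncommuting units around `f₀`. -/
theorem exists_counterexample (O : OrientedSubdivision S)
    (hcard : ∀ f : Face S, (Face.vertices f).ncard ≤ n + 1) (hD : ¬ IsField D)
    (hS : ¬ IsTwoSphere S) (f₀ : Face S) :
    ∃ (A : Vertex S → ProjSpace D n) (B : Edge S → ProjSpace D n), IsRealization A B ∧
      (∀ f, f ≠ f₀ → Menelaus B f) ∧ ¬ Menelaus B f₀ := by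
  have : Infinite D := by
    by_contra hfin
    rw [not_infinite_iff_finite] at hfin
    exact hD (Finite.isDomain_to_isField D)
  obtain ⟨x, y, hxy⟩ : ∃ x y : D, x * y ≠ y * x := by
    by_contra! hcomm
    exact hD ⟨⟨0, 1, zero_ne_one⟩, hcomm, fun {a} ha ↦ ⟨a⁻¹, mul_inv_cancel₀ ha⟩⟩
  have hx : x ≠ 0 := by
    rintro rfl
    simp at hxy
  have hy : y ≠ 0 := by
    rintro rfl
    simp at hxy
  obtain ⟨w, R, hm⟩ := O.exists_merged f₀
  obtain hw | ⟨a, b, hab⟩ := O.gluing.folds_or_crossing hm.nodup hm.opp_mem_word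
  · exact (hS (O.gluedSpace.isTwoSphere (hasConnectedPuncturedNhds_of_chartedSpace S) hm hw)).elim
  obtain ⟨g, hg, hflat, h₀⟩ :=
    PolygonGluing.exists_hol_eq_commutator hm hab (Units.mk0 x hx) (Units.mk0 y hy)
  obtain ⟨A, B, hAB, hMen⟩ := O.exists_realization hcard g hg
  refine ⟨A, B, hAB, fun f hf ↦ (hMen f).2 (hflat f hf), fun hf₀ ↦ hxy ?_⟩
  have h1 := h₀.symm.trans ((hMen f₀).1 hf₀)
  rw [mul_inv_eq_one, mul_inv_eq_iff_eq_mul] at h1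
  exact congrArg Units.val h1

variable {A : Vertex S → ProjSpace D n} {B : Edge S → ProjSpace D n} {f₀ : Face S}

/-- Over a field, every letter of the merged boundary word cancels against its opposite. -/
theorem menelaus_of_isField (O : OrientedSubdivision S) (hD : IsField D)
    (hAB : IsRealization A B) (hB : ∀ f, f ≠ f₀ → Menelaus B f) : Menelaus B f₀ := by
  obtain ⟨g, hg, hMen⟩ := exists_ratio_of_menelaus (O := O) hAB
  obtain ⟨w, R, hm⟩ := O.exists_merged f₀
  let _ : CommGroup Dˣ :=
    { (inferInstance : Group Dˣ) with mul_comm := fun x y ↦ Units.ext (hD.mul_comm x y) }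
  exact (hMen f₀).2 (hm.hol_eq_one_of_comm hg fun f hf ↦ (hMen f).1 (hB f hf))

/-- On a sphere, the merged boundary word folds up. -/
theorem menelaus_of_isTwoSphere [CompactSpace S] (O : OrientedSubdivision S)
    (hS : IsTwoSphere S) (hAB : IsRealization A B) (hB : ∀ f, f ≠ f₀ → Menelaus B f) :
    Menelaus B f₀ := by
  obtain ⟨g, hg, hMen⟩ := exists_ratio_of_menelaus (O := O) hAB
  obtain ⟨w, R, hm⟩ := O.exists_merged f₀
  have hw := hm.folds_of_cohomology fun g hg hflat ↦ exists_potential_of_isTwoSphere hS g hg hflat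
  have h1 := hm.hol_eq hg fun f _ hf ↦ (hMen f).1 (hB f hf)
  exact (hMen f₀).2 (h1.symm.trans (hw.hol_eq_one hg))

end OrientedSubdivision

end SurfaceIncidence

theorem theorem2p5
    {S : Type*} [TopologicalSpace S] [T2Space S] [CompactSpace S] [ConnectedSpace S]
    [ChartedSpace (EuclideanSpace ℝ (Fin 2)) S]
    [CWComplex (Set.univ : Set S)]
    (hP : SurfaceIncidence.IsPolygonalSubdivision S)
    (hor : SurfaceIncidence.IsOrientable S)
    (D : Type*) [DivisionRing D] (n : ℕ) :
    (SurfaceIncidence.IncidenceTheorem S D n ↔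
      (∃ f : SurfaceIncidence.Face S, n + 1 < (SurfaceIncidence.Face.vertices f).ncard) ∨
      IsField D ∨
      SurfaceIncidence.IsTwoSphere S) ∧
    ((∀ f : SurfaceIncidence.Face S, (SurfaceIncidence.Face.vertices f).ncard ≤ n + 1) →
      ¬ IsField D → ¬ SurfaceIncidence.IsTwoSphere S →
      ∀ f₀ : SurfaceIncidence.Face S,
        ∃ (A : SurfaceIncidence.Vertex S → SurfaceIncidence.ProjSpace D n)
          (B : SurfaceIncidence.Edge S → SurfaceIncidence.ProjSpace D n),
          SurfaceIncidence.IsRealization A B ∧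
          (∀ f, f ≠ f₀ → SurfaceIncidence.Menelaus B f) ∧
          ¬ SurfaceIncidence.Menelaus B f₀) := by
  obtain ⟨c, hc⟩ := hor
  let O : SurfaceIncidence.OrientedSubdivision S := ⟨hP, c, hc⟩
  have counterexample := O.exists_counterexample (D := D) (n := n)
  refine ⟨⟨fun h ↦ ?_, ?_⟩, counterexample⟩
  · by_contra! hno
    obtain ⟨f₀⟩ := O.nonempty_face
    obtain ⟨A, B, hAB, hne, h₀⟩ := counterexample hno.1 hno.2.1 hno.2.2 f₀
    exact h₀ (h A B hAB f₀ hne)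
  · rintro (⟨f, hf⟩ | hD | hS) A B hAB f₀ hB
    · exact absurd (hAB.ncard_vertices_le f) hf.not_ge
    · exact O.menelaus_of_isField hD hAB hB
    · exact O.menelaus_of_isTwoSphere hS hAB hB
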